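/- **Theorem (Nodal convergence).** *Model and semi-discrete problem.* Let $d\in\{2,3\}$, $\Gamma=(0,1)^{d-1}\times\{0\}$, $\Omega_1=(0,1)^{d-1}\times(0,1)$, $\Omega_2=(0,1)^{d-1}\times(-1,0)$ and $\Gamma_i=\partial\Omega_i\setminus\Gamma$. Let $\nu_i>0$ and $b_{i,j}$ be real constants, let $\mathbf s_i\in W^{1,\infty}(\Omega_i)^d$ be tangential to $\partial\Omega_i$, and let $f_i(t)\in L^2(\Omega_i)$, $g_i(t)\in L^2(\Gamma)$, $u_i^0\in L^2(\Omega_i)$. Fix conforming meshes of $\overline\Omega_1$ and $\overline\Omega_2$ that coincide on $\Gamma$, both consisting of triangles/tetrahedra or both of convex quadrilaterals/parallelepipeds, and $k\ge1$. Let $U_i$ be the space of continuous functions on $\overline\Omega_i$ that vanish on $\Gamma_i$ and are polynomials on every cell, of total degree at most $k$ in the first case and of degree at most $k$ in each coordinate in the second; let $U_\Gamma$ be the analogous space on the induced partition of $\overline\Gamma$, with zero values on $\partial\Gamma$. Write $(\cdot,\cdot)$, $\|\cdot\|$ for the inner product and norm of $L^2(\Omega_i)$, $(\cdot,\cdot)_\Gamma$,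 $\|\cdot\|_\Gamma$ for those of $L^2(\Gamma)$, and $L(v,w)=\int_{\Omega_i}\nu_i\nabla v\cdot\nabla w+\int_{\Omega_i}\nabla\cdot(\mathbf s_iv)\,w$. Assume that $c_1\|v\|_{H^1}^2\le L(v,v)\le c_2\|v\|_{H^1}^2$ on $U_i$ with some $c_1,c_2>0$. Let $t_f>0$, and let $u_i:[0,t_f]\to U_i$ (absolutely continuous) and $F_i:(0,t_f]\to U_\Gamma$ satisfy, for almost every $t$ and $i=1,2$, $$(\dot u_i,v)=-L(u_i,v)-(F_i,v)_\Gamma+(f_i,v)\ \ \forall v\in U_i,\qquad (F_i,\mu)_\Gamma=(b_{i,1}u_1+b_{i,2}u_2-g_i,\mu)_\Gamma\ \ \forall\mu\in U_\Gamma,$$ and $(u_i(0),v)=(u_i^0,v)$ for all $v\in U_i$. *Method.* Let $q,n_s,k_s,r_1,r_2\ge0$ be integers with $n_s\le q+1$, $\theta_1<\dots<\theta_{n_s}\le1$ real numbers and $\mathbb D$ a real $n_s\times(k_s+1)$ matrix. Let $\psi_0,\dots,\psi_q$ be $L^2(-1,1)$-orthogonal polynomials, $\psi_j$ nonzero of degree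 at most $j$, and assume that the matrix $\big(\psi_{k+q-n_s}(2\theta_j-1)\big)_{1\le j,k\le n_s}$ is nonsingular (no condition if $n_s=0$). Given $N,M_1,M_2\ge1$, put $\Delta t=t_f/N$, $\Delta t_i=\Delta t/M_i$; let $t^{\tilde n}=\tilde n\Delta t$ be the synchronization times, $I^{\tilde n}=(t^{\tilde n-1},t^{\tilde n})$ the coupling windows, and on window $\tilde n$ let $t_i^n=t^{\tilde n-1}+n\Delta t_i$, $I_i^n=(t_i^{n-1},t_i^n)$. The unknowns are side values $U_i^n\in U_i$ at the times $t_i^n$ (on each window $U_i^0$ is the value $U_i^{M_i}$ of the preceding window, and $U_i^n$ with $n<0$ likewise belongs to an earlier window), polynomials $u_i^n$ in time of degree at most $q$ with values in $U_i$, one for each $I_i^n$, and polynomials $u_{\Gamma,i}^{\tilde n},F_i^{\tilde n}$ in time of degree at most $r_i$ with values in $U_\Gamma$, one for each window. Fix $N_0\ge1$. The data on the windows $1\le\tilde n<N_0$ are given; on every window $N_0\le\tilde n\le N$ the unknowns satisfy, for $i=1,2$ and $1\le n\le M_i$, $$u_i^n(t_i^{n-1}+\theta_k\Delta t_i)=\sum_{l=1}^{k_s+1}\mathbb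 D_{k,l}\,U_i^{n+1-l},\qquad 1\le k\le n_s,$$ $$(U_i^n,v(t_i^n))-\int_{I_i^n}(u_i^n,\dot v)\,dt=(U_i^{n-1},v(t_i^{n-1}))-\int_{I_i^n}L(u_i^n,v)+(F_i^{\tilde n},v)_\Gamma-(f_i,v)\,dt$$ for all $U_i$-valued polynomials $v$ in time of degree at most $q+1-n_s$, and $$\int_{I^{\tilde n}}(u_{\Gamma,i}^{\tilde n},\lambda)_\Gamma\,dt=\sum_{n=1}^{M_i}\int_{I_i^n}(u_i^n,\lambda)_\Gamma\,dt,\qquad \int_{I^{\tilde n}}(F_i^{\tilde n},\lambda)_\Gamma\,dt=\int_{I^{\tilde n}}(b_{i,1}u_{\Gamma,1}^{\tilde n}+b_{i,2}u_{\Gamma,2}^{\tilde n}-g_i,\lambda)_\Gamma\,dt$$ for all $U_\Gamma$-valued polynomials $\lambda$ in time of degree at most $r_i$. It is assumed that $N_0$ is large enough for the side conditions to involve only nonnegative times on these windows: $k_s\le(N_0-1)M_i+1$ and $(N_0-1)M_i+\theta_k\ge0$. *Assumptions.* (a) $u_i\in H^{q+1}(0,t_f;U_i)$, $u_i|_\Gamma\in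 H^{r_i+1}(0,t_f;U_\Gamma)$ and $F_i\in H^{r_i+1}(0,t_f;U_\Gamma)$ for $i=1,2$. Let $p>0$ and let $K$ be a constant. (b) For $i=1,2$ and $1\le n\le M_i$ on every window $N_0\le\tilde n\le N$, $$\Delta t_i\sum_{k=1}^{n_s}\Big\|u_i(t_i^{n-1}+\theta_k\Delta t_i)-\sum_{l=1}^{k_s+1}\mathbb D_{k,l}u_i(t_i^{n+1-l})\Big\|^2\le K\,\Delta t_i^{2q+2}\int_{t_i^{n-k_s}}^{t_i^n}\sum_{m=0}^{q+1}\|D^{(m)}u_i\|^2\,dt .$$ (c) $\big(\sum_i\|u_i(0)-U_i^0\|^2\big)^{1/2}\le K\Delta t^p$ at the initial time, and $\big(\sum_i\sum_{n=1}^{M_i}\|u_i(t_i^n)-U_i^n\|^2\big)^{1/2}\le K\Delta t^p$ and $\big(\sum_i\sum_{n=1}^{M_i}\int_{I_i^n}\|u_i-u_i^n\|^2dt\big)^{1/2}\le K\Delta t^p$ on each window $1\le\tilde n<N_0$. (d) With $E_i^{\tilde n}:=u_i(t^{\tilde n})-U_i^{M_i}$ ($U_i^{M_i}$ the side value at $t^{\tilde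 n}$) and $$R:=\Big(\Delta t^{q+1-n_s}+\sum_{i=1,2}\Delta t^{r_i+1}\Big)\Big(\Delta t^p+\Delta t^{q+1}+\sum_{i=1,2}\Delta t^{r_i+1}\Big),$$ one has $\big(\sum_i\|E_i^{\tilde m}\|^2\big)^{1/2}\le K R$ for $\tilde m=N_0$ or for $\tilde m=N_0-1$. *Conclusion.* There are $\delta>0$ and $C>0$, which do not depend on $N,M_1,M_2$ (that is, on $\Delta t$, $\Delta t_i$), on $\tilde n$ or on the discrete solution (but may depend on the spatial meshes, the semi-discrete problem and its solution, the parameters $q,n_s,k_s,\theta,\mathbb D,r_i$ of the method, $N_0$, $t_f$, $p$ and $K$), such that whenever $\Delta t\le\delta$, every solution of the multirate method that satisfies the assumptions above has $$\Big\{\sum_{i=1,2}\|E_i^{\tilde n}\|^2\Big\}^{1/2}\le C\Big(\Delta t^{q+1-n_s}+\sum_{i=1,2}\Delta t^{r_i+1}\Big)\Big(\Delta t^p+\Delta t^{q+1}+\sum_{i=1,2}\Delta t^{r_i+1}\Big),\qquad N_0\le\tilde n\le N.$$ Moreover, for each such $\tilde n$ the dual problem with transposed coupling: find $w_i:[0,t_f]\to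 U_i$ and $\Lambda_i:(0,t_f]\to U_\Gamma$ with $$(v,\dot w_i)=L(v,w_i)+(v,\Lambda_i)_\Gamma\ \ \forall v\in U_i,\quad (\Lambda_i,\mu)_\Gamma=(b_{1,i}w_1+b_{2,i}w_2,\mu)_\Gamma\ \ \forall\mu\in U_\Gamma,\quad 0<t\le t_f,\quad w_i(t^{\tilde n})=E_i^{\tilde n},$$ is solvable, and with the same $C$ and $\|E\|^2:=\sum_i\|E_i^{\tilde n}\|^2$ any solution satisfies: (i) with $J=\max\{q+2-n_s,r_1+1,r_2+1\}$, $w_i\in C^J([0,t_f];U_i)$, $\sum_i\sum_{m=0}^{J}\int_0^{t_f}\|D^{(m)}w_i\|^2dt\le C\|E\|^2$ and $\max_{[0,t_f]}\sum_i\|w_i(t)\|^2\le C\|E\|^2$; (ii) if $\hat w_{\Gamma,i}$ is, on each window, the $L^2$-projection of $w_i|_\Gamma$ onto the polynomials in time of degree at most $r_i$, then $\sum_i\int_0^{t_f}\|w_i-\hat w_{\Gamma,i}\|_\Gamma^2dt\le C(\Delta t^{2r_1+2}+\Delta t^{2r_2+2})\|E\|^2$; (iii) there are continuous $\tilde w_i:[0,t_f]\to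 U_i$ that are polynomials in time of degree at most $q+1-n_s$ on every substep, interpolate $w_i$ at $t^{\tilde n}$ and, if $n_s\le q$, at all end points of substeps, and satisfy $\sum_i\sum_{m=0}^1\int_0^{t_f}\|D^{(m)}(w_i-\tilde w_i)\|^2dt\le C\Delta t^{2q+2-2n_s}\|E\|^2$. -/

import Mathlib

open MeasureTheory Set

noncomputable section

namespace Multirate

/-- Points of `ℝⁿ`; the measure on `Pt n` is Lebesgue measure. -/
abbrev Pt (n : ℕ) : Type := Fin n → ℝ

/-- The open box `∏ⱼ (loⱼ, hiⱼ)`. -/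
def openBox {n : ℕ} (lo hi : Pt n) : Set (Pt n) := {x | ∀ j, lo j < x j ∧ x j < hi j}

lemma isOpen_openBox {n : ℕ} (lo hi : Pt n) : IsOpen (openBox lo hi) := by
  have h : openBox lo hi = Set.pi univ (fun j => Ioo (lo j) (hi j)) := by
    ext x; simp [openBox, Set.mem_pi]
  rw [h]
  exact isOpen_set_pi finite_univ (fun j _ => isOpen_Ioo)

lemma isCompact_closure_openBox {n : ℕ} (lo hi : Pt n) :
    IsCompact (closure (openBox lo hi)) := by
  refine (isCompact_Icc (a := lo) (b := hi)).of_isClosed_subset isClosed_closure ?_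
  refine closure_minimal (fun x hx => ?_) isClosed_Icc
  exact ⟨fun j => (hx j).1.le, fun j => (hx j).2.le⟩

/-! ### Meshes and finite element spaces -/

/-- The two kinds of meshes: triangles / tetrahedra, or quadrilaterals / parallelepipeds. -/
inductive CellKind where
  | simplex : CellKind
  | quad : CellKind

/-- A closed cell of the given kind: a nondegenerate simplex; or, for the kind `quad`, a convex
quadrilateral in dimension two and a parallelepiped in dimension three. -/
def IsCell {n : ℕ} (κ : CellKind) (E : Set (Pt n)) : Prop :=
  match κ with
  | CellKind.simplex =>
      ∃ p : Fin (n + 1) → Pt n, AffineIndependent ℝ p ∧ E = convexHull ℝ (range p)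
  | CellKind.quad =>
      (n = 2 ∧ ∃ p : Fin 4 → Pt n, ConvexIndependent ℝ p ∧ E = convexHull ℝ (range p)) ∨
      (n = 3 ∧ ∃ (a : Pt n) (e : Fin n → Pt n), LinearIndependent ℝ e ∧
        E = {x | ∃ c : Fin n → ℝ, (∀ j, c j ∈ Icc (0 : ℝ) 1) ∧ x = a + ∑ j, c j • e j})

/-- The admissible degrees: total degree at most `k` for simplices, degree at most `k` in each
coordinate for quadrilaterals and parallelepipeds. -/
def DegreeLE {n : ℕ} (κ : CellKind) (k : ℕ) (P : MvPolynomial (Fin n) ℝ) : Prop :=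
  match κ with
  | CellKind.simplex => P.totalDegree ≤ k
  | CellKind.quad => ∀ j, P.degreeOf j ≤ k

lemma DegreeLE.add {n : ℕ} {κ : CellKind} {k : ℕ} {P Q : MvPolynomial (Fin n) ℝ}
    (hP : DegreeLE κ k P) (hQ : DegreeLE κ k Q) : DegreeLE κ k (P + Q) := by
  cases κ with
  | simplex => exact (MvPolynomial.totalDegree_add P Q).trans (max_le hP hQ)
  | quad => exact fun j => (MvPolynomial.degreeOf_add_le j P Q).trans (max_le (hP j) (hQ j))

lemma DegreeLE.smul {n : ℕ} {κ : CellKind} {k : ℕ} {P : MvPolynomial (Fin n) ℝ} (c : ℝ)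
    (hP : DegreeLE κ k P) : DegreeLE κ k (MvPolynomial.C c * P) := by
  cases κ with
  | simplex =>
    refine (MvPolynomial.totalDegree_mul _ _).trans ?_
    rw [MvPolynomial.totalDegree_C, zero_add]
    exact hP
  | quad => exact fun j => (MvPolynomial.degreeOf_C_mul_le P j c).trans (hP j)

/-- A conforming mesh of the closure of an open box: finitely many closed cells that cover it,
any two of which meet in a common (possibly empty) face. -/
structure Mesh (κ : CellKind) {n : ℕ} (lo hi : Pt n) where
  cells : Finset (Set (Pt n))
  isCell : ∀ E ∈ cells, IsCell κ E
  cover : (⋃ E ∈ cells, E) = closure (openBox lo hi)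
  conforming : ∀ E ∈ cells, ∀ E' ∈ cells, E ≠ E' →
    IsExposed ℝ E (E ∩ E') ∧ IsExposed ℝ E' (E ∩ E')

/-- Continuous functions on the closed box which are polynomials of order `k` on every cell and
vanish on `Z`.  A function on the closed box is represented by its extension by zero. -/
def feSubmodule {n : ℕ} (κ : CellKind) (k : ℕ) (lo hi : Pt n) (cells : Set (Set (Pt n)))
    (Z : Set (Pt n)) : Submodule ℝ (Pt n → ℝ) where
  carrier := {v | ContinuousOn v (closure (openBox lo hi)) ∧
    (∀ x, x ∉ closure (openBox lo hi) → v x = 0) ∧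
    (∀ E ∈ cells, ∃ P : MvPolynomial (Fin n) ℝ, DegreeLE κ k P ∧
      ∀ x ∈ E, v x = MvPolynomial.eval x P) ∧
    ∀ x ∈ Z, v x = 0}
  add_mem' := by
    rintro v w ⟨hv1, hv2, hv3, hv4⟩ ⟨hw1, hw2, hw3, hw4⟩
    refine ⟨hv1.add hw1, fun x hx => by simp [hv2 x hx, hw2 x hx], fun E hE => ?_,
      fun x hx => by simp [hv4 x hx, hw4 x hx]⟩
    obtain ⟨P, hP, hP'⟩ := hv3 E hE
    obtain ⟨Q, hQ, hQ'⟩ := hw3 E hE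
    exact ⟨P + Q, hP.add hQ, fun x hx => by simp [hP' x hx, hQ' x hx]⟩
  zero_mem' := by
    refine ⟨continuousOn_const, fun x _ => rfl, fun E _ => ⟨0, ?_, fun x _ => by simp⟩,
      fun x _ => rfl⟩
    cases κ with
    | simplex => simp [DegreeLE]
    | quad => intro j; simp
  smul_mem' := by
    rintro c v ⟨hv1, hv2, hv3, hv4⟩
    refine ⟨hv1.const_smul c, fun x hx => by simp [hv2 x hx], fun E hE => ?_,
      fun x hx => by simp [hv4 x hx]⟩
    obtain ⟨P, hP, hP'⟩ := hv3 E hE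
    exact ⟨MvPolynomial.C c * P, hP.smul c, fun x hx => by simp [hP' x hx]⟩

/-- The finite element space, as a type of its own: it will carry the `L²` inner product over the
open box (and not the topology of pointwise convergence). -/
def FESpace {n : ℕ} (κ : CellKind) (k : ℕ) (lo hi : Pt n) (cells : Set (Set (Pt n)))
    (Z : Set (Pt n)) : Type :=
  ↥(feSubmodule κ k lo hi cells Z)

section FESpace

variable {n : ℕ} {κ : CellKind} {k : ℕ} {lo hi : Pt n} {cells : Set (Set (Pt n))} {Z : Set (Pt n)}

instance : AddCommGroup (FESpace κ k lo hi cells Z) :=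
  inferInstanceAs (AddCommGroup ↥(feSubmodule κ k lo hi cells Z))

instance : Module ℝ (FESpace κ k lo hi cells Z) :=
  inferInstanceAs (Module ℝ ↥(feSubmodule κ k lo hi cells Z))

/-- Elements of the space are functions. -/
instance : CoeFun (FESpace κ k lo hi cells Z) (fun _ => Pt n → ℝ) :=
  ⟨fun v => Subtype.val (p := fun w => w ∈ feSubmodule κ k lo hi cells Z) v⟩

lemma FESpace.continuousOn (v : FESpace κ k lo hi cells Z) :
    ContinuousOn (v : Pt n → ℝ) (closure (openBox lo hi)) := v.2.1

lemma FESpace.integrableOn_mul (v w : FESpace κ k lo hi cells Z) :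
    IntegrableOn (fun x => v x * w x) (openBox lo hi) :=
  ((v.continuousOn.mul w.continuousOn).integrableOn_compact
    (isCompact_closure_openBox lo hi)).mono_set subset_closure

lemma FESpace.eq_zero_of_integral (v : FESpace κ k lo hi cells Z)
    (h : ∫ x in openBox lo hi, v x * v x = 0) : v = 0 := by
  have hO := isOpen_openBox lo hi
  have h1 : (fun x => v x * v x) =ᵐ[volume.restrict (openBox lo hi)] 0 :=
    (setIntegral_eq_zero_iff_of_nonneg_ae
      (Filter.Eventually.of_forall fun x => mul_self_nonneg (v x)) (v.integrableOn_mul v)).1 h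
  have h2 : EqOn (fun x => v x * v x) (fun _ => (0 : ℝ)) (openBox lo hi) :=
    Measure.eqOn_open_of_ae_eq h1 hO
      ((v.continuousOn.mul v.continuousOn).mono subset_closure) continuousOn_const
  have h3 : EqOn (fun x => v x) (fun _ => (0 : ℝ)) (openBox lo hi) :=
    fun x hx => mul_self_eq_zero.1 (h2 hx)
  have h4 : EqOn (fun x => v x) (fun _ => (0 : ℝ)) (closure (openBox lo hi)) :=
    h3.of_subset_closure v.continuousOn continuousOn_const subset_closure subset_rfl
  refine Subtype.ext (funext fun x => ?_)
  by_cases hx : x ∈ closure (openBox lo hi)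
  · exact h4 hx
  · exact v.2.2.1 x hx

/-- The `L²` inner product over the open box. -/
@[reducible]
def FESpace.core : InnerProductSpace.Core ℝ (FESpace κ k lo hi cells Z) where
  inner v w := ∫ x in openBox lo hi, v x * w x
  conj_inner_symm v w := by simp [mul_comm]
  re_inner_nonneg v := by
    simpa using integral_nonneg (fun x => mul_self_nonneg (v x))
  add_left v w z := by
    have : (fun x => (v + w) x * z x) = fun x => v x * z x + w x * z x := by
      funext x; exact add_mul (v x) (w x) (z x)
    rw [this]
    exact integral_add (v.integrableOn_mul z) (w.integrableOn_mul z)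
  smul_left v w c := by
    have : (fun x => (c • v) x * w x) = fun x => c * (v x * w x) := by
      funext x; exact mul_assoc c (v x) (w x)
    rw [this, integral_const_mul]
    simp
  definite v h := v.eq_zero_of_integral h

instance : NormedAddCommGroup (FESpace κ k lo hi cells Z) :=
  InnerProductSpace.Core.toNormedAddCommGroup (cd := FESpace.core)

instance : InnerProductSpace ℝ (FESpace κ k lo hi cells Z) :=
  InnerProductSpace.ofCore FESpace.core.toCore

lemma FESpace.inner_eq (v w : FESpace κ k lo hi cells Z) :
    inner ℝ v w = ∫ x in openBox lo hi, v x * w x := rfl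

end FESpace

/-! ### The two subdomains and the interface

The space dimension is `d = m + 1`.  The index `0 : Fin 2` stands for the first subdomain
`(0,1)^m × (0,1)`, the index `1 : Fin 2` for the second one, `(0,1)^m × (-1,0)`. -/

def lo (m : ℕ) (i : Fin 2) : Pt (m + 1) :=
  Fin.snoc (α := fun _ => ℝ) (fun _ => 0) (if i = 0 then 0 else -1)

def hi (m : ℕ) (i : Fin 2) : Pt (m + 1) :=
  Fin.snoc (α := fun _ => ℝ) (fun _ => 1) (if i = 0 then 1 else 0)

/-- The open subdomain `Ω_i`. -/
def Omega (m : ℕ) (i : Fin 2) : Set (Pt (m + 1)) := openBox (lo m i) (hi m i)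

/-- The inclusion `y ↦ (y, 0)` of the hyperplane of the interface. -/
def emb {m : ℕ} (y : Pt m) : Pt (m + 1) := Fin.snoc (α := fun _ => ℝ) y 0

/-- The interface `Γ = (0,1)^m × {0}`, in the coordinates of its hyperplane. -/
def Gam (m : ℕ) : Set (Pt m) := openBox 0 1

/-- The exterior boundary `Γ_i = ∂Ω_i \ Γ`. -/
def extBoundary (m : ℕ) (i : Fin 2) : Set (Pt (m + 1)) :=
  frontier (Omega m i) \ (emb '' Gam m)

/-- The partition of the interface induced by a set of cells: their faces lying in the hyperplane
of the interface. -/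
def faces {m : ℕ} (cells : Set (Set (Pt (m + 1)))) : Set (Set (Pt m)) :=
  {T | ∃ E ∈ cells, T = {y | emb y ∈ E} ∧ (interior T).Nonempty}

/-- Spatial discretization: conforming meshes of both subdomains which coincide on the interface,
and the polynomial order `k ≥ 1`. -/
structure Spatial (m : ℕ) where
  kind : CellKind
  k : ℕ
  one_le_k : 1 ≤ k
  mesh : ∀ i : Fin 2, Mesh kind (lo m i) (hi m i)
  coincide : faces ((mesh 0).cells : Set (Set (Pt (m + 1)))) =
    faces ((mesh 1).cells : Set (Set (Pt (m + 1))))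

/-- The finite element space `U_i`, with the inner product and the norm of `L²(Ω_i)`. -/
abbrev Spatial.FE {m : ℕ} (S : Spatial m) (i : Fin 2) : Type :=
  FESpace S.kind S.k (lo m i) (hi m i) ((S.mesh i).cells : Set (Set (Pt (m + 1))))
    (extBoundary m i)

/-- The finite element trace space `U_Γ`, with the inner product and the norm of `L²(Γ)`. -/
abbrev Spatial.TraceFE {m : ℕ} (S : Spatial m) : Type :=
  FESpace S.kind S.k (0 : Pt m) 1 (faces ((S.mesh 0).cells : Set (Set (Pt (m + 1)))))
    (frontier (Gam m))

/-- The trace on the interface. -/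
def trace {m : ℕ} (v : Pt (m + 1) → ℝ) : Pt m → ℝ := fun y => v (emb y)

/-- `(v, w) = ∫_{Ω_i} v w`, for functions that need not be finite element functions. -/
def pairOmega {m : ℕ} (i : Fin 2) (v w : Pt (m + 1) → ℝ) : ℝ := ∫ x in Omega m i, v x * w x

/-- `(μ, λ)_Γ = ∫_Γ μ λ`. -/
def pairGam {m : ℕ} (μ l : Pt m → ℝ) : ℝ := ∫ y in Gam m, μ y * l y

/-- Constant coefficients, and steady advection fields which are of class `W^{1,∞}` (that is,
Lipschitz, the subdomains being convex) and tangential to the boundaries of the subdomains. -/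
structure Coeffs (m : ℕ) where
  ν : Fin 2 → ℝ
  ν_pos : ∀ i, 0 < ν i
  b : Fin 2 → Fin 2 → ℝ
  s : Fin 2 → Pt (m + 1) → Pt (m + 1)
  s_lipschitz : ∀ i, ∃ K, LipschitzOnWith K (s i) (closure (Omega m i))
  s_tangential : ∀ i, ∀ x ∈ closure (Omega m i), ∀ j,
    (x j = lo m i j ∨ x j = hi m i j) → s i x j = 0

/-- The `j`-th partial derivative; for the piecewise smooth functions below it exists almost
everywhere and is the weak derivative. -/
def pd {n : ℕ} (j : Fin n) (v : Pt n → ℝ) (x : Pt n) : ℝ := fderiv ℝ v x (Pi.single j 1)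

/-- The bilinear form
`L(v, w) = ∫_{Ω_i} ν_i ∇v · ∇w + ∫_{Ω_i} ∇ · (s_i v) w`. -/
def Coeffs.L {m : ℕ} (A : Coeffs m) (i : Fin 2) (v w : Pt (m + 1) → ℝ) : ℝ :=
  (∫ x in Omega m i, A.ν i * ∑ j, pd j v x * pd j w x) +
    ∫ x in Omega m i, (∑ j, pd j (fun z => A.s i z j * v z) x) * w x

/-- The square of the norm of `H¹(Ω_i)`. -/
def h1sq {m : ℕ} (i : Fin 2) (v : Pt (m + 1) → ℝ) : ℝ :=
  (∫ x in Omega m i, v x ^ 2) + ∫ x in Omega m i, ∑ j, pd j v x ^ 2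

/-- Coercivity and continuity of the form `L` on `U_i`. -/
def Coercive {m : ℕ} (S : Spatial m) (A : Coeffs m) : Prop :=
  ∀ i, ∃ c₁ c₂ : ℝ, 0 < c₁ ∧ 0 < c₂ ∧ ∀ v : S.FE i,
    c₁ * h1sq i v ≤ A.L i v v ∧ A.L i v v ≤ c₂ * h1sq i v

/-- Forcings `f_i`, interface forcings `g_i`, initial values `u_i⁰`, square integrable in space. -/
structure Loads (m : ℕ) where
  f : Fin 2 → ℝ → Pt (m + 1) → ℝ
  g : Fin 2 → ℝ → Pt m → ℝ
  u₀ : Fin 2 → Pt (m + 1) → ℝ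
  f_memLp : ∀ i t, MemLp (f i t) 2 (volume.restrict (Omega m i))
  g_memLp : ∀ i t, MemLp (g i t) 2 (volume.restrict (Gam m))
  u₀_memLp : ∀ i, MemLp (u₀ i) 2 (volume.restrict (Omega m i))

/-! ### Functions of time -/

section Time

variable {V : Type*} [NormedAddCommGroup V] [InnerProductSpace ℝ V]

/-- `v` is absolutely continuous on `[0, T]` with almost everywhere derivative `v'` (tested against
the elements of the finite dimensional space `V`). -/
def IsTimeDeriv (T : ℝ) (v v' : ℝ → V) : Prop :=
  ∀ φ : V, IntervalIntegrable (fun t => inner ℝ (v' t) φ) volume 0 T ∧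
    ∀ t ∈ Icc 0 T, inner ℝ (v t) φ = inner ℝ (v 0) φ + ∫ s in (0 : ℝ)..t, inner ℝ (v' s) φ

/-- `v` belongs to the Sobolev space `H^k((0, T); V)`, and `D m` is its `m`-th weak derivative for
`m ≤ k`. -/
def IsSobolev (k : ℕ) (T : ℝ) (v : ℝ → V) (D : ℕ → ℝ → V) : Prop :=
  v =ᵐ[volume.restrict (Ioc 0 T)] D 0 ∧
  (∀ m < k, IsTimeDeriv T (D m) (D (m + 1))) ∧
  ∀ m ≤ k, MemLp (D m) 2 (volume.restrict (Ioc 0 T))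

/-- Polynomials in time of degree at most `q` with coefficients in `V` (as functions on all
of `ℝ`). -/
def IsTimePoly (q : ℕ) (v : ℝ → V) : Prop :=
  ∃ c : Fin (q + 1) → V, ∀ t, v t = ∑ j : Fin (q + 1), t ^ (j : ℕ) • c j

end Time

/-- The semi-discrete problem on `[0, T]`: the states `u i` are absolutely continuous, the
equations hold for almost every time. -/
def IsSemiDiscrete {m : ℕ} (S : Spatial m) (A : Coeffs m) (d : Loads m) (T : ℝ)
    (u : ∀ i, ℝ → S.FE i) (F : Fin 2 → ℝ → S.TraceFE) : Prop :=
  (∃ u' : ∀ i, ℝ → S.FE i, ∀ i, IsTimeDeriv T (u i) (u' i) ∧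
    ∀ᵐ t ∂volume.restrict (Ioc 0 T), ∀ v : S.FE i,
      inner ℝ (u' i t) v =
        -A.L i (u i t) v - pairGam (F i t) (trace v) + pairOmega i (d.f i t) v) ∧
  (∀ i, ∀ v : S.FE i, inner ℝ (u i 0) v = pairOmega i (d.u₀ i) v) ∧
  ∀ i, ∀ᵐ t ∂volume.restrict (Ioc 0 T), ∀ μ : S.TraceFE,
    inner ℝ (F i t) μ =
      pairGam (fun y => A.b i 0 * trace (u 0 t) y + A.b i 1 * trace (u 1 t) y - d.g i t y) μ

/-! ### The multirate method -/

/-- The parameters of the time stepping method: the order `q` in time, the `ns` side conditions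
with points `θ` and coefficient matrix `D`, the number of steps `ks`, and the orders `r i` on the
coupling windows. -/
structure Method where
  q : ℕ
  ns : ℕ
  ks : ℕ
  ns_le : ns ≤ q + 1
  θ : Fin ns → ℝ
  θ_strictMono : StrictMono θ
  θ_le_one : ∀ k, θ k ≤ 1
  D : Matrix (Fin ns) (Fin (ks + 1)) ℝ
  r : Fin 2 → ℕ

/-- `ψ 0, …, ψ q` are `L²(-1,1)`-orthogonal polynomials, `ψ j` of degree at most `j`, which form a
basis of the polynomials of degree at most `q`. -/
def IsOrthogonalBasis (q : ℕ) (ψ : ℕ → Polynomial ℝ) : Prop :=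
  (∀ j ≤ q, ψ j ≠ 0 ∧ (ψ j).natDegree ≤ j) ∧
  ∀ j ≤ q, ∀ l ≤ q, j ≠ l → ∫ x in (-1 : ℝ)..1, (ψ j).eval x * (ψ l).eval x = 0

/-- The matrix with entries `ψ_{k+q-ns}(2 θ_j - 1)`, `1 ≤ j, k ≤ ns` (the Lean indices start
at `0`). -/
def Method.Dtilde (Q : Method) (ψ : ℕ → Polynomial ℝ) : Matrix (Fin Q.ns) (Fin Q.ns) ℝ :=
  fun j k => (ψ ((k : ℕ) + 1 + Q.q - Q.ns)).eval (2 * Q.θ j - 1)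

/-- `N` coupling windows of equal length on `[0, T]`, each with `M i` substeps on subdomain `i`. -/
structure Grid where
  N : ℕ
  M : Fin 2 → ℕ
  N_pos : 0 < N
  M_pos : ∀ i, 0 < M i

/-- The window size `Δt`. -/
def Grid.dt (G : Grid) (T : ℝ) : ℝ := T / G.N

/-- The substep size `Δt_i`. -/
def Grid.dti (G : Grid) (T : ℝ) (i : Fin 2) : ℝ := G.dt T / G.M i

/-- The synchronization time `w Δt`. -/
def Grid.sync (G : Grid) (T : ℝ) (w : ℕ) : ℝ := w * G.dt T

/-- The end point `j Δt_i` of the `j`-th substep, counted from time zero. -/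
def Grid.node (G : Grid) (T : ℝ) (i : Fin 2) (j : ℕ) : ℝ := j * G.dti T i

/-- The index, counted from time zero, of substep `n` of window `w ≥ 1`. -/
def Grid.idx (G : Grid) (i : Fin 2) (w n : ℕ) : ℕ := (w - 1) * G.M i + n

/-- The discrete unknowns.  Substeps are counted from time zero: `U i j` is the side value at time
`j Δt_i`, and `u i j` is the state polynomial on the substep `((j - 1) Δt_i, j Δt_i)`.  The
projected traces `uΓ i w` and the fluxes `F i w` belong to the coupling window `w`. -/
structure Discrete {m : ℕ} (S : Spatial m) where
  U : ∀ i, ℕ → S.FE i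
  u : ∀ i, ℕ → ℝ → S.FE i
  uΓ : Fin 2 → ℕ → ℝ → S.TraceFE
  F : Fin 2 → ℕ → ℝ → S.TraceFE

/-- The side conditions and the variational equations of the substep `j` of subdomain `i`, which
belongs to the window `w`. -/
def SubstepEquations {m : ℕ} {S : Spatial m} (A : Coeffs m) (d : Loads m) (T : ℝ) (Q : Method)
    (G : Grid) (X : Discrete S) (i : Fin 2) (w j : ℕ) : Prop :=
  (∀ k, X.u i j (G.node T i (j - 1) + Q.θ k * G.dti T i) =
    ∑ l : Fin (Q.ks + 1), Q.D k l • X.U i (j - (l : ℕ))) ∧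
  ∀ v : ℝ → S.FE i, IsTimePoly (Q.q + 1 - Q.ns) v →
    inner ℝ (X.U i j) (v (G.node T i j)) -
        (∫ t in (G.node T i (j - 1))..(G.node T i j), inner ℝ (X.u i j t) (deriv v t)) =
      inner ℝ (X.U i (j - 1)) (v (G.node T i (j - 1))) -
        ∫ t in (G.node T i (j - 1))..(G.node T i j),
          (A.L i (X.u i j t) (v t) + pairGam (X.F i w t) (trace (v t))
            - pairOmega i (d.f i t) (v t))

/-- The equations for the projected traces and the fluxes on the coupling window `w`. -/
def WindowEquations {m : ℕ} {S : Spatial m} (A : Coeffs m) (d : Loads m) (T : ℝ) (Q : Method)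
    (G : Grid) (X : Discrete S) (i : Fin 2) (w : ℕ) : Prop :=
  IsTimePoly (Q.r i) (X.uΓ i w) ∧ IsTimePoly (Q.r i) (X.F i w) ∧
  ∀ l : ℝ → S.TraceFE, IsTimePoly (Q.r i) l →
    (∫ t in (G.sync T (w - 1))..(G.sync T w), inner ℝ (X.uΓ i w t) (l t)) =
        ∑ n ∈ Finset.Icc 1 (G.M i),
          ∫ t in (G.node T i (G.idx i w n - 1))..(G.node T i (G.idx i w n)),
            pairGam (trace (X.u i (G.idx i w n) t)) (l t) ∧
    (∫ t in (G.sync T (w - 1))..(G.sync T w), inner ℝ (X.F i w t) (l t)) =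
        ∫ t in (G.sync T (w - 1))..(G.sync T w),
          pairGam (fun y => A.b i 0 * X.uΓ 0 w t y + A.b i 1 * X.uΓ 1 w t y - d.g i t y) (l t)

/-- The monolithic multirate scheme.  The data on the windows `1 ≤ w < N₀` are given, the scheme
is solved on the windows `N₀ ≤ w ≤ N`. -/
def IsMultirateSolution {m : ℕ} {S : Spatial m} (A : Coeffs m) (d : Loads m) (T : ℝ) (Q : Method)
    (N₀ : ℕ) (G : Grid) (X : Discrete S) : Prop :=
  (∀ i, ∀ j ∈ Finset.Icc 1 (G.N * G.M i), IsTimePoly Q.q (X.u i j)) ∧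
  ∀ w ∈ Finset.Icc N₀ G.N, ∀ i,
    (∀ n ∈ Finset.Icc 1 (G.M i), SubstepEquations A d T Q G X i w (G.idx i w n)) ∧
    WindowEquations A d T Q G X i w

/-- `N₀` is large enough: the side conditions on the windows `w ≥ N₀` only use side values and
points at nonnegative times. -/
def ReachesBack (Q : Method) (N₀ : ℕ) (G : Grid) : Prop :=
  ∀ i, Q.ks ≤ (N₀ - 1) * G.M i + 1 ∧ ∀ k, 0 ≤ ((N₀ - 1 : ℕ) : ℝ) * G.M i + Q.θ k

/-- The consistency bounds for the side conditions, with constant `K`, on the windows on which the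
scheme is solved. `D i m` is the `m`-th derivative of `u i`. -/
def SideConsistent {m : ℕ} {S : Spatial m} (T : ℝ) (Q : Method) (N₀ : ℕ) (G : Grid)
    (u : ∀ i, ℝ → S.FE i) (D : ∀ i, ℕ → ℝ → S.FE i) (K : ℝ) : Prop :=
  ∀ w ∈ Finset.Icc N₀ G.N, ∀ i, ∀ n ∈ Finset.Icc 1 (G.M i),
    G.dti T i * ∑ k, ‖u i (G.node T i (G.idx i w n - 1) + Q.θ k * G.dti T i) -
        ∑ l : Fin (Q.ks + 1), Q.D k l • u i (G.node T i (G.idx i w n - (l : ℕ)))‖ ^ 2 ≤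
      K * G.dti T i ^ (2 * Q.q + 2) *
        ∫ t in (G.node T i (G.idx i w n - Q.ks))..(G.node T i (G.idx i w n)),
          ∑ a ∈ Finset.range (Q.q + 2), ‖D i a t‖ ^ 2

/-- Accuracy of order `p`, with constant `K`, of the initial values and of the data on the
windows `1 ≤ w < N₀`. -/
def InitAccurate {m : ℕ} {S : Spatial m} (T p : ℝ) (N₀ : ℕ) (G : Grid)
    (u : ∀ i, ℝ → S.FE i) (X : Discrete S) (K : ℝ) : Prop :=
  √(∑ i, ‖u i 0 - X.U i 0‖ ^ 2) ≤ K * G.dt T ^ p ∧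
  ∀ w ∈ Finset.Ico 1 N₀,
    √(∑ i, ∑ n ∈ Finset.Icc 1 (G.M i),
      ‖u i (G.node T i (G.idx i w n)) - X.U i (G.idx i w n)‖ ^ 2) ≤ K * G.dt T ^ p ∧
    √(∑ i, ∑ n ∈ Finset.Icc 1 (G.M i),
      ∫ t in (G.node T i (G.idx i w n - 1))..(G.node T i (G.idx i w n)),
        ‖u i t - X.u i (G.idx i w n) t‖ ^ 2) ≤ K * G.dt T ^ p

/-- The side value errors `u_i(t^w) - U_i^{M_i}` at the synchronization time `t^w`. -/
def sideError {m : ℕ} {S : Spatial m} (T : ℝ) (G : Grid) (u : ∀ i, ℝ → S.FE i) (X : Discrete S)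
    (w : ℕ) (i : Fin 2) : S.FE i :=
  u i (G.sync T w) - X.U i (w * G.M i)

/-- `{∑ᵢ ‖u_i(t^w) - U_i^{M_i}‖²}^{1/2}`. -/
def syncError {m : ℕ} {S : Spatial m} (T : ℝ) (G : Grid) (u : ∀ i, ℝ → S.FE i) (X : Discrete S)
    (w : ℕ) : ℝ :=
  √(∑ i, ‖sideError T G u X w i‖ ^ 2)

/-- `(Δt^{q+1-n_s} + ∑ᵢ Δt^{r_i+1}) (Δt^p + Δt^{q+1} + ∑ᵢ Δt^{r_i+1})`. -/
def rate (Q : Method) (p δt : ℝ) : ℝ :=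
  (δt ^ (Q.q + 1 - Q.ns) + ∑ i, δt ^ (Q.r i + 1)) *
    (δt ^ p + δt ^ (Q.q + 1) + ∑ i, δt ^ (Q.r i + 1))

/-! ### The dual problem -/

/-- The dual problem on `[0, T]`, with values `e i` prescribed at the time `τ`. -/
def IsDual {m : ℕ} {S : Spatial m} (A : Coeffs m) (T τ : ℝ) (e : ∀ i, S.FE i)
    (w : ∀ i, ℝ → S.FE i) (Λ : Fin 2 → ℝ → S.TraceFE) : Prop :=
  (∀ i, ContinuousOn (w i) (Icc 0 T)) ∧
  (∀ i, ∀ t ∈ Ioc 0 T, ∃ w' : S.FE i, HasDerivWithinAt (w i) w' (Icc 0 T) t ∧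
    ∀ v : S.FE i, inner ℝ v w' = A.L i v (w i t) + pairGam (trace v) (Λ i t)) ∧
  (∀ i, ∀ v : S.FE i, inner ℝ (w i τ) v = inner ℝ (e i) v) ∧
  ∀ i, ∀ t ∈ Ioc 0 T, ∀ μ : S.TraceFE,
    inner ℝ (Λ i t) μ =
      pairGam (fun y => A.b 0 i * trace (w 0 t) y + A.b 1 i * trace (w 1 t) y) μ

/-- Regularity bounds for a dual solution with data `e`:
`∑ᵢ ∑_{a ≤ J} ∫₀ᵀ ‖D^{(a)} w_i‖² ≤ C ∑ᵢ ‖e_i‖²`, where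
`J = max {q + 2 - n_s, r_1 + 1, r_2 + 1}`, and `max ∑ᵢ ‖w_i(t)‖² ≤ C ∑ᵢ ‖e_i‖²`. -/
def DualRegularity {m : ℕ} {S : Spatial m} (T : ℝ) (Q : Method) (e : ∀ i, S.FE i)
    (w : ∀ i, ℝ → S.FE i) (C : ℝ) : Prop :=
  (∀ i, ContDiffOn ℝ (max (Q.q + 2 - Q.ns) (max (Q.r 0 + 1) (Q.r 1 + 1)) : ℕ) (w i) (Icc 0 T)) ∧
  (∑ i, ∑ a ∈ Finset.range (max (Q.q + 2 - Q.ns) (max (Q.r 0 + 1) (Q.r 1 + 1)) + 1),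
    ∫ t in (0 : ℝ)..T, ‖iteratedDerivWithin a (w i) (Icc 0 T) t‖ ^ 2) ≤ C * ∑ i, ‖e i‖ ^ 2 ∧
  ∀ t ∈ Icc 0 T, ∑ i, ‖w i t‖ ^ 2 ≤ C * ∑ i, ‖e i‖ ^ 2

/-- The projections `wΓ i k` of `w_i|_Γ` onto the polynomials of order `r_i` on the windows `k`
satisfy `∑ᵢ ∫₀ᵀ ‖w_i - wΓ_i‖_Γ² ≤ C (Δt^{2 r_1 + 2} + Δt^{2 r_2 + 2}) ∑ᵢ ‖e_i‖²`. -/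
def DualProjection {m : ℕ} {S : Spatial m} (T : ℝ) (Q : Method) (G : Grid) (e : ∀ i, S.FE i)
    (w : ∀ i, ℝ → S.FE i) (C : ℝ) : Prop :=
  ∃ wΓ : Fin 2 → ℕ → ℝ → S.TraceFE,
    (∀ i, ∀ k ∈ Finset.Icc 1 G.N, IsTimePoly (Q.r i) (wΓ i k) ∧
      ∀ l : ℝ → S.TraceFE, IsTimePoly (Q.r i) l →
        (∫ t in (G.sync T (k - 1))..(G.sync T k), inner ℝ (wΓ i k t) (l t)) =
          ∫ t in (G.sync T (k - 1))..(G.sync T k), pairGam (trace (w i t)) (l t)) ∧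
    (∑ i, ∑ k ∈ Finset.Icc 1 G.N, ∫ t in (G.sync T (k - 1))..(G.sync T k),
        ∫ y in Gam m, (trace (w i t) y - wΓ i k t y) ^ 2) ≤
      C * (∑ i, G.dt T ^ (2 * Q.r i + 2)) * ∑ i, ‖e i‖ ^ 2

/-- There are globally continuous interpolants `wI_i` of `w_i`, polynomials of order `q + 1 - n_s`
on every substep, which agree with `w_i` at the time `τ` (and, unless they have order zero, at all
the end points of the substeps) and satisfy
`∑ᵢ ∑_{a ≤ 1} ∫₀ᵀ ‖D^{(a)} (w_i - wI_i)‖² ≤ C Δt^{2 q + 2 - 2 n_s} ∑ᵢ ‖e_i‖²`. -/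
def DualInterpolation {m : ℕ} {S : Spatial m} (T τ : ℝ) (Q : Method) (G : Grid)
    (e : ∀ i, S.FE i) (w : ∀ i, ℝ → S.FE i) (C : ℝ) : Prop :=
  ∃ wI : ∀ i, ℝ → S.FE i,
    (∀ i, ContinuousOn (wI i) (Icc 0 T) ∧ wI i τ = w i τ ∧
      (Q.ns ≤ Q.q → ∀ j ≤ G.N * G.M i, wI i (G.node T i j) = w i (G.node T i j)) ∧
      ∀ j ∈ Finset.Icc 1 (G.N * G.M i), ∃ P : ℝ → S.FE i, IsTimePoly (Q.q + 1 - Q.ns) P ∧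
        EqOn (wI i) P (Icc (G.node T i (j - 1)) (G.node T i j))) ∧
    (∑ i, ((∫ t in (0 : ℝ)..T, ‖w i t - wI i t‖ ^ 2) +
        ∫ t in (0 : ℝ)..T, ‖deriv (fun s => w i s - wI i s) t‖ ^ 2)) ≤
      C * G.dt T ^ (2 * (Q.q + 1 - Q.ns)) * ∑ i, ‖e i‖ ^ 2

end Multirate

end

open Multirate

noncomputable section

namespace Multirate

/-! ### Geometry of cells -/

/-! The spaces `S.FE i` and `S.TraceFE` are finite dimensional, so the semi-discrete problem is a
linear system of ODEs and every form and trace in it is a bounded operator; the constants may depend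
on the mesh. The nodal error is a product of two factors. One is the size of the error of the states
in `L²` in time. The other is how well the solution of a dual problem can be approximated by the
test functions of the scheme.

Duality. Subtracting the scheme from the semi-discrete equations gives, on each substep, an identity
for the side value errors at the two end points, tested with polynomials in time
(`substep_error_eq`). Let the dual problem start from the error `E` at the synchronization time. Its
solution is given by a matrix exponential (`exists_linear_flow`), so all its derivatives are bounded
by a multiple of `‖E‖`. A continuous piecewise polynomial interpolant of the dual solution is
admissible in the identity, and the side values telescope to `‖E‖²` minus a term at the starting
time. Replacing the interpolant by the dual solution itself costs a factor `Δt^{q+1-n_s}`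
(`IsRegular.abs_window_identity_le`). For the dual solution the volume terms cancel and only
coupling terms on the interface are left (`IsRegular.sum_window_eq_coupling`). The window equations
are Galerkin projections, so these terms vanish against polynomials on the window and cost a factor
`Δt^{r_i+1}` (`abs_coupling_le`, `exists_coupling_bounds`). Dividing by `‖E‖` gives
`IsRegular.exists_syncError_le`.

The error of the states. The side conditions together with the low moments determine a polynomial of
degree `q`; this is the meaning of the nonsingular matrix
(`IsOrthogonalBasis.eq_zero_of_moments_of_nodes`). The variational equations control the moments, so
the state error on a substep is bounded by side value errors, consistency errors and the residual
(`Method.exists_substep_bound`). The residual is in turn bounded by the state errors on the window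
and the approximation error of traces and fluxes. The resulting inequalities are implicit in the
window but close by a discrete Gronwall argument for small `Δt` (`gronwall_windows`), with the order
`Δt^p + Δt^{q+1} + ∑ Δt^{r_i+1}` (`IsRegular.exists_global_estimate`). The product of the two
factors is the asserted rate. -/

lemma IsCell.isCompact {n : ℕ} {κ : CellKind} {E : Set (Pt n)} (h : IsCell κ E) :
    IsCompact E := by
  cases κ with
  | simplex =>
    obtain ⟨p, -, rfl⟩ := h
    exact (finite_range p).isCompact_convexHull ℝ
  | quad =>
    rcases h with ⟨-, p, -, rfl⟩ | ⟨-, a, e, -, rfl⟩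
    · exact (finite_range p).isCompact_convexHull ℝ
    · have : {x : Pt n | ∃ c : Fin n → ℝ, (∀ j, c j ∈ Icc (0 : ℝ) 1) ∧ x = a + ∑ j, c j • e j} =
          (fun c : Fin n → ℝ => a + ∑ j, c j • e j) '' Icc 0 1 := by
        ext x
        constructor
        · rintro ⟨c, hc, rfl⟩
          exact ⟨c, ⟨fun j => (hc j).1, fun j => (hc j).2⟩, rfl⟩
        · rintro ⟨c, hc, rfl⟩
          exact ⟨c, fun j => ⟨hc.1 j, hc.2 j⟩, rfl⟩
      rw [this]
      exact isCompact_Icc.image (by fun_prop)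

lemma IsCell.convex {n : ℕ} {κ : CellKind} {E : Set (Pt n)} (h : IsCell κ E) :
    Convex ℝ E := by
  cases κ with
  | simplex =>
    obtain ⟨p, -, rfl⟩ := h
    exact convex_convexHull ℝ _
  | quad =>
    rcases h with ⟨-, p, -, rfl⟩ | ⟨-, a, e, -, rfl⟩
    · exact convex_convexHull ℝ _
    · rintro x ⟨c, hc, rfl⟩ y ⟨c', hc', rfl⟩ s t hs ht hst
      refine ⟨s • c + t • c', fun j => ?_, ?_⟩
      · have := (convex_Icc (0 : ℝ) 1) (hc j) (hc' j) hs ht hst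
        simpa using this
      · simp only [smul_add, Finset.smul_sum, Pi.add_apply, Pi.smul_apply, add_smul,
          Finset.sum_add_distrib, smul_assoc]
        have : s • a + t • a = a := by rw [← add_smul, hst, one_smul]
        rw [add_add_add_comm, this]

lemma closure_openBox {n : ℕ} {lo hi : Pt n} (h : ∀ j, lo j < hi j) :
    closure (openBox lo hi) = Icc lo hi := by
  have h' : openBox lo hi = Set.pi univ (fun j => Ioo (lo j) (hi j)) := by
    ext x; simp [openBox, Set.mem_pi]
  rw [h', closure_pi_set, ← pi_univ_Icc]
  congr 1
  funext j
  exact closure_Ioo (h j).ne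

/-- A convex set has a null frontier. This discards the cells that meet the interface only in a
lower dimensional set. -/
lemma volume_eq_zero_of_convex_of_interior_eq_empty {n : ℕ} {T : Set (Pt n)} (h : Convex ℝ T)
    (hi : interior T = ∅) : volume T = 0 := by
  refine measure_mono_null ?_ (h.addHaar_frontier volume)
  intro x hx
  rw [frontier, hi, sdiff_empty]
  exact subset_closure hx

/-! ### Finite element spaces -/

section FESpace

variable {n : ℕ} {κ : CellKind} {k : ℕ} {lo hi : Pt n} {cells : Set (Set (Pt n))} {Z : Set (Pt n)}

lemma FESpace.ext {v w : FESpace κ k lo hi cells Z} (h : ∀ x, v x = w x) : v = w :=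
  Subtype.ext (funext h)

lemma DegreeLE.degreeOf_le {P : MvPolynomial (Fin n) ℝ} (hP : DegreeLE κ k P) (j : Fin n) :
    P.degreeOf j ≤ k := by
  cases κ with
  | simplex => exact (MvPolynomial.degreeOf_le_totalDegree P j).trans hP
  | quad => exact hP j

/-- An element is determined by its restrictions to the finitely many cells, and each restriction
lies in the span of finitely many monomials. -/
lemma FESpace.finiteDimensional (hfin : cells.Finite)
    (hcov : closure (openBox lo hi) ⊆ ⋃ E ∈ cells, E) :
    FiniteDimensional ℝ (FESpace κ k lo hi cells Z) := by
  classical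
  have : Finite cells := hfin
  -- Functions on the cell are compared instead of polynomials, so the polynomial representing a
  -- restriction need not be unique.
  let W : (E : cells) → Submodule ℝ (E.1 → ℝ) := fun E =>
    Submodule.span ℝ (range fun (a : Fin n → Fin (k + 1)) (x : E.1) => ∏ j, x.1 j ^ (a j : ℕ))
  have hW : ∀ E, FiniteDimensional ℝ (W E) := fun E =>
    FiniteDimensional.span_of_finite ℝ (finite_range _)
  have hmem : ∀ (v : FESpace κ k lo hi cells Z) (E : cells),
      (fun x : E.1 => v x.1) ∈ W E := by
    intro v E
    obtain ⟨P, hP, hPE⟩ := v.2.2.2.1 E.1 E.2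
    have : (fun x : E.1 => v x.1) =
        ∑ s ∈ P.support, P.coeff s • fun x : E.1 => ∏ j, x.1 j ^ (s j) := by
      funext x
      rw [hPE x.1 x.2, MvPolynomial.eval_eq']
      simp
    rw [this]
    refine Submodule.sum_mem _ fun s hs => Submodule.smul_mem _ _ ?_
    refine Submodule.subset_span ⟨fun j => ⟨s j, ?_⟩, rfl⟩
    exact Nat.lt_succ_of_le ((MvPolynomial.monomial_le_degreeOf j hs).trans (hP.degreeOf_le j))
  let φ : FESpace κ k lo hi cells Z →ₗ[ℝ] ((E : cells) → W E) :=
    { toFun := fun v E => ⟨fun x => v x.1, hmem v E⟩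
      map_add' := fun v w => rfl
      map_smul' := fun c v => rfl }
  refine FiniteDimensional.of_injective φ fun v w hvw => FESpace.ext fun x => ?_
  by_cases hx : x ∈ closure (openBox lo hi)
  · obtain ⟨E, hE, hxE⟩ := mem_iUnion₂.1 (hcov hx)
    exact congrFun (congrArg Subtype.val (congrFun hvw ⟨E, hE⟩)) ⟨x, hxE⟩
  · exact (v.2.2.1 x hx).trans (w.2.2.1 x hx).symm

end FESpace

instance {m : ℕ} (S : Spatial m) (i : Fin 2) : FiniteDimensional ℝ (S.FE i) :=
  FESpace.finiteDimensional (S.mesh i).cells.finite_toSet (by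
    have := (S.mesh i).cover
    simp [← this])

/-! ### The trace -/

lemma lo_lt_hi (m : ℕ) (i : Fin 2) (j : Fin (m + 1)) : lo m i j < hi m i j := by
  refine Fin.lastCases ?_ (fun j => ?_) j
  · fin_cases i <;> simp [lo, hi]
  · simp [lo, hi]

lemma emb_castSucc {m : ℕ} (y : Pt m) (j : Fin m) : emb y j.castSucc = y j := by simp [emb]

lemma emb_last {m : ℕ} (y : Pt m) : emb y (Fin.last m) = 0 := by simp [emb]

lemma emb_injective {m : ℕ} : Function.Injective (emb (m := m)) := fun y z h => by
  funext j
  have := congrFun h j.castSucc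
  rwa [emb_castSucc, emb_castSucc] at this

lemma continuous_emb {m : ℕ} : Continuous (emb (m := m)) := by
  refine continuous_pi fun j => ?_
  refine Fin.lastCases ?_ (fun j => ?_) j
  · simp only [emb_last]; exact continuous_const
  · simp only [emb_castSucc]; exact continuous_apply j

lemma emb_convexCombo {m : ℕ} (y z : Pt m) (s t : ℝ) :
    emb (s • y + t • z) = s • emb y + t • emb z := by
  funext j
  refine Fin.lastCases ?_ (fun j => ?_) j <;> simp [emb]

lemma closure_Gam (m : ℕ) : closure (Gam m) = Icc 0 1 :=
  closure_openBox fun _ => by simp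

lemma emb_mem_closure_Omega_iff {m : ℕ} (i : Fin 2) (y : Pt m) :
    emb y ∈ closure (Omega m i) ↔ y ∈ closure (Gam m) := by
  rw [closure_Gam, Omega, closure_openBox (lo_lt_hi m i)]
  simp only [mem_Icc, Pi.le_def, Fin.forall_fin_succ', emb_castSucc, emb_last]
  fin_cases i <;> simp [lo, hi]

lemma emb_notMem_Omega {m : ℕ} (i : Fin 2) (y : Pt m) : emb y ∉ Omega m i := by
  intro h
  have := h (Fin.last m)
  rw [emb_last] at this
  fin_cases i <;> simp [lo, hi] at this

/-- This makes traces vanish on the boundary of the interface: its points belong to the exterior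
boundary because `Gam m` is open. -/
lemma emb_mem_extBoundary {m : ℕ} (i : Fin 2) {y : Pt m} (hy : y ∈ frontier (Gam m)) :
    emb y ∈ extBoundary m i := by
  have hO : IsOpen (Gam m) := isOpen_openBox _ _
  rw [hO.frontier_eq] at hy
  refine ⟨?_, ?_⟩
  · rw [IsOpen.frontier_eq (s := Omega m i) (isOpen_openBox _ _)]
    exact ⟨(emb_mem_closure_Omega_iff i y).2 hy.1, emb_notMem_Omega i y⟩
  · rintro ⟨z, hz, hzy⟩
    exact hy.2 (emb_injective hzy ▸ hz)

lemma DegreeLE.sum {n : ℕ} {κ : CellKind} {k : ℕ} {ι : Type*} (s : Finset ι)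
    (P : ι → MvPolynomial (Fin n) ℝ) (h : ∀ a ∈ s, DegreeLE κ k (P a)) :
    DegreeLE κ k (∑ a ∈ s, P a) := by
  classical
  induction s using Finset.induction_on with
  | empty =>
    rw [Finset.sum_empty]
    cases κ with
    | simplex => simp [DegreeLE]
    | quad => intro j; simp
  | insert a s ha ih =>
    rw [Finset.sum_insert ha]
    exact (h a (Finset.mem_insert_self a s)).add
      (ih fun c hc => h c (Finset.mem_insert_of_mem hc))

lemma DegreeLE.exists_comp_emb {m : ℕ} {κ : CellKind} {k : ℕ}
    {P : MvPolynomial (Fin (m + 1)) ℝ} (hP : DegreeLE κ k P) :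
    ∃ P' : MvPolynomial (Fin m) ℝ, DegreeLE κ k P' ∧
      ∀ y, MvPolynomial.eval (emb y) P = MvPolynomial.eval y P' := by
  let ρ : (Fin (m + 1) →₀ ℕ) → (Fin m →₀ ℕ) := fun s =>
    Finsupp.equivFunOnFinite.symm fun j => s j.castSucc
  -- Setting the last variable to zero keeps exactly the monomials free of it: the factor `0 ^ s
  -- (Fin.last m)` is `1` for exponent zero and `0` otherwise.
  refine ⟨∑ s ∈ P.support, MvPolynomial.C (P.coeff s * 0 ^ s (Fin.last m)) *
    MvPolynomial.monomial (ρ s) 1, DegreeLE.sum _ _ fun s hs => DegreeLE.smul _ ?_, fun y => ?_⟩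
  · cases κ with
    | simplex =>
      have h1 := MvPolynomial.le_totalDegree hs
      have h2 : s.sum (fun _ e => e) = ∑ j, s j := Finsupp.sum_fintype _ _ (fun _ => rfl)
      have h3 : (ρ s).sum (fun _ e => e) = ∑ j, (ρ s) j :=
        Finsupp.sum_fintype _ _ (fun _ => rfl)
      rw [h2, Fin.sum_univ_castSucc] at h1
      change MvPolynomial.totalDegree _ ≤ k
      rw [MvPolynomial.totalDegree_monomial _ one_ne_zero, h3]
      have hP' : P.totalDegree ≤ k := hP
      simp only [ρ, Finsupp.equivFunOnFinite_symm_apply_apply]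
      omega
    | quad =>
      intro j
      rw [MvPolynomial.degreeOf_monomial_eq _ _ one_ne_zero]
      exact (MvPolynomial.monomial_le_degreeOf j.castSucc hs).trans (hP j.castSucc)
  · rw [MvPolynomial.eval_eq', map_sum]
    refine Finset.sum_congr rfl fun s _ => ?_
    rw [Fin.prod_univ_castSucc]
    simp only [emb_castSucc, emb_last, map_mul, MvPolynomial.eval_C, MvPolynomial.eval_monomial,
      one_mul]
    rw [Finsupp.prod_fintype _ _ (fun _ => pow_zero _)]
    simp only [ρ, Finsupp.equivFunOnFinite_symm_apply_apply]
    ring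

lemma Spatial.faces_eq {m : ℕ} (S : Spatial m) (i : Fin 2) :
    faces ((S.mesh 0).cells : Set (Set (Pt (m + 1)))) =
      faces ((S.mesh i).cells : Set (Set (Pt (m + 1)))) := by
  fin_cases i
  · rfl
  · exact S.coincide

lemma faces_finite {m : ℕ} {cells : Set (Set (Pt (m + 1)))} (h : cells.Finite) :
    (faces cells).Finite :=
  (h.image fun E => {y | emb y ∈ E}).subset fun _ ⟨E, hE, hT, _⟩ => ⟨E, hE, hT.symm⟩

/-- The slices of all cells cover the interface, but `faces` keeps only those with nonempty
interior. The others are convex and null, so the part of the interface that the faces miss is open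
and null, hence empty. -/
lemma closure_Gam_subset_faces {m : ℕ} (S : Spatial m) :
    closure (openBox (0 : Pt m) 1) ⊆
      ⋃ E ∈ faces ((S.mesh 0).cells : Set (Set (Pt (m + 1)))), E := by
  set cells := ((S.mesh 0).cells : Set (Set (Pt (m + 1)))) with hcells
  have hfin : cells.Finite := (S.mesh 0).cells.finite_toSet
  have hclosed : ∀ E ∈ cells, IsClosed {y : Pt m | emb y ∈ E} := fun E hE =>
    ((S.mesh 0).isCell E hE).isCompact.isClosed.preimage continuous_emb
  have hconv : ∀ E ∈ cells, Convex ℝ {y : Pt m | emb y ∈ E} := by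
    intro E hE y hy z hz s t hs ht hst
    change emb _ ∈ E
    rw [emb_convexCombo]
    exact ((S.mesh 0).isCell E hE).convex hy hz hs ht hst
  have hFclosed : IsClosed (⋃ E ∈ faces cells, E) := by
    refine (faces_finite hfin).isClosed_biUnion ?_
    rintro T ⟨E, hE, rfl, -⟩
    exact hclosed E hE
  refine closure_minimal ?_ hFclosed
  by_contra hcon
  obtain ⟨y, hy, hyF⟩ := not_subset.1 hcon
  have hopen : IsOpen (openBox (0 : Pt m) 1 \ ⋃ E ∈ faces cells, E) :=
    (isOpen_openBox _ _).sdiff hFclosed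
  refine (hopen.measure_pos volume ⟨y, hy, hyF⟩).ne' ?_
  have hsub : (openBox (0 : Pt m) 1 \ ⋃ E ∈ faces cells, E) ⊆
      ⋃ E ∈ {E ∈ cells | interior {y : Pt m | emb y ∈ E} = ∅}, {y : Pt m | emb y ∈ E} := by
    rintro z ⟨hz, hzF⟩
    have hz' : emb z ∈ closure (Omega m 0) :=
      (emb_mem_closure_Omega_iff 0 z).2 (subset_closure hz)
    rw [Omega, ← (S.mesh 0).cover] at hz'
    obtain ⟨E, hE, hzE⟩ := mem_iUnion₂.1 hz'
    refine mem_iUnion₂.2 ⟨E, ⟨hE, ?_⟩, hzE⟩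
    by_contra hne
    exact hzF (mem_iUnion₂.2 ⟨_, ⟨E, hE, rfl, nonempty_iff_ne_empty.2 hne⟩, hzE⟩)
  refine measure_mono_null hsub ?_
  rw [measure_biUnion_null_iff (hfin.subset (sep_subset _ _)).countable]
  exact fun E hE => volume_eq_zero_of_convex_of_interior_eq_empty (hconv E hE.1) hE.2

instance {m : ℕ} (S : Spatial m) : FiniteDimensional ℝ S.TraceFE :=
  FESpace.finiteDimensional (faces_finite (S.mesh 0).cells.finite_toSet)
    (closure_Gam_subset_faces S)

/-- The trace space is built on the faces of the mesh of the first subdomain; that the two meshes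
coincide on the interface puts the traces from both sides into this one space. -/
lemma trace_mem {m : ℕ} (S : Spatial m) (i : Fin 2) (v : S.FE i) :
    trace v ∈ feSubmodule S.kind S.k (0 : Pt m) 1
      (faces ((S.mesh 0).cells : Set (Set (Pt (m + 1))))) (frontier (Gam m)) := by
  refine ⟨?_, fun y hy => ?_, ?_, fun y hy => v.2.2.2.2 _ (emb_mem_extBoundary i hy)⟩
  · exact v.continuousOn.comp continuous_emb.continuousOn
      fun y hy => (emb_mem_closure_Omega_iff i y).2 hy
  · exact v.2.2.1 _ fun h => hy ((emb_mem_closure_Omega_iff i y).1 h)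
  · rw [S.faces_eq i]
    rintro T ⟨E, hE, rfl, -⟩
    obtain ⟨P, hP, hPE⟩ := v.2.2.2.1 E hE
    obtain ⟨P', hP', hPP'⟩ := hP.exists_comp_emb
    exact ⟨P', hP', fun y hy => (hPE _ hy).trans (hPP' y)⟩

/-- The trace operator between the finite element spaces. -/
def Spatial.tr {m : ℕ} (S : Spatial m) (i : Fin 2) : S.FE i →L[ℝ] S.TraceFE :=
  LinearMap.toContinuousLinearMap
    { toFun := fun v => ⟨trace v, trace_mem S i v⟩
      map_add' := fun _ _ => rfl
      map_smul' := fun _ _ => rfl }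

lemma pairGam_trace_right {m : ℕ} (S : Spatial m) (i : Fin 2) (v : S.FE i) (l : S.TraceFE) :
    pairGam l (trace v) = inner ℝ l (S.tr i v) := rfl

/-! ### The bilinear form on the finite element spaces -/

/-- Functions which are bounded and almost everywhere differentiable on `Ω_i`, with essentially
bounded partial derivatives. -/
def IsAELip {m : ℕ} (i : Fin 2) (f : Pt (m + 1) → ℝ) : Prop :=
  (∃ C, ∀ x ∈ Omega m i, |f x| ≤ C) ∧
  (∀ᵐ x ∂volume.restrict (Omega m i), DifferentiableAt ℝ f x) ∧
  ∃ C, ∀ᵐ x ∂volume.restrict (Omega m i), ∀ j, |pd j f x| ≤ C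

lemma isOpen_Omega (m : ℕ) (i : Fin 2) : IsOpen (Omega m i) := isOpen_openBox _ _

lemma isCompact_closure_Omega (m : ℕ) (i : Fin 2) : IsCompact (closure (Omega m i)) :=
  isCompact_closure_openBox _ _

instance (m : ℕ) (i : Fin 2) : IsFiniteMeasure (volume.restrict (Omega m i)) :=
  ⟨by
    rw [Measure.restrict_apply_univ]
    exact (measure_mono subset_closure).trans_lt (isCompact_closure_Omega m i).measure_lt_top⟩

lemma exists_abs_le_of_continuousOn_closure {m : ℕ} {i : Fin 2} {f : Pt (m + 1) → ℝ}
    (hf : ContinuousOn f (closure (Omega m i))) : ∃ C, ∀ x ∈ Omega m i, |f x| ≤ C := by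
  obtain ⟨C, hC⟩ := (isCompact_closure_Omega m i).exists_bound_of_continuousOn hf
  exact ⟨C, fun x hx => hC x (subset_closure hx)⟩

lemma pd_add {n : ℕ} {f g : Pt n → ℝ} {x : Pt n} (hf : DifferentiableAt ℝ f x)
    (hg : DifferentiableAt ℝ g x) (j : Fin n) :
    pd j (fun z => f z + g z) x = pd j f x + pd j g x := by
  rw [pd, fderiv_fun_add hf hg]; rfl

lemma pd_const_mul {n : ℕ} {f : Pt n → ℝ} {x : Pt n} (hf : DifferentiableAt ℝ f x) (c : ℝ)
    (j : Fin n) : pd j (fun z => c * f z) x = c * pd j f x := by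
  rw [pd, fderiv_const_mul hf]; rfl

lemma pd_mul {n : ℕ} {f g : Pt n → ℝ} {x : Pt n} (hf : DifferentiableAt ℝ f x)
    (hg : DifferentiableAt ℝ g x) (j : Fin n) :
    pd j (fun z => f z * g z) x = f x * pd j g x + g x * pd j f x := by
  rw [pd, fderiv_fun_mul hf hg]; rfl

lemma measurable_pd {n : ℕ} (f : Pt n → ℝ) (j : Fin n) : Measurable (pd j f) :=
  measurable_fderiv_apply_const ℝ f _

lemma IsAELip.mul {m : ℕ} {i : Fin 2} {f g : Pt (m + 1) → ℝ} (hf : IsAELip i f)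
    (hg : IsAELip i g) : IsAELip i (fun x => f x * g x) := by
  obtain ⟨⟨Cf, hCf⟩, hdf, Df, hDf⟩ := hf
  obtain ⟨⟨Cg, hCg⟩, hdg, Dg, hDg⟩ := hg
  refine ⟨⟨Cf * Cg, fun x hx => ?_⟩, ?_, Cf * Dg + Cg * Df, ?_⟩
  · rw [abs_mul]
    exact mul_le_mul (hCf x hx) (hCg x hx) (abs_nonneg _) ((abs_nonneg _).trans (hCf x hx))
  · filter_upwards [hdf, hdg] with x h1 h2 using h1.mul h2
  · filter_upwards [hdf, hdg, hDf, hDg, ae_restrict_mem (isOpen_Omega m i).measurableSet]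
      with x h1 h2 h3 h4 hx j
    rw [pd_mul h1 h2]
    refine (abs_add_le _ _).trans (add_le_add ?_ ?_) <;> rw [abs_mul]
    · exact mul_le_mul (hCf x hx) (h4 j) (abs_nonneg _) ((abs_nonneg _).trans (hCf x hx))
    · exact mul_le_mul (hCg x hx) (h3 j) (abs_nonneg _) ((abs_nonneg _).trans (hCg x hx))

lemma IsAELip.integrable_pd_mul_pd {m : ℕ} {i : Fin 2} {f g : Pt (m + 1) → ℝ}
    (hf : IsAELip i f) (hg : IsAELip i g) (j l : Fin (m + 1)) :
    IntegrableOn (fun x => pd j f x * pd l g x) (Omega m i) := by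
  obtain ⟨-, -, Df, hDf⟩ := hf
  obtain ⟨-, -, Dg, hDg⟩ := hg
  refine Integrable.of_bound
    ((measurable_pd f j).mul (measurable_pd g l)).aestronglyMeasurable (Df * Dg) ?_
  filter_upwards [hDf, hDg] with x h1 h2
  rw [Real.norm_eq_abs, abs_mul]
  exact mul_le_mul (h1 j) (h2 l) (abs_nonneg _) ((abs_nonneg _).trans (h1 j))

/-- The finitely many cells are convex, so their frontiers form a null set. -/
lemma ae_mem_interior_cell {m : ℕ} (S : Spatial m) (i : Fin 2) :
    ∀ᵐ x ∂volume.restrict (Omega m i), ∃ E ∈ (S.mesh i).cells, x ∈ interior E := by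
  have h0 : volume (⋃ E ∈ (S.mesh i).cells, frontier E) = 0 := by
    refine (measure_biUnion_null_iff (S.mesh i).cells.countable_toSet).2 ?_
    exact fun E hE => ((S.mesh i).isCell E hE).convex.addHaar_frontier volume
  have h1 : ∀ᵐ x ∂volume.restrict (Omega m i), x ∉ ⋃ E ∈ (S.mesh i).cells, frontier E :=
    ae_restrict_of_ae (measure_eq_zero_iff_ae_notMem.1 h0)
  filter_upwards [h1, ae_restrict_mem (isOpen_Omega m i).measurableSet] with x hx hxO
  have h2 : x ∈ ⋃ E ∈ (S.mesh i).cells, E := by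
    rw [(S.mesh i).cover]; exact subset_closure hxO
  obtain ⟨E, hE, hxE⟩ := mem_iUnion₂.1 h2
  refine ⟨E, hE, ?_⟩
  by_contra hcon
  exact hx (mem_iUnion₂.2 ⟨E, hE, subset_closure hxE, hcon⟩)

/-- In the interior of a cell the function agrees with a polynomial near the point, and the
derivatives of that polynomial are bounded on the compact cell. -/
lemma Spatial.isAELip {m : ℕ} (S : Spatial m) (i : Fin 2) (v : S.FE i) : IsAELip i v := by
  classical
  have hpoly : ∀ E : (S.mesh i).cells, ∃ P : MvPolynomial (Fin (m + 1)) ℝ,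
      ∀ x ∈ E.1, v x = MvPolynomial.eval x P := fun E => by
    obtain ⟨P, -, hP⟩ := v.2.2.2.1 E.1 E.2
    exact ⟨P, hP⟩
  choose P hP using hpoly
  have hsmooth : ∀ E, ContDiff ℝ 1 fun x : Pt (m + 1) => MvPolynomial.eval x (P E) := by
    intro E
    simp only [MvPolynomial.eval_eq']
    fun_prop
  have heq : ∀ E : (S.mesh i).cells, ∀ x ∈ interior E.1,
      (v : Pt (m + 1) → ℝ) =ᶠ[nhds x] fun z => MvPolynomial.eval z (P E) := fun E x hx => by
    filter_upwards [isOpen_interior.mem_nhds hx] with z hz using hP E z (interior_subset hz)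
  have hbd : ∀ (E : (S.mesh i).cells) (j : Fin (m + 1)), ∃ C, ∀ x ∈ E.1,
      ‖pd j (fun z => MvPolynomial.eval z (P E)) x‖ ≤ C := by
    intro E j
    refine ((S.mesh i).isCell E.1 E.2).isCompact.exists_bound_of_continuousOn ?_
    exact (((hsmooth E).continuous_fderiv one_ne_zero).clm_apply continuous_const).continuousOn
  choose C hC using hbd
  refine ⟨exists_abs_le_of_continuousOn_closure v.continuousOn, ?_,
    ∑ E, ∑ j, |C E j|, ?_⟩
  · filter_upwards [ae_mem_interior_cell S i] with x hx
    obtain ⟨E, hE, hxE⟩ := hx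
    exact (heq ⟨E, hE⟩ x hxE).differentiableAt_iff.2
      (((hsmooth ⟨E, hE⟩).differentiable one_ne_zero).differentiableAt)
  · filter_upwards [ae_mem_interior_cell S i] with x hx j
    obtain ⟨E, hE, hxE⟩ := hx
    have h1 : pd j v x = pd j (fun z => MvPolynomial.eval z (P ⟨E, hE⟩)) x := by
      rw [pd, pd, (heq ⟨E, hE⟩ x hxE).fderiv_eq]
    rw [h1, ← Real.norm_eq_abs]
    refine (hC ⟨E, hE⟩ j x (interior_subset hxE)).trans ((le_abs_self _).trans ?_)
    refine (Finset.single_le_sum (f := fun j => |C ⟨E, hE⟩ j|) (fun _ _ => abs_nonneg _)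
      (Finset.mem_univ j)).trans ?_
    exact Finset.single_le_sum (f := fun E => ∑ j, |C E j|)
      (fun _ _ => Finset.sum_nonneg fun _ _ => abs_nonneg _) (Finset.mem_univ (⟨E, hE⟩ :
        {x // x ∈ (S.mesh i).cells}))

/-- Rademacher's theorem; the Lipschitz constant bounds the derivative. -/
lemma Coeffs.isAELip {m : ℕ} (A : Coeffs m) (i : Fin 2) (j : Fin (m + 1)) :
    IsAELip i (fun x => A.s i x j) := by
  obtain ⟨K, hK⟩ := A.s_lipschitz i
  have hK' : LipschitzOnWith K (fun x => A.s i x j) (closure (Omega m i)) := by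
    have := (LipschitzWith.eval j : LipschitzWith 1 (Function.eval j : Pt (m + 1) → ℝ))
    have h2 := this.comp_lipschitzOnWith hK
    rw [one_mul] at h2
    exact h2
  have hK'' := hK'.mono subset_closure
  refine ⟨exists_abs_le_of_continuousOn_closure hK'.continuousOn, ?_, K, ?_⟩
  · filter_upwards [hK''.ae_differentiableWithinAt (isOpen_Omega m i).measurableSet (μ := volume),
      ae_restrict_mem (isOpen_Omega m i).measurableSet] with x hx hxO
    exact hx.differentiableAt ((isOpen_Omega m i).mem_nhds hxO)
  · filter_upwards [ae_restrict_mem (isOpen_Omega m i).measurableSet] with x hxO l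
    rw [pd, ← Real.norm_eq_abs]
    refine (ContinuousLinearMap.le_opNorm _ _).trans ?_
    have h1 := norm_fderiv_le_of_lipschitzOn ℝ ((isOpen_Omega m i).mem_nhds hxO) hK''
    rw [Pi.norm_single, norm_one, mul_one]
    exact h1

lemma integrableOn_mul_of_isAELip {m : ℕ} (S : Spatial m) (A : Coeffs m) (i : Fin 2)
    (v w : S.FE i) :
    IntegrableOn (fun x => (∑ j, pd j (fun z => A.s i z j * v z) x) * w x) (Omega m i) := by
  simp only [Finset.sum_mul]
  refine integrable_finsetSum _ fun j _ => ?_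
  obtain ⟨-, -, D, hD⟩ := (A.isAELip i j).mul (S.isAELip i v)
  obtain ⟨C, hC⟩ := (S.isAELip i w).1
  refine Integrable.of_bound ((measurable_pd _ j).aestronglyMeasurable.mul
    ((w.continuousOn.mono subset_closure).aestronglyMeasurable
      (isOpen_Omega m i).measurableSet)) (D * C) ?_
  filter_upwards [hD, ae_restrict_mem (isOpen_Omega m i).measurableSet] with x h1 hx
  rw [Real.norm_eq_abs, abs_mul]
  exact mul_le_mul (h1 j) (hC x hx) (abs_nonneg _) ((abs_nonneg _).trans (h1 j))

lemma integrableOn_grad {m : ℕ} (S : Spatial m) (A : Coeffs m) (i : Fin 2) (v w : S.FE i) :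
    IntegrableOn (fun x => A.ν i * ∑ j, pd j v x * pd j w x) (Omega m i) :=
  (integrable_finsetSum _ fun j _ =>
    (S.isAELip i v).integrable_pd_mul_pd (S.isAELip i w) j j).const_mul _

/-- The form `L` as a bilinear map on `U_i`. -/
def Coeffs.form {m : ℕ} (A : Coeffs m) (S : Spatial m) (i : Fin 2) :
    S.FE i →ₗ[ℝ] S.FE i →ₗ[ℝ] ℝ :=
  LinearMap.mk₂ ℝ (fun v w => A.L i v w)
    (fun v v' w => by
      simp only [Coeffs.L]
      rw [add_add_add_comm, ← integral_add (integrableOn_grad S A i v w)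
        (integrableOn_grad S A i v' w), ← integral_add (integrableOn_mul_of_isAELip S A i v w)
        (integrableOn_mul_of_isAELip S A i v' w)]
      congr 1 <;> refine integral_congr_ae ?_
      · filter_upwards [(S.isAELip i v).2.1, (S.isAELip i v').2.1] with x h1 h2
        rw [← mul_add, ← Finset.sum_add_distrib]
        congr 1
        refine Finset.sum_congr rfl fun j _ => ?_
        rw [← add_mul, ← pd_add h1 h2]; rfl
      · filter_upwards [(S.isAELip i v).2.1, (S.isAELip i v').2.1,
          ae_all_iff.2 fun j => (A.isAELip i j).2.1] with x h1 h2 h3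
        rw [← add_mul, ← Finset.sum_add_distrib]
        congr 1
        refine Finset.sum_congr rfl fun j _ => ?_
        rw [← pd_add ((h3 j).fun_mul h1) ((h3 j).fun_mul h2)]
        congr 1
        funext z
        exact mul_add _ _ _)
    (fun c v w => by
      simp only [Coeffs.L]
      rw [smul_eq_mul, mul_add, ← integral_const_mul, ← integral_const_mul]
      congr 1 <;> refine integral_congr_ae ?_
      · filter_upwards [(S.isAELip i v).2.1] with x h1
        rw [mul_left_comm, Finset.mul_sum _ _ c]
        congr 1
        refine Finset.sum_congr rfl fun j _ => ?_
        rw [← mul_assoc, ← pd_const_mul h1]; rfl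
      · filter_upwards [(S.isAELip i v).2.1,
          ae_all_iff.2 fun j => (A.isAELip i j).2.1] with x h1 h3
        rw [← mul_assoc, Finset.mul_sum]
        congr 1
        refine Finset.sum_congr rfl fun j _ => ?_
        rw [← pd_const_mul ((h3 j).fun_mul h1)]
        congr 1
        funext z
        exact mul_left_comm _ _ _)
    (fun v w w' => by
      simp only [Coeffs.L]
      rw [add_add_add_comm, ← integral_add (integrableOn_grad S A i v w)
        (integrableOn_grad S A i v w'), ← integral_add (integrableOn_mul_of_isAELip S A i v w)
        (integrableOn_mul_of_isAELip S A i v w')]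
      congr 1 <;> refine integral_congr_ae ?_
      · filter_upwards [(S.isAELip i w).2.1, (S.isAELip i w').2.1] with x h1 h2
        rw [← mul_add, ← Finset.sum_add_distrib]
        congr 1
        refine Finset.sum_congr rfl fun j _ => ?_
        rw [← mul_add, ← pd_add h1 h2]; rfl
      · filter_upwards with x
        rw [← mul_add]; rfl)
    (fun c v w => by
      simp only [Coeffs.L]
      rw [smul_eq_mul, mul_add, ← integral_const_mul, ← integral_const_mul]
      congr 1 <;> refine integral_congr_ae ?_
      · filter_upwards [(S.isAELip i w).2.1] with x h1
        rw [mul_left_comm, Finset.mul_sum _ _ c]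
        congr 1
        refine Finset.sum_congr rfl fun j _ => ?_
        rw [mul_left_comm, ← pd_const_mul h1]; rfl
      · filter_upwards with x
        rw [mul_left_comm]; rfl)

/-- The operator on `U_i` associated with the form `L`. -/
def Coeffs.op {m : ℕ} (A : Coeffs m) (S : Spatial m) (i : Fin 2) : S.FE i →L[ℝ] S.FE i :=
  LinearMap.toContinuousLinearMap
    ((InnerProductSpace.toDual ℝ (S.FE i)).symm.toLinearEquiv.toLinearMap ∘ₗ
      LinearMap.toContinuousLinearMap.toLinearMap ∘ₗ A.form S i)

lemma Coeffs.inner_op {m : ℕ} (A : Coeffs m) (S : Spatial m) (i : Fin 2) (v w : S.FE i) :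
    inner ℝ (A.op S i v) w = A.L i v w := by
  have := InnerProductSpace.toDual_symm_apply (𝕜 := ℝ) (x := w)
    (y := LinearMap.toContinuousLinearMap (A.form S i v))
  exact this

instance (m : ℕ) : IsFiniteMeasure (volume.restrict (Gam m)) :=
  ⟨by
    rw [Measure.restrict_apply_univ]
    exact (measure_mono subset_closure).trans_lt
      (isCompact_closure_openBox (n := m) 0 1).measure_lt_top⟩

lemma integrableOn_mul_traceFE {m : ℕ} (S : Spatial m) {g : Pt m → ℝ}
    (hg : MemLp g 2 (volume.restrict (Gam m))) (μ : S.TraceFE) :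
    IntegrableOn (fun y => g y * μ y) (Gam m) := by
  obtain ⟨C, hC⟩ := (isCompact_closure_openBox (n := m) 0 1).exists_bound_of_continuousOn
    μ.continuousOn
  refine (hg.integrable one_le_two).mul_bdd (c := C)
    ((μ.continuousOn.mono subset_closure).aestronglyMeasurable
      (isOpen_openBox _ _).measurableSet) ?_
  filter_upwards [ae_restrict_mem (isOpen_openBox (0 : Pt m) 1).measurableSet] with y hy
  exact hC y (subset_closure hy)

/-- The load `g` is only square integrable, so the pairing is split after checking that its product
with the bounded function `μ` is integrable. -/
lemma pairGam_combo_sub {m : ℕ} (S : Spatial m) {g : Pt m → ℝ}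
    (hg : MemLp g 2 (volume.restrict (Gam m))) (b₀ b₁ : ℝ) (v₀ v₁ μ : S.TraceFE) :
    pairGam (fun y => b₀ * v₀ y + b₁ * v₁ y - g y) μ =
      b₀ * inner ℝ v₀ μ + b₁ * inner ℝ v₁ μ - pairGam g μ := by
  have h0 : IntegrableOn (fun y => b₀ * (v₀ y * μ y)) (Gam m) :=
    (v₀.integrableOn_mul μ).const_mul b₀
  have h1 : IntegrableOn (fun y => b₁ * (v₁ y * μ y)) (Gam m) :=
    (v₁.integrableOn_mul μ).const_mul b₁
  have h2 := integrableOn_mul_traceFE S hg μ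
  have e0 : ∫ y in Gam m, b₀ * (v₀ y * μ y) = b₀ * inner ℝ v₀ μ := integral_const_mul _ _
  have e1 : ∫ y in Gam m, b₁ * (v₁ y * μ y) = b₁ * inner ℝ v₁ μ := integral_const_mul _ _
  rw [← e0, ← e1, ← integral_add h0 h1, pairGam, pairGam,
    ← integral_sub (f := fun y => b₀ * (v₀ y * μ y) + b₁ * (v₁ y * μ y)) (h0.add h1) h2]
  refine integral_congr_ae (Filter.Eventually.of_forall fun y => ?_)
  simp only []
  ring

/-! ### Polynomials in time -/

section TimePoly

variable {V : Type*} [NormedAddCommGroup V] [InnerProductSpace ℝ V]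
  {W : Type*} [NormedAddCommGroup W] [InnerProductSpace ℝ W]

lemma isTimePoly_iff_range {q : ℕ} {v : ℝ → V} :
    IsTimePoly q v ↔ ∃ c : ℕ → V, ∀ t, v t = ∑ j ∈ Finset.range (q + 1), t ^ j • c j := by
  constructor
  · rintro ⟨c, hc⟩
    refine ⟨fun j => if h : j < q + 1 then c ⟨j, h⟩ else 0, fun t => ?_⟩
    rw [hc, Finset.sum_range]
    exact Finset.sum_congr rfl fun j _ => by simp [j.2]
  · rintro ⟨c, hc⟩
    exact ⟨fun j => c j, fun t => by rw [hc, Finset.sum_range]⟩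

lemma isTimePoly_zero (q : ℕ) : IsTimePoly q (fun _ => (0 : V)) := ⟨0, fun t => by simp⟩

lemma IsTimePoly.add {q : ℕ} {v w : ℝ → V} (hv : IsTimePoly q v) (hw : IsTimePoly q w) :
    IsTimePoly q (fun t => v t + w t) := by
  obtain ⟨c, hc⟩ := hv
  obtain ⟨d, hd⟩ := hw
  exact ⟨c + d, fun t => by simp [hc, hd, smul_add, Finset.sum_add_distrib]⟩

lemma IsTimePoly.const_smul {q : ℕ} {v : ℝ → V} (hv : IsTimePoly q v) (a : ℝ) :
    IsTimePoly q (fun t => a • v t) := by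
  obtain ⟨c, hc⟩ := hv
  exact ⟨a • c, fun t => by simp [hc, Finset.smul_sum, smul_comm a]⟩

lemma IsTimePoly.sub {q : ℕ} {v w : ℝ → V} (hv : IsTimePoly q v) (hw : IsTimePoly q w) :
    IsTimePoly q (fun t => v t - w t) := by
  simpa [sub_eq_add_neg] using hv.add (hw.const_smul (-1))

lemma IsTimePoly.sum {q : ℕ} {ι : Type*} (s : Finset ι) {v : ι → ℝ → V}
    (hv : ∀ i ∈ s, IsTimePoly q (v i)) : IsTimePoly q (fun t => ∑ i ∈ s, v i t) := by
  classical
  induction s using Finset.induction_on with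
  | empty => simpa using isTimePoly_zero q
  | insert a s ha ih =>
    simp only [Finset.sum_insert ha]
    exact (hv a (Finset.mem_insert_self a s)).add
      (ih fun i hi => hv i (Finset.mem_insert_of_mem hi))

lemma isTimePoly_pow_smul {q j : ℕ} (hj : j ≤ q) (c : V) :
    IsTimePoly q (fun t => t ^ j • c) := by
  rw [isTimePoly_iff_range]
  refine ⟨fun l => if l = j then c else 0, fun t => ?_⟩
  simp [Finset.sum_ite_eq', Nat.lt_succ_of_le hj]

lemma IsTimePoly.mono {q q' : ℕ} (h : q ≤ q') {v : ℝ → V} (hv : IsTimePoly q v) :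
    IsTimePoly q' v := by
  obtain ⟨c, hc⟩ := hv
  obtain rfl : v = _ := funext hc
  exact IsTimePoly.sum _ fun j _ => isTimePoly_pow_smul (by omega) _

lemma isTimePoly_const (q : ℕ) (c : V) : IsTimePoly q (fun _ => c) := by
  simpa using isTimePoly_pow_smul (Nat.zero_le q) c

lemma IsTimePoly.mul_affine {q : ℕ} {v : ℝ → V} (hv : IsTimePoly q v) (α β : ℝ) :
    IsTimePoly (q + 1) (fun t => (α + β * t) • v t) := by
  obtain ⟨c, hc⟩ := hv
  have : (fun t => (α + β * t) • v t) = fun t => α • v t +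
      ∑ j : Fin (q + 1), t ^ ((j : ℕ) + 1) • (β • c j) := by
    funext t
    rw [add_smul, hc, Finset.smul_sum (r := β * t)]
    congr 1
    refine Finset.sum_congr rfl fun j _ => ?_
    rw [smul_smul, smul_smul]
    ring_nf
  rw [this]
  refine ((IsTimePoly.mono (Nat.le_succ q) ⟨c, hc⟩).const_smul α).add
    (IsTimePoly.sum _ fun j _ => isTimePoly_pow_smul (by omega) _)

lemma isTimePoly_affine_pow_smul {q j : ℕ} (hj : j ≤ q) (α β : ℝ) (c : V) :
    IsTimePoly q (fun t => (α + β * t) ^ j • c) := by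
  refine IsTimePoly.mono hj ?_
  clear hj
  induction j with
  | zero => simpa using isTimePoly_const 0 c
  | succ j ih =>
    have := ih.mul_affine α β
    simp only [smul_smul, ← pow_succ'] at this
    exact this

/-- Used to transport polynomials on a substep to the reference interval. -/
lemma IsTimePoly.comp_affine {q : ℕ} {v : ℝ → V} (hv : IsTimePoly q v) (α β : ℝ) :
    IsTimePoly q (fun t => v (α + β * t)) := by
  obtain ⟨c, hc⟩ := hv
  simp only [hc]
  exact IsTimePoly.sum _ fun j _ => isTimePoly_affine_pow_smul (by omega) _ _ _

lemma IsTimePoly.contDiff {q : ℕ} {v : ℝ → V} (hv : IsTimePoly q v) {n : WithTop ℕ∞} :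
    ContDiff ℝ n v := by
  obtain ⟨c, hc⟩ := hv
  obtain rfl : v = _ := funext hc
  fun_prop

lemma IsTimePoly.continuous {q : ℕ} {v : ℝ → V} (hv : IsTimePoly q v) : Continuous v :=
  (hv.contDiff (n := 0)).continuous

lemma IsTimePoly.hasDerivAt {q : ℕ} {v : ℝ → V} (hv : IsTimePoly q v) (t : ℝ) :
    HasDerivAt v (deriv v t) t :=
  ((hv.contDiff (n := 1)).differentiable one_ne_zero).differentiableAt.hasDerivAt

lemma IsTimePoly.continuous_deriv {q : ℕ} {v : ℝ → V} (hv : IsTimePoly q v) :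
    Continuous (deriv v) :=
  (hv.contDiff (n := 1)).continuous_deriv le_rfl

lemma IsTimePoly.exists_antideriv {q : ℕ} {v : ℝ → V} (hv : IsTimePoly q v) (a : ℝ) (x : V) :
    ∃ P : ℝ → V, IsTimePoly (q + 1) P ∧ P a = x ∧ ∀ t, HasDerivAt P (v t) t := by
  obtain ⟨c, hc⟩ := hv
  let P₀ : ℝ → V := fun t => ∑ j : Fin (q + 1), t ^ ((j : ℕ) + 1) • ((((j : ℕ) : ℝ) + 1)⁻¹ • c j)
  have hP₀ : IsTimePoly (q + 1) P₀ := IsTimePoly.sum _ fun j _ => isTimePoly_pow_smul (by omega) _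
  refine ⟨fun t => P₀ t + (x - P₀ a), hP₀.add (isTimePoly_const _ _), by simp, fun t => ?_⟩
  have : HasDerivAt P₀ (v t) t := by
    rw [hc]
    refine HasDerivAt.fun_sum fun j _ => ?_
    have h1 := (hasDerivAt_pow ((j : ℕ) + 1) t).smul_const ((((j : ℕ) : ℝ) + 1)⁻¹ • c j)
    convert h1 using 1
    rw [smul_smul]
    congr 1
    have : (((j : ℕ) : ℝ) + 1) ≠ 0 := by positivity
    push_cast
    field_simp
  exact this.add_const _

end TimePoly

/-! ### Weakly differentiable functions of time -/

section Weak

variable {V : Type*} [NormedAddCommGroup V] [InnerProductSpace ℝ V]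

/-- `IsTimeDeriv` only speaks of inner products with fixed vectors; in finite dimension an
orthonormal basis recovers the vector valued statement. -/
lemma continuousOn_of_inner [FiniteDimensional ℝ V] {s : Set ℝ} {v : ℝ → V}
    (h : ∀ φ : V, ContinuousOn (fun t => (inner ℝ (v t) φ : ℝ)) s) : ContinuousOn v s := by
  have b := stdOrthonormalBasis ℝ V
  have : v = fun t => ∑ j, (inner ℝ (v t) (b j) : ℝ) • b j := by
    funext t
    rw [← b.sum_repr' (v t)]
    simp only [real_inner_comm, b.sum_repr']
  rw [this]
  exact continuousOn_finsetSum _ fun j _ => (h (b j)).smul continuousOn_const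

lemma IsTimeDeriv.inner_eq {T : ℝ} {v v' : ℝ → V} (h : IsTimeDeriv T v v') (φ : V) {a t : ℝ}
    (ha : a ∈ Icc 0 T) (ht : t ∈ Icc 0 T) :
    (inner ℝ (v t) φ : ℝ) = inner ℝ (v a) φ + ∫ s in a..t, inner ℝ (v' s) φ := by
  obtain ⟨h1, h2⟩ := h φ
  have hsub : ∀ x ∈ Icc 0 T, IntervalIntegrable (fun t => (inner ℝ (v' t) φ : ℝ)) volume 0 x :=
    fun x hx => h1.mono_set (uIcc_subset_uIcc left_mem_uIcc (Icc_subset_uIcc hx))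
  rw [h2 t ht, h2 a ha, add_assoc, intervalIntegral.integral_add_adjacent_intervals (hsub a ha)
    ((hsub a ha).symm.trans (hsub t ht))]

lemma IsTimeDeriv.continuousOn [FiniteDimensional ℝ V] {T : ℝ} (hT : 0 ≤ T) {v v' : ℝ → V} (h : IsTimeDeriv T v v') :
    ContinuousOn v (Icc 0 T) := by
  refine continuousOn_of_inner fun φ => ?_
  obtain ⟨h1, h2⟩ := h φ
  have : ContinuousOn (fun t => (inner ℝ (v 0) φ : ℝ) + ∫ s in (0 : ℝ)..t, inner ℝ (v' s) φ)
      (Icc 0 T) := by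
    refine continuousOn_const.add ?_
    have h3 := intervalIntegral.continuousOn_primitive_interval' h1 left_mem_uIcc
    rwa [uIcc_of_le hT] at h3
  exact this.congr fun t ht => h2 t ht

/-- On `[a, b]` the function `f` is a primitive of an integrable function, hence absolutely
continuous, and integration by parts for such functions applies. -/
lemma integral_deriv_mul_add_of_eq_integral {f g p p' : ℝ → ℝ} {a b : ℝ} (hab : a ≤ b)
    (hg : IntervalIntegrable g volume a b)
    (hf : ∀ t ∈ Icc a b, f t = f a + ∫ s in a..t, g s)
    (hp : ∀ t, HasDerivAt p (p' t) t) (hp' : Continuous p') :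
    ∫ t in a..b, (g t * p t + f t * p' t) = f b * p b - f a * p a := by
  -- Nothing is known about `f` outside `[a, b]`, so the explicit primitive takes its place where a
  -- derivative at a point is needed.
  let F : ℝ → ℝ := fun t => f a + ∫ s in a..t, g s
  have hF : AbsolutelyContinuousOnInterval F a b :=
    ((contDiff_const (c := f a) (n := 1)).contDiffOn.absolutelyContinuousOnInterval).add
      (hg.absolutelyContinuousOnInterval_intervalIntegral left_mem_uIcc)
  have hdp : deriv p = p' := funext fun t => (hp t).deriv
  have hpc : ContDiff ℝ 1 p := by
    rw [contDiff_one_iff_deriv, hdp]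
    exact ⟨fun t => (hp t).differentiableAt, hp'⟩
  have hp1 : AbsolutelyContinuousOnInterval p a b := hpc.contDiffOn.absolutelyContinuousOnInterval
  have h1 := hF.integral_deriv_mul_eq_sub hp1
  have hFa : F a = f a := by simp [F]
  have hFb : F b = f b := (hf b (right_mem_Icc.2 hab)).symm
  rw [hFa, hFb] at h1
  rw [← h1]
  refine intervalIntegral.integral_congr_ae ?_
  filter_upwards [hg.ae_hasDerivAt_integral] with t ht htI
  have htI' : t ∈ Icc a b := by
    rw [uIoc_of_le hab] at htI; exact Ioc_subset_Icc_self htI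
  have h2 : HasDerivAt F (g t) t :=
    (ht (by rw [uIcc_of_le hab]; exact htI') a left_mem_uIcc).const_add _
  rw [h2.deriv, hdp, hf t htI']

lemma IsTimeDeriv.intervalIntegrable_inner {T : ℝ} {v v' : ℝ → V}
    (h : IsTimeDeriv T v v') {a b : ℝ} (ha : 0 ≤ a) (hab : a ≤ b) (hb : b ≤ T) (φ : V) :
    IntervalIntegrable (fun t => (inner ℝ (v' t) φ : ℝ)) volume a b :=
  (h φ).1.mono_set (by
    rw [uIcc_of_le hab, uIcc_of_le (ha.trans (hab.trans hb))]
    exact Icc_subset_Icc ha hb)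

lemma IsTimeDeriv.intervalIntegrable_inner_timePoly {T : ℝ} {v v' : ℝ → V}
    (h : IsTimeDeriv T v v') {a b : ℝ} (ha : 0 ≤ a) (hab : a ≤ b) (hb : b ≤ T) {q : ℕ}
    {P : ℝ → V} (hP : IsTimePoly q P) :
    IntervalIntegrable (fun t => (inner ℝ (v' t) (P t) : ℝ)) volume a b := by
  obtain ⟨c, hc⟩ := hP
  have h1 : (fun t => (inner ℝ (v' t) (P t) : ℝ)) =
      ∑ j : Fin (q + 1), fun t => t ^ (j : ℕ) * (inner ℝ (v' t) (c j) : ℝ) := by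
    funext t
    simp only [hc, inner_sum, real_inner_smul_right, Finset.sum_apply]
  rw [h1]
  exact IntervalIntegrable.sum Finset.univ fun (j : Fin (q + 1)) _ =>
    (h.intervalIntegrable_inner ha hab hb (c j)).continuousOn_mul
      (continuous_pow (j : ℕ)).continuousOn

/-- Integration by parts against polynomials in time. -/
lemma IsTimeDeriv.integral_inner_timePoly [FiniteDimensional ℝ V] {T : ℝ} {v v' : ℝ → V}
    (h : IsTimeDeriv T v v') {a b : ℝ} (ha : 0 ≤ a) (hab : a ≤ b) (hb : b ≤ T) {q : ℕ}
    {P : ℝ → V} (hP : IsTimePoly q P) :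
    (∫ t in a..b, (inner ℝ (v' t) (P t) : ℝ)) + ∫ t in a..b, inner ℝ (v t) (deriv P t) =
      inner ℝ (v b) (P b) - inner ℝ (v a) (P a) := by
  have hT : 0 ≤ T := ha.trans (hab.trans hb)
  have hsub : Icc a b ⊆ Icc 0 T := Icc_subset_Icc ha hb
  have hv : ContinuousOn v (uIcc a b) := by
    rw [uIcc_of_le hab]; exact (h.continuousOn hT).mono hsub
  rw [← intervalIntegral.integral_add (h.intervalIntegrable_inner_timePoly ha hab hb hP)
    ((hv.inner (𝕜 := ℝ) hP.continuous_deriv.continuousOn).intervalIntegrable)]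
  -- Expanding `P` in powers of `t` reduces the claim to scalar functions `⟨v t, c j⟩` against
  -- monomials.
  obtain ⟨c, hc⟩ := hP
  have hd : ∀ t, deriv P t = ∑ j : Fin (q + 1), (((j : ℕ) : ℝ) * t ^ ((j : ℕ) - 1)) • c j := by
    intro t
    obtain rfl : P = _ := funext hc
    exact (HasDerivAt.fun_sum fun (j : Fin (q + 1)) _ =>
      (hasDerivAt_pow (j : ℕ) t).smul_const (c j)).deriv
  simp only [hc, hd, inner_sum, real_inner_smul_right, ← Finset.sum_add_distrib,
    ← Finset.sum_sub_distrib]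
  rw [intervalIntegral.integral_finsetSum]
  · refine Finset.sum_congr rfl fun j _ => ?_
    have h1 := integral_deriv_mul_add_of_eq_integral
      (f := fun t => (inner ℝ (v t) (c j) : ℝ)) (g := fun t => inner ℝ (v' t) (c j))
      (p := fun t => t ^ (j : ℕ)) (p' := fun t => ((j : ℕ) : ℝ) * t ^ ((j : ℕ) - 1)) hab
      (h.intervalIntegrable_inner ha hab hb (c j))
      (fun t ht => h.inner_eq (c j) ⟨ha, hab.trans hb⟩ (hsub ht))
      (fun t => hasDerivAt_pow (j : ℕ) t) (by fun_prop)
    rw [mul_comm (b ^ (j : ℕ)), mul_comm (a ^ (j : ℕ)), ← h1]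
    refine intervalIntegral.integral_congr fun t _ => ?_
    ring
  · intro j _
    refine ((h.intervalIntegrable_inner ha hab hb (c j)).continuousOn_mul
      (continuous_pow (j : ℕ)).continuousOn).add ?_
    refine ContinuousOn.intervalIntegrable ?_
    exact ContinuousOn.mul (by fun_prop) (hv.inner (𝕜 := ℝ) continuousOn_const)

/-- A finite sequence of functions on `[0, T]`, each the derivative of the preceding one. -/
def IsDerivChain (k : ℕ) (T : ℝ) (D : ℕ → ℝ → V) : Prop :=
  ∀ m < k, IntervalIntegrable (D (m + 1)) volume 0 T ∧
    ∀ a ∈ Icc 0 T, ∀ t ∈ Icc 0 T, D m t = D m a + ∫ s in a..t, D (m + 1) s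

lemma intervalIntegrable_of_memLp {V : Type*} [NormedAddCommGroup V] {T : ℝ} (hT : 0 ≤ T) {f : ℝ → V}
    (hf : MemLp f 2 (volume.restrict (Ioc 0 T))) : IntervalIntegrable f volume 0 T := by
  rw [intervalIntegrable_iff_integrableOn_Ioc_of_le hT]
  exact hf.integrable one_le_two

/-- The derivatives are square integrable, hence integrable on a bounded interval, so the identities
tested with fixed vectors combine into one with a vector valued integral. -/
lemma IsSobolev.isDerivChain [FiniteDimensional ℝ V] {k : ℕ} {T : ℝ} (hT : 0 ≤ T) {v : ℝ → V} {D : ℕ → ℝ → V}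
    (h : IsSobolev k T v D) : IsDerivChain k T D := by
  intro m hm
  have h1 := intervalIntegrable_of_memLp hT (h.2.2 (m + 1) hm)
  refine ⟨h1, fun a ha t ht => ext_inner_right ℝ fun φ => ?_⟩
  have h2 : IntervalIntegrable (D (m + 1)) volume a t :=
    h1.mono_set (uIcc_subset_uIcc (Icc_subset_uIcc ha) (Icc_subset_uIcc ht))
  rw [(h.2.1 m hm).inner_eq φ ha ht, inner_add_left]
  congr 1
  have h3 := (innerSL ℝ φ).intervalIntegral_comp_comm h2
  simp only [innerSL_apply_apply] at h3
  rw [real_inner_comm, ← h3]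
  exact intervalIntegral.integral_congr fun s _ => real_inner_comm _ _

/-- A function which is continuous on `[0, T]` agrees there with the representative `D 0`. -/
lemma IsSobolev.eqOn [FiniteDimensional ℝ V] {k : ℕ} {T : ℝ} (hT : 0 < T) {v : ℝ → V} {D : ℕ → ℝ → V}
    (h : IsSobolev (k + 1) T v D) (hv : ContinuousOn v (Icc 0 T)) : EqOn v (D 0) (Icc 0 T) := by
  have h0 : ContinuousOn (D 0) (Icc 0 T) := (h.2.1 0 (Nat.succ_pos k)).continuousOn hT.le
  have h1 : v =ᵐ[volume.restrict (Ioo 0 T)] D 0 :=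
    ae_restrict_of_ae_restrict_of_subset Ioo_subset_Ioc_self h.1
  have h2 : EqOn v (D 0) (Ioo 0 T) :=
    Measure.eqOn_open_of_ae_eq h1 isOpen_Ioo (hv.mono Ioo_subset_Icc_self)
      (h0.mono Ioo_subset_Icc_self)
  exact h2.of_subset_closure hv h0 Ioo_subset_Icc_self (by rw [closure_Ioo hT.ne])

lemma IsDerivChain.tail {k : ℕ} {T : ℝ} {D : ℕ → ℝ → V} (h : IsDerivChain (k + 1) T D) :
    IsDerivChain k T (fun m => D (m + 1)) := fun m hm => h (m + 1) (Nat.succ_lt_succ hm)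

lemma IsDerivChain.intervalIntegrable {k : ℕ} {T : ℝ} {D : ℕ → ℝ → V} (h : IsDerivChain k T D)
    {m : ℕ} (hm : m < k) {a b : ℝ} (ha : 0 ≤ a) (hab : a ≤ b) (hb : b ≤ T) :
    IntervalIntegrable (D (m + 1)) volume a b :=
  (h m hm).1.mono_set (by
    rw [uIcc_of_le hab, uIcc_of_le (ha.trans (hab.trans hb))]
    exact Icc_subset_Icc ha hb)

/-- Integration of an approximation of the derivative. -/
lemma IsDerivChain.norm_sub_le_of_deriv [FiniteDimensional ℝ V] {k : ℕ} {T : ℝ} {D : ℕ → ℝ → V}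
    (h : IsDerivChain (k + 1) T D) {a b : ℝ} (ha : 0 ≤ a) (hab : a ≤ b) (hb : b ≤ T)
    {P P' : ℝ → V} (hP : ∀ t, HasDerivAt P (P' t) t) (hP' : Continuous P') (hPa : P a = D 0 a)
    {ε : ℝ} (hε : ∀ t ∈ Icc a b, ‖D 1 t - P' t‖ ≤ ε) {t : ℝ} (ht : t ∈ Icc a b) :
    ‖D 0 t - P t‖ ≤ (b - a) * ε := by
  have hi : IntervalIntegrable (D 1) volume a t :=
    h.intervalIntegrable (Nat.succ_pos k) ha ht.1 (ht.2.trans hb)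
  have h1 := (h 0 (Nat.succ_pos k)).2 a ⟨ha, hab.trans hb⟩ t ⟨ha.trans ht.1, ht.2.trans hb⟩
  have h2 : ∫ s in a..t, P' s = P t - P a :=
    intervalIntegral.integral_eq_sub_of_hasDerivAt (fun s _ => hP s) (hP'.intervalIntegrable a t)
  have h3 : D 0 t - P t = ∫ s in a..t, (D 1 s - P' s) := by
    rw [intervalIntegral.integral_sub hi (hP'.intervalIntegrable a t), h2, h1, hPa, zero_add]
    abel
  have hε0 : 0 ≤ ε := (norm_nonneg _).trans (hε a (left_mem_Icc.2 hab))
  rw [h3]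
  refine (intervalIntegral.norm_integral_le_of_norm_le_const (C := ε) fun s hs => ?_).trans ?_
  · rw [uIoc_of_le ht.1] at hs
    exact hε s ⟨hs.1.le, hs.2.trans ht.2⟩
  · rw [abs_of_nonneg (sub_nonneg.2 ht.1), mul_comm]
    exact mul_le_mul_of_nonneg_right (sub_le_sub_right ht.2 a) hε0

/-- Polynomial approximation on an interval. -/
lemma IsDerivChain.exists_timePoly_approx [FiniteDimensional ℝ V] {T : ℝ} (k : ℕ) {D : ℕ → ℝ → V}
    (h : IsDerivChain (k + 1) T D) {a b : ℝ} (ha : 0 ≤ a) (hab : a ≤ b) (hb : b ≤ T) :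
    ∃ P : ℝ → V, IsTimePoly k P ∧
      ∀ t ∈ Icc a b, ‖D 0 t - P t‖ ≤ (b - a) ^ k * ∫ s in a..b, ‖D (k + 1) s‖ := by
  induction k generalizing D with
  | zero =>
    refine ⟨fun _ => D 0 a, isTimePoly_const 0 _, fun t ht => ?_⟩
    have h1 := (h 0 Nat.one_pos).2 a ⟨ha, hab.trans hb⟩ t ⟨ha.trans ht.1, ht.2.trans hb⟩
    rw [h1, add_sub_cancel_left, pow_zero, one_mul]
    refine (intervalIntegral.norm_integral_le_integral_norm ht.1).trans ?_
    refine intervalIntegral.integral_mono_interval le_rfl ht.1 ht.2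
      (Filter.Eventually.of_forall fun _ => norm_nonneg _) ?_
    exact (h.intervalIntegrable Nat.one_pos ha hab hb).norm
  | succ k ih =>
    obtain ⟨P', hP', hPe⟩ := ih h.tail
    -- The approximation of the derivative is integrated from the left end point with the exact
    -- initial value; each integration gains one factor `b - a` and one degree.
    obtain ⟨P, hP, hPa, hPd⟩ := hP'.exists_antideriv a (D 0 a)
    refine ⟨P, hP, fun t ht => ?_⟩
    have := h.norm_sub_le_of_deriv ha hab hb hPd hP'.continuous hPa hPe ht
    rwa [← mul_assoc, ← pow_succ'] at this

end Weak

/-- The Cauchy-Schwarz inequality for the integral of a function over an interval. -/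
lemma sq_integral_le {f : ℝ → ℝ} {a b : ℝ} (hab : a ≤ b)
    (hf : MemLp f 2 (volume.restrict (Ioc a b))) :
    (∫ t in a..b, f t) ^ 2 ≤ (b - a) * ∫ t in a..b, f t ^ 2 := by
  have h1 : IntervalIntegrable f volume a b := by
    rw [intervalIntegrable_iff_integrableOn_Ioc_of_le hab]; exact hf.integrable one_le_two
  have h2 : IntervalIntegrable (fun t => f t ^ 2) volume a b := by
    rw [intervalIntegrable_iff_integrableOn_Ioc_of_le hab]; exact hf.integrable_sq
  rcases hab.eq_or_lt with rfl | hlt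
  · simp
  set I := ∫ t in a..b, f t
  -- The variance about the mean value is nonnegative; expanding it is the claim.
  have h3 : 0 ≤ ∫ t in a..b, (f t - I / (b - a)) ^ 2 :=
    intervalIntegral.integral_nonneg hab fun t _ => sq_nonneg _
  have h4 : ∫ t in a..b, (f t - I / (b - a)) ^ 2 =
      (∫ t in a..b, f t ^ 2) - I ^ 2 / (b - a) := by
    have : ∀ t, (f t - I / (b - a)) ^ 2 =
        f t ^ 2 - (2 * (I / (b - a))) * f t + (I / (b - a)) ^ 2 := fun t => by ring
    simp only [this]
    rw [intervalIntegral.integral_add (h2.sub (h1.const_mul _)) intervalIntegrable_const,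
      intervalIntegral.integral_sub h2 (h1.const_mul _), intervalIntegral.integral_const_mul,
      intervalIntegral.integral_const, smul_eq_mul]
    have : b - a ≠ 0 := (sub_pos.2 hlt).ne'
    change (∫ t in a..b, f t ^ 2) - 2 * (I / (b - a)) * I + _ = _
    field_simp
    ring
  rw [h4, sub_nonneg, div_le_iff₀ (sub_pos.2 hlt)] at h3
  linarith

/-! ### Unisolvence of the side conditions and the low moments -/

lemma Polynomial.integral_mul_self_pos {f : Polynomial ℝ} (hf : f ≠ 0) :
    0 < ∫ x in (-1 : ℝ)..1, f.eval x * f.eval x := by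
  have h : ∃ c ∈ Icc (-1 : ℝ) 1, f.eval c ≠ 0 := by
    by_contra! hcon
    exact hf (Polynomial.eq_zero_of_infinite_isRoot f
      ((Icc_infinite (by norm_num : (-1 : ℝ) < 1)).mono fun x hx => hcon x hx))
  obtain ⟨c, hc, hfc⟩ := h
  exact intervalIntegral.integral_pos (by norm_num) (f.continuous.mul f.continuous).continuousOn
    (fun x _ => mul_self_nonneg _) ⟨c, hc, mul_self_pos.2 hfc⟩

lemma Polynomial.integral_mul_eq_zero_of_moments {f : Polynomial ℝ} {g : ℝ → ℝ} {n : ℕ}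
    (hg : Continuous g) (hf : f.natDegree < n)
    (h : ∀ l < n, ∫ x in (0 : ℝ)..1, x ^ l * g x = 0) :
    ∫ x in (0 : ℝ)..1, f.eval x * g x = 0 := by
  have h1 : ∀ x, f.eval x * g x = ∑ l ∈ Finset.range n, f.coeff l * (x ^ l * g x) := by
    intro x
    rw [Polynomial.eval_eq_sum_range' hf, Finset.sum_mul]
    exact Finset.sum_congr rfl fun l _ => mul_assoc _ _ _
  simp only [h1]
  rw [intervalIntegral.integral_finsetSum]
  · refine Finset.sum_eq_zero fun l hl => ?_
    rw [intervalIntegral.integral_const_mul, h l (Finset.mem_range.1 hl), mul_zero]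
  · intro l _
    exact Continuous.intervalIntegrable (by fun_prop) _ _

/-- Expand the polynomial in the orthogonal polynomials transplanted to `[0, 1]`. Vanishing moments
below `q + 1 - ns` kill the coefficients of low index by orthogonality. The `ns` remaining ones
satisfy the homogeneous linear system expressing the zeros at the `θ k`, whose matrix is
nonsingular. -/
lemma IsOrthogonalBasis.eq_zero_of_moments_of_nodes {q ns : ℕ} (hns : ns ≤ q + 1)
    {θ : Fin ns → ℝ} {ψ : ℕ → Polynomial ℝ} (hψ : IsOrthogonalBasis q ψ)
    (hD : Matrix.det (fun j k : Fin ns => (ψ ((k : ℕ) + 1 + q - ns)).eval (2 * θ j - 1)) ≠ 0)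
    (c : Fin (q + 1) → ℝ)
    (hθ : ∀ k, ∑ j : Fin (q + 1), θ k ^ (j : ℕ) * c j = 0)
    (hm : ∀ l < q + 1 - ns, ∫ x in (0 : ℝ)..1, x ^ l * ∑ j : Fin (q + 1), x ^ (j : ℕ) * c j = 0) :
    c = 0 := by
  let φ : ℕ → Polynomial ℝ := fun j => (ψ j).comp (Polynomial.C 2 * Polynomial.X - 1)
  have hφev : ∀ j x, (φ j).eval x = (ψ j).eval (2 * x - 1) := fun j x => by simp [φ]
  have hφdeg : ∀ j ≤ q, (φ j).natDegree ≤ j := by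
    intro j hj
    refine Polynomial.natDegree_comp_le.trans ?_
    have h1 : (Polynomial.C (2 : ℝ) * Polynomial.X - 1).natDegree ≤ 1 := by compute_degree
    calc _ ≤ j * 1 := Nat.mul_le_mul (hψ.1 j hj).2 h1
      _ = j := mul_one j
  have hint : ∀ j l, ∫ x in (0 : ℝ)..1, (φ j).eval x * (φ l).eval x =
      2⁻¹ * ∫ x in (-1 : ℝ)..1, (ψ j).eval x * (ψ l).eval x := by
    intro j l
    simp only [hφev]
    have := intervalIntegral.integral_comp_mul_sub (a := 0) (b := 1)
      (fun x => (ψ j).eval x * (ψ l).eval x) (two_ne_zero (α := ℝ)) 1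
    rw [this]
    norm_num
  have hφorth : ∀ j ≤ q, ∀ l ≤ q, j ≠ l → ∫ x in (0 : ℝ)..1, (φ j).eval x * (φ l).eval x = 0 :=
    fun j hj l hl hjl => by rw [hint, hψ.2 j hj l hl hjl, mul_zero]
  have hφpos : ∀ j ≤ q, 0 < ∫ x in (0 : ℝ)..1, (φ j).eval x * (φ j).eval x := fun j hj => by
    rw [hint]
    exact mul_pos (by norm_num) (Polynomial.integral_mul_self_pos (hψ.1 j hj).1)
  let S : (Fin (q + 1) → ℝ) →ₗ[ℝ] Polynomial ℝ :=
    ∑ j : Fin (q + 1), (LinearMap.proj (R := ℝ) (φ := fun _ : Fin (q + 1) => ℝ) j).smulRight (φ j)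
  have hS : ∀ a, S a = ∑ j : Fin (q + 1), a j • φ j := fun a => by
    simp [S, LinearMap.sum_apply]
  have hSev : ∀ a x, (S a).eval x = ∑ j : Fin (q + 1), a j * (φ j).eval x := fun a x => by
    rw [hS, Polynomial.eval_finsetSum]; simp
  have hSdeg : ∀ a, (S a).natDegree < q + 1 := by
    intro a
    rw [hS, Nat.lt_succ_iff]
    refine Polynomial.natDegree_sum_le_of_forall_le _ _ fun j _ => ?_
    have hj : (j : ℕ) ≤ q := by omega
    exact (Polynomial.natDegree_smul_le _ _).trans ((hφdeg j hj).trans hj)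
  have hcoef : ∀ a, ∀ l : Fin (q + 1), ∫ x in (0 : ℝ)..1, (φ l).eval x * (S a).eval x =
      a l * ∫ x in (0 : ℝ)..1, (φ l).eval x * (φ l).eval x := by
    intro a l
    have h1 : ∀ x, (φ l).eval x * (S a).eval x =
        ∑ j : Fin (q + 1), a j * ((φ l).eval x * (φ j).eval x) := by
      intro x
      rw [hSev, Finset.mul_sum]
      exact Finset.sum_congr rfl fun j _ => by ring
    simp only [h1]
    rw [intervalIntegral.integral_finsetSum]
    · simp only [intervalIntegral.integral_const_mul]
      refine Finset.sum_eq_single_of_mem l (Finset.mem_univ l) fun j _ hj => ?_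
      rw [hφorth l (by omega) j (by omega) (fun h => hj (Fin.ext h.symm)), mul_zero]
    · intro j _
      exact ((continuous_const.mul ((φ l).continuous.mul (φ j).continuous))).intervalIntegrable _ _
  -- The passage from orthogonal to monomial coefficients. It is injective by orthogonality, hence
  -- surjective, so the `ψ j` span all polynomials of degree at most `q` although only upper bounds
  -- on their degrees are given.
  let Tm : (Fin (q + 1) → ℝ) →ₗ[ℝ] (Fin (q + 1) → ℝ) :=
    LinearMap.pi fun m => (Polynomial.lcoeff ℝ (m : ℕ)) ∘ₗ S
  have hTinj : Function.Injective Tm := by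
    rw [injective_iff_map_eq_zero]
    intro a ha
    have hSa : S a = 0 := by
      ext m
      by_cases hm : m < q + 1
      · exact congrFun ha ⟨m, hm⟩
      · rw [Polynomial.coeff_eq_zero_of_natDegree_lt, Polynomial.coeff_zero]
        have := hSdeg a
        omega
    funext l
    have h1 := hcoef a l
    rw [hSa] at h1
    simp only [Polynomial.eval_zero, mul_zero, intervalIntegral.integral_zero] at h1
    exact (mul_eq_zero.1 h1.symm).resolve_right (hφpos l (by omega)).ne'
  obtain ⟨a, rfl⟩ := (LinearMap.injective_iff_surjective.1 hTinj) c
  have hev : ∀ x : ℝ, ∑ j : Fin (q + 1), x ^ (j : ℕ) * Tm a j = (S a).eval x := by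
    intro x
    rw [Polynomial.eval_eq_sum_range' (hSdeg a), Finset.sum_range]
    exact Finset.sum_congr rfl fun j _ => mul_comm _ _
  simp only [hev] at hθ hm
  have hlow : ∀ j : Fin (q + 1), (j : ℕ) < q + 1 - ns → a j = 0 := by
    intro j hj
    have h1 := hcoef a j
    rw [Polynomial.integral_mul_eq_zero_of_moments (S a).continuous
      (lt_of_le_of_lt (hφdeg j (by omega)) hj) hm] at h1
    exact (mul_eq_zero.1 h1.symm).resolve_right (hφpos j (by omega)).ne'
  -- The top `ns` indices `q + 1 - ns, …, q`, which are the columns of the matrix.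
  let ι : Fin ns → Fin (q + 1) := fun k => ⟨(k : ℕ) + 1 + q - ns, by omega⟩
  have hιinj : Function.Injective ι := fun k l h => by
    have : (k : ℕ) + 1 + q - ns = (l : ℕ) + 1 + q - ns := congrArg Fin.val h
    exact Fin.ext (by omega)
  have hsum : ∀ x, (S a).eval x = ∑ k, (φ (ι k)).eval x * a (ι k) := by
    intro x
    have h1 : ∑ j ∈ Finset.univ.image ι, a j * (φ j).eval x = ∑ j, a j * (φ j).eval x := by
      refine Finset.sum_subset (Finset.subset_univ _) fun j _ hj => ?_
      by_cases hjl : (j : ℕ) < q + 1 - ns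
      · rw [hlow j hjl, zero_mul]
      · refine absurd (Finset.mem_image.2 ⟨⟨(j : ℕ) - (q + 1 - ns), by omega⟩,
          Finset.mem_univ _, Fin.ext ?_⟩) hj
        simp only [ι]
        omega
    rw [hSev, ← h1, Finset.sum_image fun k _ l _ h => hιinj h]
    exact Finset.sum_congr rfl fun j _ => mul_comm _ _
  have hzero := Matrix.eq_zero_of_mulVec_eq_zero hD (v := fun k => a (ι k)) (by
    funext j
    have h1 := hθ j
    rw [hsum] at h1
    simp only [hφev] at h1
    exact h1)
  have ha : a = 0 := by
    funext j
    by_cases hjl : (j : ℕ) < q + 1 - ns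
    · exact hlow j hjl
    · have h1 := congrFun hzero ⟨(j : ℕ) - (q + 1 - ns), by omega⟩
      have h2 : ι ⟨(j : ℕ) - (q + 1 - ns), by omega⟩ = j := Fin.ext (by simp only [ι]; omega)
      simp only [h2] at h1
      exact h1
  rw [ha, map_zero]

/-- The coefficients of a polynomial are combinations of its values at the `θ k` and its low
moments. -/
lemma Method.exists_reconstruction (Q : Method) {ψ : ℕ → Polynomial ℝ}
    (hψ : IsOrthogonalBasis Q.q ψ) (hD : (Q.Dtilde ψ).det ≠ 0) :
    ∃ (α : Fin (Q.q + 1) → Fin Q.ns → ℝ) (β : Fin (Q.q + 1) → Fin (Q.q + 1 - Q.ns) → ℝ),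
      ∀ m j : Fin (Q.q + 1), ∑ k, α m k * Q.θ k ^ (j : ℕ) +
        ∑ l, β m l * (((j : ℕ) : ℝ) + ((l : ℕ) : ℝ) + 1)⁻¹ = if m = j then 1 else 0 := by
  -- `Φ` sends the coefficients to the values at the `θ k` and the moments on `[0, 1]`, where `(j +
  -- l + 1)⁻¹` is the integral of `x ^ (j + l)`. It is injective by unisolvence, and `α`, `β` are
  -- the entries of a left inverse.
  let Φ : (Fin (Q.q + 1) → ℝ) →ₗ[ℝ] (Fin Q.ns ⊕ Fin (Q.q + 1 - Q.ns) → ℝ) :=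
    Matrix.toLin' (Matrix.of fun i (j : Fin (Q.q + 1)) =>
      Sum.elim (fun k => Q.θ k ^ (j : ℕ))
        (fun l : Fin (Q.q + 1 - Q.ns) => (((j : ℕ) : ℝ) + ((l : ℕ) : ℝ) + 1)⁻¹) i)
  have hΦl : ∀ c k, Φ c (Sum.inl k) = ∑ j : Fin (Q.q + 1), Q.θ k ^ (j : ℕ) * c j := fun c k => rfl
  have hΦr : ∀ c l, Φ c (Sum.inr l) =
      ∑ j : Fin (Q.q + 1), (((j : ℕ) : ℝ) + ((l : ℕ) : ℝ) + 1)⁻¹ * c j := fun c l => rfl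
  have hinj : Function.Injective Φ := by
    rw [injective_iff_map_eq_zero]
    intro c hc
    refine hψ.eq_zero_of_moments_of_nodes Q.ns_le hD c (fun k => ?_) fun l hl => ?_
    · rw [← hΦl, hc]; rfl
    · have h1 : ∀ x : ℝ, x ^ l * ∑ j : Fin (Q.q + 1), x ^ (j : ℕ) * c j =
          ∑ j : Fin (Q.q + 1), c j * x ^ ((j : ℕ) + l) := by
        intro x
        rw [Finset.mul_sum]
        exact Finset.sum_congr rfl fun j _ => by ring
      simp only [h1]
      rw [intervalIntegral.integral_finsetSum]
      · have h2 : Φ c (Sum.inr ⟨l, hl⟩) = 0 := by rw [hc]; rfl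
        rw [hΦr] at h2
        refine Eq.trans (Finset.sum_congr rfl fun j _ => ?_) h2
        rw [intervalIntegral.integral_const_mul, integral_pow]
        simp
        ring
      · intro j _
        exact Continuous.intervalIntegrable (by fun_prop) _ _
  obtain ⟨Ψ, hΨ⟩ := Φ.exists_leftInverse_of_injective (LinearMap.ker_eq_bot.2 hinj)
  refine ⟨fun m k => Ψ (Pi.single (Sum.inl k) 1) m, fun m l => Ψ (Pi.single (Sum.inr l) 1) m,
    fun m j => ?_⟩
  have h1 : Ψ (Φ (Pi.single j 1)) = Pi.single j 1 := LinearMap.congr_fun hΨ _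
  rw [LinearMap.pi_apply_eq_sum_univ Ψ, Fintype.sum_sum_type] at h1
  have hs : ∀ i : Fin Q.ns ⊕ Fin (Q.q + 1 - Q.ns),
      (fun j => if i = j then (1 : ℝ) else 0) = Pi.single i 1 := fun i => by
    funext j; simp [Pi.single_apply, eq_comm]
  simp only [hs] at h1
  have h2 := congrFun h1 m
  simp only [hΦl, hΦr, Pi.add_apply, Finset.sum_apply, Pi.smul_apply, smul_eq_mul,
    Pi.single_apply j, mul_ite, mul_one, mul_zero, Finset.sum_ite_eq', Finset.mem_univ,
    if_true] at h2
  rw [← h2]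
  congr 1 <;> exact Finset.sum_congr rfl fun k _ => mul_comm _ _

/-! ### Stability of a single substep. -/

section Substep

variable {V : Type*} [NormedAddCommGroup V] [InnerProductSpace ℝ V]

lemma integral_moment_timePoly {q l : ℕ} {c : Fin (q + 1) → V} [CompleteSpace V] :
    ∫ x in (0 : ℝ)..1, x ^ l • ∑ j : Fin (q + 1), x ^ (j : ℕ) • c j =
      ∑ j : Fin (q + 1), (((j : ℕ) : ℝ) + (l : ℝ) + 1)⁻¹ • c j := by
  have h1 : ∀ x : ℝ, x ^ l • ∑ j : Fin (q + 1), x ^ (j : ℕ) • c j =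
      ∑ j : Fin (q + 1), x ^ ((j : ℕ) + l) • c j := by
    intro x
    rw [Finset.smul_sum]
    exact Finset.sum_congr rfl fun j _ => by rw [smul_smul, ← pow_add, add_comm]
  simp only [h1]
  rw [intervalIntegral.integral_finsetSum]
  · refine Finset.sum_congr rfl fun j _ => ?_
    rw [intervalIntegral.integral_smul_const, integral_pow]
    simp
  · intro j _
    exact Continuous.intervalIntegrable (by fun_prop) _ _

/-- On a substep, a polynomial is bounded by its values at the side points and its low moments. -/
lemma Method.exists_norm_le_of_moments (Q : Method) {ψ : ℕ → Polynomial ℝ}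
    (hψ : IsOrthogonalBasis Q.q ψ) (hD : (Q.Dtilde ψ).det ≠ 0) :
    ∃ C, 0 ≤ C ∧ ∀ (V : Type) [NormedAddCommGroup V] [InnerProductSpace ℝ V] [CompleteSpace V]
      (z : ℝ → V), IsTimePoly Q.q z → ∀ a h : ℝ, 0 < h → ∀ t ∈ Icc a (a + h),
      ‖z t‖ ≤ C * (∑ k, ‖z (a + Q.θ k * h)‖ + ∑ l : Fin (Q.q + 1 - Q.ns),
        ‖∫ s in a..(a + h), (h⁻¹ * ((s - a) / h) ^ (l : ℕ)) • z s‖) := by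
  obtain ⟨α, β, hαβ⟩ := Q.exists_reconstruction hψ hD
  -- The reconstruction is scalar and takes place on `[0, 1]`, so this constant serves every space
  -- `V` and every substep.
  refine ⟨∑ m, (∑ k, |α m k| + ∑ l, |β m l|), Finset.sum_nonneg fun m _ =>
    add_nonneg (Finset.sum_nonneg fun _ _ => abs_nonneg _)
      (Finset.sum_nonneg fun _ _ => abs_nonneg _), ?_⟩
  intro V _ _ _ z hz a h hh t ht
  obtain ⟨c, hc⟩ := hz.comp_affine a h
  have hmom : ∀ l : ℕ, ∫ s in a..(a + h), (h⁻¹ * ((s - a) / h) ^ l) • z s =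
      ∑ j : Fin (Q.q + 1), (((j : ℕ) : ℝ) + (l : ℝ) + 1)⁻¹ • c j := by
    intro l
    rw [← integral_moment_timePoly (l := l) (c := c)]
    have h1 := intervalIntegral.integral_comp_add_mul (a := 0) (b := 1)
      (fun s => (h⁻¹ * ((s - a) / h) ^ l) • z s) hh.ne' a
    rw [mul_zero, add_zero, mul_one] at h1
    have h2 : ∫ s in a..(a + h), (h⁻¹ * ((s - a) / h) ^ l) • z s =
        h • ∫ x in (0 : ℝ)..1, (h⁻¹ * ((a + h * x - a) / h) ^ l) • z (a + h * x) := by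
      rw [h1, smul_smul, mul_inv_cancel₀ hh.ne', one_smul]
    rw [h2, ← intervalIntegral.integral_smul]
    refine intervalIntegral.integral_congr fun x _ => ?_
    simp only [hc, smul_smul]
    congr 1
    have : (a + h * x - a) / h = x := by field_simp; ring
    rw [this]
    field_simp
  have hθ : ∀ k, z (a + Q.θ k * h) = ∑ j : Fin (Q.q + 1), Q.θ k ^ (j : ℕ) • c j := fun k => by
    rw [← hc, mul_comm]
  -- The identities for `α` and `β` applied to vector coefficients: each coefficient on the
  -- reference interval is a combination of side values and scaled moments.
  have hcm : ∀ m, c m = ∑ k, α m k • z (a + Q.θ k * h) + ∑ l : Fin (Q.q + 1 - Q.ns),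
      β m l • ∫ s in a..(a + h), (h⁻¹ * ((s - a) / h) ^ (l : ℕ)) • z s := by
    intro m
    simp only [hmom, hθ, Finset.smul_sum, smul_smul]
    rw [Finset.sum_comm, Finset.sum_comm (s := (Finset.univ : Finset (Fin (Q.q + 1 - Q.ns)))),
      ← Finset.sum_add_distrib]
    simp only [← Finset.sum_smul, ← add_smul, hαβ, ite_smul, one_smul, zero_smul]
    simp
  set A := ∑ k, ‖z (a + Q.θ k * h)‖
  set B := ∑ l : Fin (Q.q + 1 - Q.ns), ‖∫ s in a..(a + h), (h⁻¹ * ((s - a) / h) ^ (l : ℕ)) • z s‖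
  have hA : 0 ≤ A := Finset.sum_nonneg fun _ _ => norm_nonneg _
  have hB : 0 ≤ B := Finset.sum_nonneg fun _ _ => norm_nonneg _
  have hcn : ∀ m, ‖c m‖ ≤ (∑ k, |α m k| + ∑ l, |β m l|) * (A + B) := by
    intro m
    rw [hcm m, add_mul]
    refine (norm_add_le _ _).trans (add_le_add ?_ ?_)
    · refine (norm_sum_le _ _).trans ?_
      rw [Finset.sum_mul]
      refine Finset.sum_le_sum fun k _ => ?_
      rw [norm_smul, Real.norm_eq_abs]
      refine mul_le_mul_of_nonneg_left ?_ (abs_nonneg _)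
      exact (Finset.single_le_sum (f := fun k => ‖z (a + Q.θ k * h)‖)
        (fun _ _ => norm_nonneg _) (Finset.mem_univ k)).trans (le_add_of_nonneg_right hB)
    · refine (norm_sum_le _ _).trans ?_
      rw [Finset.sum_mul]
      refine Finset.sum_le_sum fun l _ => ?_
      rw [norm_smul, Real.norm_eq_abs]
      refine mul_le_mul_of_nonneg_left ?_ (abs_nonneg _)
      exact (Finset.single_le_sum (f := fun l : Fin (Q.q + 1 - Q.ns) =>
        ‖∫ s in a..(a + h), (h⁻¹ * ((s - a) / h) ^ (l : ℕ)) • z s‖)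
        (fun _ _ => norm_nonneg _) (Finset.mem_univ l)).trans (le_add_of_nonneg_left hA)
  have ht' : z t = ∑ j : Fin (Q.q + 1), ((t - a) / h) ^ (j : ℕ) • c j := by
    rw [← hc]; congr 1; field_simp; ring
  rw [ht', Finset.sum_mul]
  refine (norm_sum_le _ _).trans (Finset.sum_le_sum fun m _ => ?_)
  rw [norm_smul]
  refine le_trans ?_ (hcn m)
  refine mul_le_of_le_one_left (norm_nonneg _) ?_
  have h0 : 0 ≤ (t - a) / h := div_nonneg (sub_nonneg.2 ht.1) hh.le
  rw [norm_pow, Real.norm_of_nonneg h0]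
  exact pow_le_one₀ h0 ((div_le_one hh).2 (by linarith [ht.2]))

/-- Stability of a substep. -/
lemma Method.exists_substep_bound (Q : Method) {ψ : ℕ → Polynomial ℝ}
    (hψ : IsOrthogonalBasis Q.q ψ) (hD : (Q.Dtilde ψ).det ≠ 0) :
    ∃ C, 0 ≤ C ∧ ∀ (V : Type) [NormedAddCommGroup V] [InnerProductSpace ℝ V] [CompleteSpace V]
      (x y P ξ : ℝ → V) (E₀ E₁ : V) (a h ρ : ℝ), IsTimePoly Q.q x → IsTimePoly Q.q P → 0 < h →
      ContinuousOn y (Icc a (a + h)) → IntervalIntegrable ξ volume a (a + h) →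
      (∀ t ∈ Icc a (a + h), ‖y t - P t‖ ≤ ρ) →
      (∀ k, ‖y (a + Q.θ k * h) - P (a + Q.θ k * h)‖ ≤ ρ) →
      (∀ v : ℝ → V, IsTimePoly (Q.q + 1 - Q.ns) v →
        inner ℝ E₁ (v (a + h)) - inner ℝ E₀ (v a) =
          (∫ t in a..(a + h), inner ℝ (y t - x t) (deriv v t)) -
            ∫ t in a..(a + h), inner ℝ (ξ t) (v t)) →
      ∀ t ∈ Icc a (a + h), ‖y t - x t‖ ≤
        C * (‖E₁‖ + ∑ k, ‖y (a + Q.θ k * h) - x (a + Q.θ k * h)‖ + ρ +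
          ∫ t in a..(a + h), ‖ξ t‖) := by
  obtain ⟨C, hC0, hC⟩ := Q.exists_norm_le_of_moments hψ hD
  -- The leading `1` accounts for `y - P`. In the bracket multiplied by `C`, the `1` stands for the
  -- side values of `y - x`, `ns` for replacing `y` by `P` there, and `q + 1 - ns` for the moments.
  refine ⟨1 + C * (1 + Q.ns + ((Q.q + 1 - Q.ns : ℕ) : ℝ)), by positivity, ?_⟩
  intro V _ _ _ x y P ξ E₀ E₁ a h ρ hx hP hh hy hξ hρ hρθ heq t ht
  have hah : a ≤ a + h := by linarith
  have hρ0 : 0 ≤ ρ := (norm_nonneg _).trans (hρ t ht)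
  set Ξ := ∫ t in a..(a + h), ‖ξ t‖ with hΞ
  have hΞ0 : 0 ≤ Ξ := intervalIntegral.integral_nonneg hah fun _ _ => norm_nonneg _
  have hx' := hx.continuous
  have hP' := hP.continuous
  have hfrac : ∀ s ∈ Icc a (a + h), (s - a) / h ∈ Icc (0 : ℝ) 1 := fun s hs =>
    ⟨div_nonneg (sub_nonneg.2 hs.1) hh.le, (div_le_one hh).2 (by linarith [hs.2])⟩
  have hIyx : ∀ l : ℕ, IntervalIntegrable
      (fun s => (h⁻¹ * ((s - a) / h) ^ l) • (y s - x s)) volume a (a + h) := fun l => by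
    refine ContinuousOn.intervalIntegrable ?_
    rw [uIcc_of_le hah]
    exact ContinuousOn.smul (by fun_prop) (hy.sub hx'.continuousOn)
  have hIyP : ∀ l : ℕ, IntervalIntegrable
      (fun s => (h⁻¹ * ((s - a) / h) ^ l) • (y s - P s)) volume a (a + h) := fun l => by
    refine ContinuousOn.intervalIntegrable ?_
    rw [uIcc_of_le hah]
    exact ContinuousOn.smul (by fun_prop) (hy.sub hP'.continuousOn)
  -- The moment `m` is tested against itself: `v = ((s - a) / h) ^ (l + 1) • m` has admissible
  -- degree, vanishes at `a`, so that `E₀` drops out, equals `m` at `a + h`, and its derivative is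
  -- `l + 1` times the weight of the moment. Hence `(l + 1) ‖m‖²` is at most `(‖E₁‖ + Ξ) ‖m‖`.
  have hm1 : ∀ l : Fin (Q.q + 1 - Q.ns),
      ‖∫ s in a..(a + h), (h⁻¹ * ((s - a) / h) ^ (l : ℕ)) • (y s - x s)‖ ≤ ‖E₁‖ + Ξ := by
    intro l
    set m := ∫ s in a..(a + h), (h⁻¹ * ((s - a) / h) ^ (l : ℕ)) • (y s - x s) with hmdef
    have hv : IsTimePoly (Q.q + 1 - Q.ns) (fun s => ((s - a) / h) ^ ((l : ℕ) + 1) • m) := by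
      have := isTimePoly_affine_pow_smul (q := Q.q + 1 - Q.ns) (j := (l : ℕ) + 1) (by omega)
        (-a / h) (h⁻¹) m
      refine (funext fun s => ?_ : (fun s => ((s - a) / h) ^ ((l : ℕ) + 1) • m) = _) ▸ this
      congr 2
      field_simp
      ring
    have hdv : ∀ s, deriv (fun s => ((s - a) / h) ^ ((l : ℕ) + 1) • m) s =
        ((((l : ℕ) : ℝ) + 1) * (h⁻¹ * ((s - a) / h) ^ (l : ℕ))) • m := by
      intro s
      have h1 : HasDerivAt (fun s => (s - a) / h) (1 / h) s :=
        ((hasDerivAt_id s).sub_const a).div_const h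
      have h2 := (h1.fun_pow ((l : ℕ) + 1)).smul_const m
      rw [h2.deriv]
      congr 1
      push_cast
      ring
    have h1 := heq _ hv
    have h2 : (a + h - a) / h = 1 := by field_simp; ring
    simp only [hdv, h2, sub_self, zero_div, one_pow, one_smul, zero_smul, inner_zero_right,
      sub_zero, ne_eq, Nat.succ_ne_zero, not_false_eq_true, zero_pow] at h1
    have h3 : ∫ s in a..(a + h), (inner ℝ (y s - x s)
        (((((l : ℕ) : ℝ) + 1) * (h⁻¹ * ((s - a) / h) ^ (l : ℕ))) • m) : ℝ) =
        (((l : ℕ) : ℝ) + 1) * ‖m‖ ^ 2 := by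
      have h4 := (innerSL ℝ m).intervalIntegral_comp_comm (hIyx l)
      rw [← hmdef, innerSL_apply_apply, real_inner_self_eq_norm_sq] at h4
      rw [← h4, ← intervalIntegral.integral_const_mul]
      refine intervalIntegral.integral_congr fun s _ => ?_
      rw [innerSL_apply_apply, real_inner_smul_right, real_inner_smul_right, real_inner_comm]
      ring
    rw [h3] at h1
    have h5 : |∫ s in a..(a + h), (inner ℝ (ξ s) (((s - a) / h) ^ ((l : ℕ) + 1) • m) : ℝ)| ≤
        Ξ * ‖m‖ := by
      rw [← Real.norm_eq_abs, hΞ, ← intervalIntegral.integral_mul_const]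
      refine intervalIntegral.norm_integral_le_of_norm_le hah ?_ (hξ.norm.mul_const _)
      refine Filter.Eventually.of_forall fun s hs => (norm_inner_le_norm _ _).trans ?_
      refine mul_le_mul_of_nonneg_left ?_ (norm_nonneg _)
      rw [norm_smul]
      obtain ⟨h6, h7⟩ := hfrac s (Ioc_subset_Icc_self hs)
      rw [norm_pow, Real.norm_of_nonneg h6]
      exact mul_le_of_le_one_left (norm_nonneg _) (pow_le_one₀ h6 h7)
    have h6 : (inner ℝ E₁ m : ℝ) ≤ ‖E₁‖ * ‖m‖ := real_inner_le_norm _ _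
    have h7 : ‖m‖ ^ 2 ≤ (‖E₁‖ + Ξ) * ‖m‖ := by
      have h8 := abs_le.1 h5
      have h9 : ‖m‖ ^ 2 ≤ (((l : ℕ) : ℝ) + 1) * ‖m‖ ^ 2 :=
        le_mul_of_one_le_left (sq_nonneg _) (by linarith [(Nat.cast_nonneg (l : ℕ) : (0:ℝ) ≤ _)])
      linarith
    rcases (norm_nonneg m).eq_or_lt with h8 | h8
    · rw [← h8]; positivity
    · rw [pow_two] at h7; exact le_of_mul_le_mul_right h7 h8
  have hm2 : ∀ l : Fin (Q.q + 1 - Q.ns),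
      ‖∫ s in a..(a + h), (h⁻¹ * ((s - a) / h) ^ (l : ℕ)) • (y s - P s)‖ ≤ ρ := by
    intro l
    have h1 : ∀ s ∈ uIoc a (a + h), ‖(h⁻¹ * ((s - a) / h) ^ (l : ℕ)) • (y s - P s)‖ ≤
        h⁻¹ * ρ := by
      intro s hs
      rw [uIoc_of_le hah] at hs
      have hs' := Ioc_subset_Icc_self hs
      obtain ⟨h6, h7⟩ := hfrac s hs'
      rw [norm_smul, norm_mul, norm_pow, Real.norm_of_nonneg h6,
        Real.norm_of_nonneg (inv_nonneg.2 hh.le)]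
      refine mul_le_mul (mul_le_of_le_one_right (inv_nonneg.2 hh.le) (pow_le_one₀ h6 h7))
        (hρ s hs') (norm_nonneg _) (inv_nonneg.2 hh.le)
    refine (intervalIntegral.norm_integral_le_of_norm_le_const h1).trans ?_
    rw [add_sub_cancel_left, abs_of_pos hh]
    field_simp
    exact le_rfl
  -- The difference `y - x` is no polynomial, but `P - x` is one of degree at most `q`.
  have hz := hC V (fun s => P s - x s) (hP.sub hx) a h hh t ht
  -- A side point may lie before the substep, since `θ k` may be negative; the closeness of `y` and
  -- `P` there is a separate hypothesis.
  have hs1 : ∑ k, ‖P (a + Q.θ k * h) - x (a + Q.θ k * h)‖ ≤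
      ∑ k, ‖y (a + Q.θ k * h) - x (a + Q.θ k * h)‖ + Q.ns * ρ := by
    have : (Q.ns : ℝ) * ρ = ∑ _k : Fin Q.ns, ρ := by simp
    rw [this, ← Finset.sum_add_distrib]
    refine Finset.sum_le_sum fun k _ => ?_
    have : P (a + Q.θ k * h) - x (a + Q.θ k * h) = (y (a + Q.θ k * h) - x (a + Q.θ k * h)) -
      (y (a + Q.θ k * h) - P (a + Q.θ k * h)) := by abel
    rw [this]
    exact (norm_sub_le _ _).trans (add_le_add le_rfl (hρθ k))
  have hs2 : ∑ l : Fin (Q.q + 1 - Q.ns),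
      ‖∫ s in a..(a + h), (h⁻¹ * ((s - a) / h) ^ (l : ℕ)) • (P s - x s)‖ ≤
      ((Q.q + 1 - Q.ns : ℕ) : ℝ) * (‖E₁‖ + Ξ + ρ) := by
    have : ((Q.q + 1 - Q.ns : ℕ) : ℝ) * (‖E₁‖ + Ξ + ρ) =
      ∑ _l : Fin (Q.q + 1 - Q.ns), (‖E₁‖ + Ξ + ρ) := by
        rw [Finset.sum_const, Finset.card_univ, Fintype.card_fin, nsmul_eq_mul]
    rw [this]
    refine Finset.sum_le_sum fun l _ => ?_
    have h1 : ∫ s in a..(a + h), (h⁻¹ * ((s - a) / h) ^ (l : ℕ)) • (P s - x s) =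
        (∫ s in a..(a + h), (h⁻¹ * ((s - a) / h) ^ (l : ℕ)) • (y s - x s)) -
        ∫ s in a..(a + h), (h⁻¹ * ((s - a) / h) ^ (l : ℕ)) • (y s - P s) := by
      rw [← intervalIntegral.integral_sub (hIyx l) (hIyP l)]
      refine intervalIntegral.integral_congr fun s _ => ?_
      rw [← smul_sub]
      congr 1
      abel
    rw [h1]
    exact (norm_sub_le _ _).trans (add_le_add (hm1 l) (hm2 l))
  set Κ := ∑ k, ‖y (a + Q.θ k * h) - x (a + Q.θ k * h)‖
  have hΚ0 : 0 ≤ Κ := Finset.sum_nonneg fun _ _ => norm_nonneg _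
  have h1 : ‖y t - x t‖ ≤ ρ + C * ((Κ + Q.ns * ρ) +
      ((Q.q + 1 - Q.ns : ℕ) : ℝ) * (‖E₁‖ + Ξ + ρ)) := by
    have : y t - x t = (y t - P t) + (P t - x t) := by abel
    rw [this]
    refine (norm_add_le _ _).trans (add_le_add (hρ t ht) (hz.trans ?_))
    exact mul_le_mul_of_nonneg_left (add_le_add hs1 hs2) hC0
  refine h1.trans ?_
  have hE0 := norm_nonneg E₁
  have hn0 : (0 : ℝ) ≤ Q.ns := Nat.cast_nonneg _
  have hs0 : (0 : ℝ) ≤ ((Q.q + 1 - Q.ns : ℕ) : ℝ) := Nat.cast_nonneg _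
  generalize ((Q.q + 1 - Q.ns : ℕ) : ℝ) = s at *
  set S := ‖E₁‖ + Κ + ρ + Ξ
  have a1 : s * (‖E₁‖ + Ξ + ρ) ≤ s * S := mul_le_mul_of_nonneg_left (by linarith) hs0
  have a2 : Q.ns * ρ ≤ Q.ns * S := mul_le_mul_of_nonneg_left (by linarith) hn0
  have a3 : C * ((Κ + Q.ns * ρ) + s * (‖E₁‖ + Ξ + ρ)) ≤ C * ((S + Q.ns * S) + s * S) :=
    mul_le_mul_of_nonneg_left (by linarith) hC0
  have a4 : (1 + C * (1 + Q.ns + s)) * S = S + C * ((S + Q.ns * S) + s * S) := by ring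
  linarith

end Substep

/-! ### The coupling conditions in a Hilbert space -/

section Hilbert

variable {H : Type*} [NormedAddCommGroup H] [InnerProductSpace ℝ H]

/-- The hypotheses make `x` the orthogonal projection of `y` onto `K`, so `x - p` is the projection
of `y - p`. No completeness is needed. -/
lemma norm_sub_le_of_inner_eq {K : Submodule ℝ H} {x y p : H} (hx : x ∈ K) (hp : p ∈ K)
    (h : ∀ l ∈ K, (inner ℝ x l : ℝ) = inner ℝ y l) : ‖x - p‖ ≤ ‖y - p‖ := by
  have h1 : ‖x - p‖ * ‖x - p‖ ≤ ‖y - p‖ * ‖x - p‖ := by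
    rw [← real_inner_self_eq_norm_mul_norm]
    calc (inner ℝ (x - p) (x - p) : ℝ) = inner ℝ (y - p) (x - p) := by
          rw [inner_sub_left, inner_sub_left y, h _ (K.sub_mem hx hp)]
      _ ≤ _ := real_inner_le_norm _ _
  rcases (norm_nonneg (x - p)).eq_or_lt with h2 | h2
  · rw [← h2]; exact norm_nonneg _
  · exact le_of_mul_le_mul_right h1 h2

variable {K : Fin 2 → Submodule ℝ H} {b : Fin 2 → Fin 2 → ℝ} {U Uh UΓ F Fh P G : Fin 2 → H}

/-- Here `U` is the exact trace, `Uh` the discrete one, `UΓ` its projection and `P` any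
approximation of `U`. -/
lemma norm_sub_trace_le (hUΓ : ∀ j, UΓ j ∈ K j) (hP : ∀ j, P j ∈ K j)
    (h1 : ∀ j, ∀ l ∈ K j, (inner ℝ (UΓ j) l : ℝ) = inner ℝ (Uh j) l) (j : Fin 2) :
    ‖U j - UΓ j‖ ≤ 2 * ‖U j - P j‖ + ‖U j - Uh j‖ := by
  have h2 := norm_sub_le_of_inner_eq (hUΓ j) (hP j) (h1 j)
  have h3 : ‖U j - UΓ j‖ ≤ ‖U j - P j‖ + ‖UΓ j - P j‖ := by
    have := norm_sub_le (U j - P j) (UΓ j - P j)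
    rwa [sub_sub_sub_cancel_right] at this
  have h4 : ‖Uh j - P j‖ ≤ ‖U j - P j‖ + ‖U j - Uh j‖ := by
    have := norm_sub_le (U j - P j) (U j - Uh j)
    rwa [sub_sub_sub_cancel_left] at this
  linarith

/-- The discrete flux is the projection of the exact flux corrected by the trace errors; the load
has already cancelled. -/
lemma norm_sub_flux_le (hFh : ∀ i, Fh i ∈ K i) (hG : ∀ i, G i ∈ K i)
    (h2 : ∀ i, ∀ l ∈ K i, (inner ℝ (Fh i) l : ℝ) =
      inner ℝ (F i - ∑ j, b i j • (U j - UΓ j)) l) (i : Fin 2) :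
    ‖F i - Fh i‖ ≤ 2 * ‖F i - G i‖ + ∑ j, |b i j| * ‖U j - UΓ j‖ := by
  have h3 := norm_sub_le_of_inner_eq (hFh i) (hG i) (h2 i)
  have h4 : ‖F i - Fh i‖ ≤ ‖F i - G i‖ + ‖Fh i - G i‖ := by
    have := norm_sub_le (F i - G i) (Fh i - G i)
    rwa [sub_sub_sub_cancel_right] at this
  have h5 : ‖F i - ∑ j, b i j • (U j - UΓ j) - G i‖ ≤
      ‖F i - G i‖ + ∑ j, |b i j| * ‖U j - UΓ j‖ := by
    rw [sub_right_comm]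
    refine (norm_sub_le _ _).trans (add_le_add le_rfl ((norm_sum_le _ _).trans ?_))
    exact Finset.sum_le_sum fun j _ => by rw [norm_smul, Real.norm_eq_abs]
  linarith

/-- The cancellation behind the second factor of the rate. Against elements of the trial spaces the
error `U j - Uh j` may be exchanged for `U j - UΓ j`, and the flux error for the combination of the
`U j - UΓ j`. Comparing `w` with one approximant `x j` per space therefore leaves only products of
an error with an approximation error of `w`. One approximant per index is needed because the degrees
in time differ. -/
lemma abs_coupling_le
    (h1 : ∀ j, ∀ l ∈ K j, (inner ℝ (UΓ j) l : ℝ) = inner ℝ (Uh j) l)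
    (h2 : ∀ i, ∀ l ∈ K i, (inner ℝ (Fh i) l : ℝ) =
      inner ℝ (F i - ∑ j, b i j • (U j - UΓ j)) l) (i : Fin 2) {w : H} {x : Fin 2 → H}
    (hx : ∀ j, x j ∈ K j) :
    |∑ j, b i j * inner ℝ (U j - Uh j) w - inner ℝ (F i - Fh i) w| ≤
      ∑ j, |b i j| * (‖U j - Uh j‖ * ‖w - x j‖ + ‖U j - UΓ j‖ * (‖w - x j‖ + ‖w - x i‖)) +
        ‖F i - Fh i‖ * ‖w - x i‖ := by
  have h3 : (inner ℝ (F i - Fh i) (x i) : ℝ) = ∑ j, b i j * inner ℝ (U j - UΓ j) (x i) := by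
    rw [inner_sub_left, h2 i _ (hx i), inner_sub_left, sum_inner]
    simp only [real_inner_smul_left]
    ring
  have h4 : ∀ j, (inner ℝ (U j - Uh j) w : ℝ) - inner ℝ (U j - UΓ j) (x i) =
      inner ℝ (U j - Uh j) (w - x j) + inner ℝ (U j - UΓ j) (x j - x i) := by
    intro j
    have := h1 j _ (hx j)
    simp only [inner_sub_left, inner_sub_right] at this ⊢
    linarith
  have h5 : ∑ j, b i j * inner ℝ (U j - Uh j) w - (inner ℝ (F i - Fh i) w : ℝ) =
      ∑ j, b i j * (inner ℝ (U j - Uh j) (w - x j) + inner ℝ (U j - UΓ j) (x j - x i)) -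
        inner ℝ (F i - Fh i) (w - x i) := by
    rw [inner_sub_right (F i - Fh i), h3]
    simp only [← h4, mul_sub, Finset.sum_sub_distrib]
    ring
  rw [h5]
  refine (abs_sub _ _).trans (add_le_add ((Finset.abs_sum_le_sum_abs _ _).trans
    (Finset.sum_le_sum fun j _ => ?_)) (abs_real_inner_le_norm _ _))
  rw [abs_mul]
  refine mul_le_mul_of_nonneg_left ((abs_add_le _ _).trans (add_le_add
    (abs_real_inner_le_norm _ _) ((abs_real_inner_le_norm _ _).trans
    (mul_le_mul_of_nonneg_left ?_ (norm_nonneg _))))) (abs_nonneg _)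
  have := norm_sub_le (w - x i) (w - x j)
  rw [sub_sub_sub_cancel_left] at this
  linarith

end Hilbert

/-! ### Square integrable functions of time -/

section L2

variable {W : Type*} [NormedAddCommGroup W]

/-- The norm of `L²(a, b; W)`. -/
def l2n (a b : ℝ) (f : ℝ → W) : ℝ := √(∫ t in a..b, ‖f t‖ ^ 2)

lemma l2n_nonneg (a b : ℝ) (f : ℝ → W) : 0 ≤ l2n a b f := Real.sqrt_nonneg _

lemma sq_l2n {a b : ℝ} (hab : a ≤ b) (f : ℝ → W) : l2n a b f ^ 2 = ∫ t in a..b, ‖f t‖ ^ 2 :=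
  Real.sq_sqrt (intervalIntegral.integral_nonneg hab fun _ _ => sq_nonneg _)

lemma _root_.ContinuousOn.memLp_Ioc {f : ℝ → W} {a b : ℝ} (hf : ContinuousOn f (Icc a b)) :
    MemLp f 2 (volume.restrict (Ioc a b)) := by
  obtain ⟨C, hC⟩ := isCompact_Icc.exists_bound_of_continuousOn hf
  refine MemLp.of_bound ((hf.mono Ioc_subset_Icc_self).aestronglyMeasurable measurableSet_Ioc) C ?_
  filter_upwards [ae_restrict_mem measurableSet_Ioc] with t ht using hC t (Ioc_subset_Icc_self ht)

variable [InnerProductSpace ℝ W]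

lemma inner_toLp {a b : ℝ} (hab : a ≤ b) {f g : ℝ → W}
    (hf : MemLp f 2 (volume.restrict (Ioc a b))) (hg : MemLp g 2 (volume.restrict (Ioc a b))) :
    (inner ℝ (hf.toLp f) (hg.toLp g) : ℝ) = ∫ t in a..b, inner ℝ (f t) (g t) := by
  rw [L2.inner_def, intervalIntegral.integral_of_le hab]
  refine integral_congr_ae ?_
  filter_upwards [hf.coeFn_toLp, hg.coeFn_toLp] with t h1 h2
  rw [h1, h2]

lemma norm_toLp_eq_l2n {a b : ℝ} (hab : a ≤ b) {f : ℝ → W}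
    (hf : MemLp f 2 (volume.restrict (Ioc a b))) : ‖hf.toLp f‖ = l2n a b f := by
  rw [l2n, ← Real.sqrt_sq (norm_nonneg _), ← real_inner_self_eq_norm_sq, inner_toLp hab]
  simp only [real_inner_self_eq_norm_sq]

/-- Polynomials in time of degree at most `r` as elements of `L²`. -/
def polyLp (W : Type*) [NormedAddCommGroup W] [InnerProductSpace ℝ W] (μ : Measure ℝ) (r : ℕ) :
    Submodule ℝ (Lp W 2 μ) where
  carrier := {f | ∃ P, IsTimePoly r P ∧ f =ᵐ[μ] P}
  add_mem' := by
    rintro f g ⟨P, hP, hf⟩ ⟨R, hR, hg⟩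
    refine ⟨_, hP.add hR, ?_⟩
    filter_upwards [Lp.coeFn_add f g, hf, hg] with t h1 h2 h3
    rw [h1, Pi.add_apply, h2, h3]
  zero_mem' := ⟨_, isTimePoly_zero r, Lp.coeFn_zero _ _ _⟩
  smul_mem' := by
    rintro c f ⟨P, hP, hf⟩
    refine ⟨_, hP.const_smul c, ?_⟩
    filter_upwards [Lp.coeFn_smul c f, hf] with t h1 h2
    rw [h1, Pi.smul_apply, h2]

lemma IsTimePoly.memLp {r : ℕ} {P : ℝ → W} (hP : IsTimePoly r P) (a b : ℝ) :
    MemLp P 2 (volume.restrict (Ioc a b)) :=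
  hP.continuous.continuousOn.memLp_Ioc

lemma toLp_mem_polyLp {r : ℕ} {P : ℝ → W} {a b : ℝ} (hP : IsTimePoly r P)
    (hP' : MemLp P 2 (volume.restrict (Ioc a b))) :
    hP'.toLp P ∈ polyLp W (volume.restrict (Ioc a b)) r := ⟨P, hP, hP'.coeFn_toLp⟩

lemma exists_toLp_of_mem_polyLp {r : ℕ} {a b : ℝ} {f : Lp W 2 (volume.restrict (Ioc a b))}
    (hf : f ∈ polyLp W (volume.restrict (Ioc a b)) r) :
    ∃ P, ∃ hP : IsTimePoly r P, f = (hP.memLp a b).toLp P := by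
  obtain ⟨P, hP, hfP⟩ := hf
  exact ⟨P, hP, Lp.ext (hfP.trans (hP.memLp a b).coeFn_toLp.symm)⟩

/-- The conditions on a coupling window, and their consequences for errors measured in `L²`. -/
lemma exists_coupling_bounds (b : Fin 2 → Fin 2 → ℝ) :
    ∃ C, 0 ≤ C ∧ ∀ (W : Type) [NormedAddCommGroup W] [InnerProductSpace ℝ W] (r : Fin 2 → ℕ)
      (α β : ℝ) (U Uh UΓ F Fh P G : Fin 2 → ℝ → W), α ≤ β →
      (∀ j, MemLp (U j) 2 (volume.restrict (Ioc α β))) →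
      (∀ j, MemLp (Uh j) 2 (volume.restrict (Ioc α β))) →
      (∀ j, MemLp (F j) 2 (volume.restrict (Ioc α β))) →
      (∀ j, IsTimePoly (r j) (UΓ j)) → (∀ j, IsTimePoly (r j) (Fh j)) →
      (∀ j, IsTimePoly (r j) (P j)) → (∀ j, IsTimePoly (r j) (G j)) →
      (∀ j l, IsTimePoly (r j) l →
        ∫ t in α..β, (inner ℝ (UΓ j t) (l t) : ℝ) = ∫ t in α..β, inner ℝ (Uh j t) (l t)) →
      (∀ i l, IsTimePoly (r i) l → ∫ t in α..β, (inner ℝ (Fh i t) (l t) : ℝ) =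
        ∫ t in α..β, inner ℝ (F i t - ∑ j, b i j • (U j t - UΓ j t)) (l t)) →
      (∀ i, l2n α β (fun t => F i t - Fh i t) ≤
        C * (∑ j, l2n α β (fun t => U j t - Uh j t) + ∑ j, l2n α β (fun t => U j t - P j t) +
          ∑ j, l2n α β (fun t => F j t - G j t))) ∧
      ∀ (w : Fin 2 → ℝ → W) (x : Fin 2 → Fin 2 → ℝ → W) (ω : ℝ),
        (∀ i, MemLp (w i) 2 (volume.restrict (Ioc α β))) → (∀ i j, IsTimePoly (r j) (x i j)) →
        (∀ i j, l2n α β (fun t => w i t - x i j t) ≤ ω) →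
        |∑ i, (∑ j, b i j * (∫ t in α..β, inner ℝ (U j t - Uh j t) (w i t)) -
          ∫ t in α..β, inner ℝ (F i t - Fh i t) (w i t))| ≤
        C * (∑ j, l2n α β (fun t => U j t - Uh j t) + ∑ j, l2n α β (fun t => U j t - P j t) +
          ∑ j, l2n α β (fun t => F j t - G j t)) * ω := by
  set B := ∑ i, ∑ j, |b i j| with hB
  have hB0 : 0 ≤ B := Finset.sum_nonneg fun _ _ => Finset.sum_nonneg fun _ _ => abs_nonneg _
  -- The coupling terms add up to `5 B` from the traces and `2 · 2 (1 + B)` from the fluxes, `9 B +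
  -- 4` in all; the flux bound alone needs `2 (1 + B)`.
  refine ⟨10 * (1 + B), by positivity, ?_⟩
  intro W _ _ r α β U Uh UΓ F Fh P G hαβ hU hUh hF hUΓ hFh hP hG h1 h2
  have hUΓ' := fun j => (hUΓ j).memLp α β
  have hFh' := fun j => (hFh j).memLp α β
  have hP' := fun j => (hP j).memLp α β
  have hG' := fun j => (hG j).memLp α β
  -- Everything is moved to the Hilbert space `L²(α, β; W)`, with the polynomials of degree at most
  -- `r j` as subspaces; there the integral identities become the orthogonality relations of the
  -- abstract lemmas.
  let K : Fin 2 → Submodule ℝ (Lp W 2 (volume.restrict (Ioc α β))) := fun j => polyLp W _ (r j)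
  let u := fun j => (hU j).toLp (U j)
  let uh := fun j => (hUh j).toLp (Uh j)
  let uΓ := fun j => (hUΓ' j).toLp (UΓ j)
  let f := fun j => (hF j).toLp (F j)
  let fh := fun j => (hFh' j).toLp (Fh j)
  let p := fun j => (hP' j).toLp (P j)
  let g := fun j => (hG' j).toLp (G j)
  have k1 : ∀ j, ∀ l ∈ K j, (inner ℝ (uΓ j) l : ℝ) = inner ℝ (uh j) l := by
    intro j l hl
    obtain ⟨R, hR, rfl⟩ := exists_toLp_of_mem_polyLp hl
    rw [inner_toLp hαβ, inner_toLp hαβ, h1 j R hR]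
  have k2 : ∀ i, ∀ l ∈ K i, (inner ℝ (fh i) l : ℝ) =
      inner ℝ (f i - ∑ j, b i j • (u j - uΓ j)) l := by
    intro i l hl
    obtain ⟨R, hR, rfl⟩ := exists_toLp_of_mem_polyLp hl
    have hd : MemLp (fun t => F i t - ∑ j, b i j • (U j t - UΓ j t)) 2
        (volume.restrict (Ioc α β)) :=
      (hF i).sub (memLp_finsetSum _ fun j _ => ((hU j).sub (hUΓ' j)).const_smul (b i j))
    have hd' : f i - ∑ j, b i j • (u j - uΓ j) = hd.toLp _ := by
      rw [Fin.sum_univ_two]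
      simp only [Fin.sum_univ_two]
      rfl
    rw [hd', inner_toLp hαβ, inner_toLp hαβ, h2 i R hR]
  have e1 : ∀ j, ‖u j - uh j‖ = l2n α β (fun t => U j t - Uh j t) := fun j =>
    norm_toLp_eq_l2n hαβ ((hU j).sub (hUh j))
  have e2 : ∀ j, ‖u j - p j‖ = l2n α β (fun t => U j t - P j t) := fun j =>
    norm_toLp_eq_l2n hαβ ((hU j).sub (hP' j))
  have e3 : ∀ j, ‖f j - g j‖ = l2n α β (fun t => F j t - G j t) := fun j =>
    norm_toLp_eq_l2n hαβ ((hF j).sub (hG' j))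
  have e4 : ∀ j, ‖f j - fh j‖ = l2n α β (fun t => F j t - Fh j t) := fun j =>
    norm_toLp_eq_l2n hαβ ((hF j).sub (hFh' j))
  simp only [← e1, ← e2, ← e3, ← e4]
  set S := ∑ j, ‖u j - uh j‖ + ∑ j, ‖u j - p j‖ + ∑ j, ‖f j - g j‖ with hS
  have s1 : ∀ j, ‖u j - uh j‖ ≤ ∑ j, ‖u j - uh j‖ := fun j =>
    Finset.single_le_sum (f := fun j => ‖u j - uh j‖) (fun _ _ => norm_nonneg _)
      (Finset.mem_univ j)
  have s2 : ∀ j, ‖u j - p j‖ ≤ ∑ j, ‖u j - p j‖ := fun j =>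
    Finset.single_le_sum (f := fun j => ‖u j - p j‖) (fun _ _ => norm_nonneg _)
      (Finset.mem_univ j)
  have s3 : ∀ j, ‖f j - g j‖ ≤ ∑ j, ‖f j - g j‖ := fun j =>
    Finset.single_le_sum (f := fun j => ‖f j - g j‖) (fun _ _ => norm_nonneg _)
      (Finset.mem_univ j)
  have p1 : 0 ≤ ∑ j, ‖u j - uh j‖ := Finset.sum_nonneg fun _ _ => norm_nonneg _
  have p2 : 0 ≤ ∑ j, ‖u j - p j‖ := Finset.sum_nonneg fun _ _ => norm_nonneg _
  have p3 : 0 ≤ ∑ j, ‖f j - g j‖ := Finset.sum_nonneg fun _ _ => norm_nonneg _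
  have hS0 : 0 ≤ S := by rw [hS]; linarith
  have t1 : ∀ j, ‖u j - uΓ j‖ ≤ 2 * S := fun j => by
    have := norm_sub_trace_le (U := u) (fun j => toLp_mem_polyLp (hUΓ j) (hUΓ' j))
      (fun j => toLp_mem_polyLp (hP j) (hP' j)) k1 j
    have := s1 j
    have := s2 j
    linarith
  have t0 : ∀ j, ‖u j - uh j‖ ≤ S := fun j => by
    have := s1 j
    linarith
  have hbi : ∀ i, ∑ j, |b i j| ≤ B := fun i =>
    Finset.single_le_sum (f := fun i => ∑ j, |b i j|)
      (fun _ _ => Finset.sum_nonneg fun _ _ => abs_nonneg _) (Finset.mem_univ i)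
  have t2 : ∀ i, ‖f i - fh i‖ ≤ 2 * (1 + B) * S := fun i => by
    have h3 := norm_sub_flux_le (U := u) (UΓ := uΓ) (F := f)
      (fun j => toLp_mem_polyLp (hFh j) (hFh' j)) (fun j => toLp_mem_polyLp (hG j) (hG' j)) k2 i
    have h4 : ∑ j, |b i j| * ‖u j - uΓ j‖ ≤ B * (2 * S) := by
      refine (Finset.sum_le_sum fun j _ =>
        mul_le_mul_of_nonneg_left (t1 j) (abs_nonneg (b i j))).trans ?_
      rw [← Finset.sum_mul]
      exact mul_le_mul_of_nonneg_right (hbi i) (by positivity)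
    have := s3 i
    nlinarith
  refine ⟨fun i => (t2 i).trans ?_, ?_⟩
  · exact mul_le_mul_of_nonneg_right (by linarith) hS0
  intro w x ω hw hx hω
  have hx' := fun i j => (hx i j).memLp α β
  have hω0 : 0 ≤ ω := (l2n_nonneg _ _ _).trans (hω 0 0)
  let w' := fun i => (hw i).toLp (w i)
  let x' := fun i j => (hx' i j).toLp (x i j)
  have e5 : ∀ i j, ‖w' i - x' i j‖ ≤ ω := fun i j =>
    (norm_toLp_eq_l2n hαβ ((hw i).sub (hx' i j))).le.trans (hω i j)
  have hi1 : ∀ i j, ∫ t in α..β, (inner ℝ (U j t - Uh j t) (w i t) : ℝ) =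
      inner ℝ (u j - uh j) (w' i) := fun i j =>
    (inner_toLp hαβ ((hU j).sub (hUh j)) (hw i)).symm
  have hi2 : ∀ i, ∫ t in α..β, (inner ℝ (F i t - Fh i t) (w i t) : ℝ) =
      inner ℝ (f i - fh i) (w' i) := fun i =>
    (inner_toLp hαβ ((hF i).sub (hFh' i)) (hw i)).symm
  simp only [hi1, hi2]
  have h3 : ∀ i, |∑ j, b i j * inner ℝ (u j - uh j) (w' i) - inner ℝ (f i - fh i) (w' i)| ≤
      (∑ j, |b i j|) * (5 * S * ω) + 2 * (1 + B) * S * ω := by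
    intro i
    refine (abs_coupling_le (K := K) (x := x' i) k1 k2 i
      (fun j => toLp_mem_polyLp (hx i j) (hx' i j))).trans (add_le_add ?_ ?_)
    · rw [Finset.sum_mul]
      refine Finset.sum_le_sum fun j _ => mul_le_mul_of_nonneg_left ?_ (abs_nonneg _)
      have a1 := mul_le_mul (t0 j) (e5 i j) (norm_nonneg _) hS0
      have a2 := mul_le_mul (t1 j) (add_le_add (e5 i j) (e5 i i))
        (add_nonneg (norm_nonneg _) (norm_nonneg _)) (by positivity : 0 ≤ 2 * S)
      linarith
    · exact mul_le_mul (t2 i) (e5 i i) (norm_nonneg _) (by positivity)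
  refine (Finset.abs_sum_le_sum_abs _ _).trans ((Finset.sum_le_sum fun i _ => h3 i).trans ?_)
  rw [Finset.sum_add_distrib, ← Finset.sum_mul, ← hB]
  simp only [Finset.sum_const, Finset.card_univ, Fintype.card_fin, nsmul_eq_mul]
  push_cast
  nlinarith [mul_nonneg hS0 hω0, mul_nonneg hB0 (mul_nonneg hS0 hω0)]

end L2

/-! ### Grids -/

section Grid

variable (G : Grid) {T : ℝ} (hT : 0 < T)

lemma sum_Icc_one {M : Type*} [AddCommMonoid M] (f : ℕ → M) (n : ℕ) :
    ∑ j ∈ Finset.Icc 1 n, f j = ∑ k ∈ Finset.range n, f (k + 1) := by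
  rw [Finset.range_eq_Ico, Finset.sum_Ico_add' f 0 n 1]
  rfl

lemma Grid.N_mul_dt : (G.N : ℝ) * G.dt T = T := by
  have : (G.N : ℝ) ≠ 0 := Nat.cast_ne_zero.2 G.N_pos.ne'
  rw [Grid.dt]; field_simp

lemma Grid.M_mul_dti (i : Fin 2) : (G.M i : ℝ) * G.dti T i = G.dt T := by
  have : (G.M i : ℝ) ≠ 0 := Nat.cast_ne_zero.2 (G.M_pos i).ne'
  rw [Grid.dti]; field_simp

lemma Grid.node_mul (i : Fin 2) (w : ℕ) : G.node T i (w * G.M i) = G.sync T w := by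
  rw [Grid.node, Grid.sync, Nat.cast_mul, mul_assoc, G.M_mul_dti]

lemma Grid.node_zero (i : Fin 2) : G.node T i 0 = 0 := by simp [Grid.node]

lemma Grid.sync_N : G.sync T G.N = T := G.N_mul_dt

lemma Grid.node_succ (i : Fin 2) (j : ℕ) : G.node T i (j + 1) = G.node T i j + G.dti T i := by
  simp only [Grid.node]; push_cast; ring

lemma Grid.node_pred_add (i : Fin 2) {j : ℕ} (hj : 1 ≤ j) :
    G.node T i (j - 1) + G.dti T i = G.node T i j := by
  rw [← G.node_succ, Nat.sub_add_cancel hj]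

lemma Grid.sync_pred_add {w : ℕ} (hw : 1 ≤ w) : G.sync T (w - 1) + G.dt T = G.sync T w := by
  simp only [Grid.sync]
  rw [Nat.cast_sub hw]; push_cast; ring

include hT

lemma Grid.dt_pos : 0 < G.dt T := div_pos hT (Nat.cast_pos.2 G.N_pos)

lemma Grid.dti_pos (i : Fin 2) : 0 < G.dti T i :=
  div_pos (G.dt_pos hT) (Nat.cast_pos.2 (G.M_pos i))

lemma Grid.dti_le_dt (i : Fin 2) : G.dti T i ≤ G.dt T :=
  div_le_self (G.dt_pos hT).le (Nat.one_le_cast.2 (G.M_pos i))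

lemma Grid.node_le_node (i : Fin 2) {j l : ℕ} (h : j ≤ l) : G.node T i j ≤ G.node T i l :=
  mul_le_mul_of_nonneg_right (Nat.cast_le.2 h) (G.dti_pos hT i).le

lemma Grid.node_nonneg (i : Fin 2) (j : ℕ) : 0 ≤ G.node T i j :=
  mul_nonneg (Nat.cast_nonneg _) (G.dti_pos hT i).le

lemma Grid.sync_le_sync {j l : ℕ} (h : j ≤ l) : G.sync T j ≤ G.sync T l :=
  mul_le_mul_of_nonneg_right (Nat.cast_le.2 h) (G.dt_pos hT).le

lemma Grid.sync_nonneg (w : ℕ) : 0 ≤ G.sync T w :=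
  mul_nonneg (Nat.cast_nonneg _) (G.dt_pos hT).le

lemma Grid.sync_le {w : ℕ} (h : w ≤ G.N) : G.sync T w ≤ T :=
  (G.sync_le_sync hT h).trans_eq G.sync_N

lemma Grid.node_le (i : Fin 2) {j : ℕ} (h : j ≤ G.N * G.M i) : G.node T i j ≤ T := by
  refine (G.node_le_node hT i h).trans_eq ?_
  rw [G.node_mul, G.sync_N]

/-- The ceiling recovers the number of the substep from the time, which turns families of functions
on substeps into one function on `(0, T]`. -/
lemma Grid.ceil_eq_of_mem (i : Fin 2) {j : ℕ} (hj : 1 ≤ j) {t : ℝ}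
    (ht : t ∈ Ioc (G.node T i (j - 1)) (G.node T i j)) : ⌈t / G.dti T i⌉₊ = j := by
  have hp := G.dti_pos hT i
  rw [Nat.ceil_eq_iff (by omega), lt_div_iff₀ hp, div_le_iff₀ hp]
  exact ht

lemma Grid.ceil_sync_eq_of_mem {w : ℕ} (hw : 1 ≤ w) {t : ℝ}
    (ht : t ∈ Ioc (G.sync T (w - 1)) (G.sync T w)) : ⌈t / G.dt T⌉₊ = w := by
  have hp := G.dt_pos hT
  rw [Nat.ceil_eq_iff (by omega), lt_div_iff₀ hp, div_le_iff₀ hp]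
  exact ht

lemma Grid.mem_Ioc_ceil (i : Fin 2) {t : ℝ} (ht : t ∈ Ioc 0 T) :
    ⌈t / G.dti T i⌉₊ ∈ Finset.Icc 1 (G.N * G.M i) ∧
      t ∈ Ioc (G.node T i (⌈t / G.dti T i⌉₊ - 1)) (G.node T i ⌈t / G.dti T i⌉₊) := by
  have hp := G.dti_pos hT i
  have h1 : 0 < ⌈t / G.dti T i⌉₊ := Nat.ceil_pos.2 (div_pos ht.1 hp)
  refine ⟨Finset.mem_Icc.2 ⟨h1, Nat.ceil_le.2 ?_⟩, ?_, ?_⟩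
  · rw [div_le_iff₀ hp]
    refine ht.2.trans_eq ?_
    push_cast
    rw [mul_assoc, G.M_mul_dti, G.N_mul_dt]
  · have h2 := Nat.ceil_lt_add_one (div_pos ht.1 hp).le
    rw [Grid.node, ← lt_div_iff₀ hp, Nat.cast_sub h1]
    push_cast
    linarith
  · rw [Grid.node, ← div_le_iff₀ hp]
    exact Nat.le_ceil _

omit hT

lemma Grid.idx_bounds {i : Fin 2} {w n : ℕ} (hw : 1 ≤ w) (hwN : w ≤ G.N)
    (hn : n ∈ Finset.Icc 1 (G.M i)) :
    1 ≤ G.idx i w n ∧ G.idx i w n ≤ w * G.M i ∧ (w - 1) * G.M i ≤ G.idx i w n - 1 ∧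
      G.idx i w n ≤ G.N * G.M i := by
  rw [Finset.mem_Icc] at hn
  have h1 : G.idx i w n = (w - 1) * G.M i + n := rfl
  obtain ⟨v, rfl⟩ : ∃ v, w = v + 1 := ⟨w - 1, by omega⟩
  rw [Nat.add_sub_cancel] at h1 ⊢
  have h2 : (v + 1) * G.M i = v * G.M i + G.M i := by ring
  have h3 : (v + 1) * G.M i ≤ G.N * G.M i := Nat.mul_le_mul_right _ hwN
  omega

lemma Grid.sum_window {E : Type*} [NormedAddCommGroup E] [NormedSpace ℝ E] (i : Fin 2) {w : ℕ}
    (hw : 1 ≤ w) {f : ℝ → E}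
    (hf : ∀ n ∈ Finset.Icc 1 (G.M i), IntervalIntegrable f volume
      (G.node T i (G.idx i w n - 1)) (G.node T i (G.idx i w n))) :
    ∑ n ∈ Finset.Icc 1 (G.M i),
      ∫ t in (G.node T i (G.idx i w n - 1))..(G.node T i (G.idx i w n)), f t =
    ∫ t in (G.sync T (w - 1))..(G.sync T w), f t := by
  rw [sum_Icc_one]
  have h3 := intervalIntegral.sum_integral_adjacent_intervals (f := f) (μ := volume)
    (a := fun k => G.node T i ((w - 1) * G.M i + k)) (n := G.M i) (fun k hk =>
      hf (k + 1) (Finset.mem_Icc.2 ⟨by omega, hk⟩))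
  refine h3.trans ?_
  rw [add_zero, G.node_mul]
  congr 1
  rw [← G.node_mul i w]
  congr 1
  obtain ⟨v, rfl⟩ : ∃ v, w = v + 1 := ⟨w - 1, by omega⟩
  rw [Nat.add_sub_cancel]; ring

lemma Grid.sum_windows_le (i : Fin 2) {f : ℕ → ℝ} (hf : ∀ j, 0 ≤ f j) {N₀ : ℕ} (hN₀ : 1 ≤ N₀) :
    ∑ w ∈ Finset.Icc N₀ G.N, ∑ n ∈ Finset.Icc 1 (G.M i), f (G.idx i w n) ≤
      ∑ j ∈ Finset.Icc 1 (G.N * G.M i), f j := by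
  refine (Finset.sum_le_sum_of_subset_of_nonneg (Finset.Icc_subset_Icc_left hN₀)
    fun _ _ _ => Finset.sum_nonneg fun _ _ => hf _).trans ?_
  rw [sum_Icc_one, sum_Icc_one]
  have : ∀ N, ∑ k ∈ Finset.range N, ∑ n ∈ Finset.Icc 1 (G.M i), f (G.idx i (k + 1) n) =
      ∑ k ∈ Finset.range (N * G.M i), f (k + 1) := by
    intro N
    induction N with
    | zero => simp
    | succ N ih =>
      rw [Finset.sum_range_succ, ih, Nat.succ_mul, Finset.sum_range_add, sum_Icc_one]
      rfl
  rw [this]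

/-- An interval of `J` consecutive substeps splits into `J` single ones, and for a fixed shift these
are disjoint as `j` varies. -/
lemma Grid.sum_overlap_le (hT : 0 < T) (i : Fin 2) (J : ℕ) {f : ℝ → ℝ} (hf : ∀ t, 0 ≤ f t)
    (hfi : IntervalIntegrable f volume 0 T) :
    ∑ j ∈ Finset.Icc 1 (G.N * G.M i), ∫ t in (G.node T i (j - J))..(G.node T i j), f t ≤
      J * ∫ t in (0 : ℝ)..T, f t := by
  have hsub : ∀ j ≤ G.N * G.M i, ∀ l ≤ j,
      IntervalIntegrable f volume (G.node T i l) (G.node T i j) := fun j hj l hl => by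
    refine hfi.mono_set ?_
    rw [uIcc_of_le (G.node_le_node hT i hl), uIcc_of_le hT.le]
    exact Icc_subset_Icc (G.node_nonneg hT i l) (G.node_le hT i hj)
  -- The truncated subtraction is harmless: for `l ≥ j` both end points are the node zero and the
  -- piece is empty.
  have h1 : ∀ j ≤ G.N * G.M i, ∀ J : ℕ, ∫ t in (G.node T i (j - J))..(G.node T i j), f t =
      ∑ l ∈ Finset.range J, ∫ t in (G.node T i (j - l - 1))..(G.node T i (j - l)), f t := by
    intro j hj J
    induction J with
    | zero => simp
    | succ J ih =>
      rw [Finset.sum_range_succ, ← ih, ← Nat.sub_sub, add_comm,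
        intervalIntegral.integral_add_adjacent_intervals
          (hsub (j - J) (by omega) (j - J - 1) (by omega)) (hsub j hj (j - J) (by omega))]
  have h2 : ∀ l n, n ≤ G.N * G.M i →
      ∑ j ∈ Finset.Icc 1 n, ∫ t in (G.node T i (j - l - 1))..(G.node T i (j - l)), f t =
        ∫ t in (0 : ℝ)..(G.node T i (n - l)), f t := by
    intro l n hn
    induction n with
    | zero => simp [G.node_zero]
    | succ n ih =>
      rw [Finset.sum_Icc_succ_top (by omega), ih (by omega), ← G.node_zero (T := T) i]
      have h3 : n + 1 - l - 1 = n - l := by omega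
      rw [h3, intervalIntegral.integral_add_adjacent_intervals
        (hsub _ (by omega) _ (by omega)) (hsub _ (by omega) _ (by omega))]
  calc _ = ∑ j ∈ Finset.Icc 1 (G.N * G.M i), ∑ l ∈ Finset.range J,
        ∫ t in (G.node T i (j - l - 1))..(G.node T i (j - l)), f t :=
        Finset.sum_congr rfl fun j hj => h1 j (Finset.mem_Icc.1 hj).2 J
    _ = ∑ l ∈ Finset.range J, ∫ t in (0 : ℝ)..(G.node T i (G.N * G.M i - l)), f t := by
        rw [Finset.sum_comm]
        exact Finset.sum_congr rfl fun l _ => h2 l _ le_rfl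
    _ ≤ ∑ _l ∈ Finset.range J, ∫ t in (0 : ℝ)..T, f t := by
        refine Finset.sum_le_sum fun l _ => ?_
        exact intervalIntegral.integral_mono_interval le_rfl (G.node_nonneg hT i _)
          (G.node_le hT i (Nat.sub_le _ _)) (Filter.Eventually.of_forall hf) hfi
    _ = _ := by simp

lemma Grid.sum_windows_integral {E : Type*} [NormedAddCommGroup E] [NormedSpace ℝ E] {f : ℝ → E}
    {a b : ℕ} (hab : a ≤ b)
    (hfi : ∀ w ∈ Finset.Icc (a + 1) b,
      IntervalIntegrable f volume (G.sync T (w - 1)) (G.sync T w)) :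
    ∑ w ∈ Finset.Icc (a + 1) b, ∫ t in (G.sync T (w - 1))..(G.sync T w), f t =
      ∫ t in (G.sync T a)..(G.sync T b), f t := by
  have h1 : Finset.Icc (a + 1) b = Finset.Ico (a + 1) (b + 1) := by
    ext x; simp
  rw [h1, ← Finset.sum_Ico_add' (fun w => ∫ t in (G.sync T (w - 1))..(G.sync T w), f t) a b 1]
  simp only [Nat.add_sub_cancel]
  exact intervalIntegral.sum_integral_adjacent_intervals_Ico hab fun k hk =>
    hfi (k + 1) (Finset.mem_Icc.2 ⟨Nat.succ_le_succ hk.1, hk.2⟩)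

end Grid

/-! ### A discrete Gronwall inequality -/

lemma le_add_of_sq_le {a x y : ℝ} (hx : 0 ≤ x) (hy : 0 ≤ y) (h : a ^ 2 ≤ x ^ 2 + y ^ 2) :
    a ≤ x + y :=
  (le_abs_self a).trans (abs_le_of_sq_le_sq (h.trans (by nlinarith)) (add_nonneg hx hy))

/-- In the application `ε w` is the state error on the window, `s w` collects the consistency
errors, `Y w` dominates all side value errors up to the end of the window, and `x w` is the time
integral of the residual. The recursion is implicit, since the bound for `x w` involves `ε w` and
thereby `Y w` itself; for small `dt` this feedback is absorbed. -/
lemma gronwall_windows {c T : ℝ} (hc : 1 ≤ c) (hT : 0 < T) :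
    ∃ δ > 0, ∃ C, 0 ≤ C ∧ ∀ (N₀ N : ℕ) (dt : ℝ) (ε s x Y : ℕ → ℝ), 1 ≤ N₀ → 0 < dt → dt ≤ δ →
      N * dt ≤ T → (∀ w, 0 ≤ ε w) → (∀ w, 0 ≤ s w) → (∀ w, 0 ≤ x w) → 0 ≤ Y (N₀ - 1) →
      (∀ w ∈ Finset.Icc N₀ N, Y w = Y (w - 1) + c * x w) →
      (∀ w ∈ Finset.Icc N₀ N,
        ε w ^ 2 ≤ c * (dt * Y w ^ 2 + s w ^ 2 + dt ^ 2 * (ε w ^ 2 + s w ^ 2))) →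
      (∀ w ∈ Finset.Icc N₀ N, x w ^ 2 ≤ c * dt * (ε w ^ 2 + s w ^ 2)) →
      ∑ w ∈ Finset.Icc N₀ N, ε w ^ 2 ≤ C * (Y (N₀ - 1) ^ 2 + ∑ w ∈ Finset.Icc N₀ N, s w ^ 2) := by
  -- Large enough for the growth of `Y`, which needs `5 c²`, and for `c ≤ B`, which is used to
  -- absorb the terms with `dt ^ 2`. The condition on `δ` then means `B dt ≤ 1/2`.
  set B := 10 * c ^ 3 with hB
  have hB1 : 1 ≤ B := by
    have : 1 ≤ c ^ 3 := one_le_pow₀ hc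
    linarith
  set A := Real.exp (2 * B * T) with hA
  have hA1 : 1 ≤ A := Real.one_le_exp (by positivity)
  refine ⟨min 1 (1 / (2 * B)), by positivity, 4 * c * (2 * T * A ^ 2 * (1 + B ^ 2 * T) + 1),
    by positivity, ?_⟩
  intro N₀ N dt ε s x Y hN₀ hdt hdtδ hNdt hε hs hx hY0 hY hε2 hx2
  have hdt1 : dt ≤ 1 := hdtδ.trans (min_le_left _ _)
  have hdtB : 2 * B * dt ≤ 1 := by
    have := hdtδ.trans (min_le_right _ _)
    rw [le_div_iff₀ (by positivity)] at this
    linarith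
  have hc3 : c ≤ c ^ 3 := le_self_pow₀ hc (by norm_num)
  have hcdt : c * dt ^ 2 ≤ 1 / 2 := by
    have h1 : dt ^ 2 ≤ dt := by nlinarith
    have h2 : c * dt ^ 2 ≤ c * dt := mul_le_mul_of_nonneg_left h1 (by linarith)
    have h3 : c * dt ≤ B * dt := mul_le_mul_of_nonneg_right (by linarith) hdt.le
    linarith
  -- Since `c dt² ≤ 1/2`, the term with `ε w` on the right is absorbed on the left.
  have k1 : ∀ w ∈ Finset.Icc N₀ N, ε w ^ 2 ≤ 4 * c * (dt * Y w ^ 2 + s w ^ 2) := by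
    intro w hw
    have h1 := hε2 w hw
    have h2 : c * dt ^ 2 * (ε w ^ 2 + s w ^ 2) ≤ 1 / 2 * (ε w ^ 2 + s w ^ 2) :=
      mul_le_mul_of_nonneg_right hcdt (by positivity)
    have h3 : s w ^ 2 ≤ c * s w ^ 2 := le_mul_of_one_le_left (sq_nonneg _) hc
    have h4 : 0 ≤ c * (dt * Y w ^ 2) := by positivity
    have h5 := sq_nonneg (s w)
    linarith
  -- Taking roots turns the factor `dt` in the bound for `x w ^ 2` into `dt` in front of `Y w` and
  -- `√dt` in front of `s w`.
  have hx3 : ∀ w ∈ Finset.Icc N₀ N, 0 ≤ Y w → c * x w ≤ B * (dt * Y w + √dt * s w) := by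
    intro w hw hYw
    have h1 := k1 w hw
    have h2 := hx2 w hw
    have h3 : ε w ^ 2 + s w ^ 2 ≤ 5 * c * (dt * Y w ^ 2 + s w ^ 2) := by
      have h3 : s w ^ 2 ≤ c * s w ^ 2 := le_mul_of_one_le_left (sq_nonneg _) hc
      have h4 : 0 ≤ c * (dt * Y w ^ 2) := by positivity
      linarith
    have h4 : x w ^ 2 ≤ (5 * c * (dt * Y w)) ^ 2 + (5 * c * (√dt * s w)) ^ 2 := by
      have h5 : c * dt * (ε w ^ 2 + s w ^ 2) ≤ c * dt * (5 * c * (dt * Y w ^ 2 + s w ^ 2)) :=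
        mul_le_mul_of_nonneg_left h3 (by positivity)
      have h6 : (√dt) ^ 2 = dt := Real.sq_sqrt hdt.le
      have h7 : (5 * c * (dt * Y w)) ^ 2 + (5 * c * (√dt * s w)) ^ 2 =
          5 * (c * dt * (5 * c * (dt * Y w ^ 2 + s w ^ 2))) := by
        have : (5 * c * (√dt * s w)) ^ 2 = 25 * c ^ 2 * ((√dt) ^ 2 * s w ^ 2) := by ring
        rw [this, h6]; ring
      have h8 : 0 ≤ c * dt * (5 * c * (dt * Y w ^ 2 + s w ^ 2)) := by positivity
      linarith
    have h5 := le_add_of_sq_le (by positivity) (mul_nonneg (by positivity)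
      (mul_nonneg (Real.sqrt_nonneg _) (hs w))) h4
    calc c * x w ≤ c * (5 * c * (dt * Y w) + 5 * c * (√dt * s w)) :=
          mul_le_mul_of_nonneg_left h5 (by linarith)
      _ = 5 * c ^ 2 * (dt * Y w + √dt * s w) := by ring
      _ ≤ B * (dt * Y w + √dt * s w) := by
          refine mul_le_mul_of_nonneg_right ?_ (add_nonneg (by positivity)
            (mul_nonneg (Real.sqrt_nonneg _) (hs w)))
          have : c ^ 2 ≤ c ^ 3 := pow_le_pow_right₀ hc (by norm_num)
          have : 0 ≤ c ^ 3 := by positivity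
          linarith
  have k2 : ∀ k, N₀ - 1 + k ≤ N → 0 ≤ Y (N₀ - 1 + k) ∧
      Y (N₀ - 1 + k) ≤ (1 + 2 * B * dt) ^ k *
        (Y (N₀ - 1) + B * ∑ w ∈ Finset.Ico N₀ (N₀ + k), √dt * s w) := by
    intro k
    induction k with
    | zero => intro _; simpa using hY0
    | succ k ih =>
      intro hk
      obtain ⟨ih0, ih1⟩ := ih (by omega)
      have hmem : N₀ + k ∈ Finset.Icc N₀ N := Finset.mem_Icc.2 ⟨by omega, by omega⟩
      have e1 : N₀ - 1 + (k + 1) = N₀ + k := by omega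
      have e2 : N₀ + k - 1 = N₀ - 1 + k := by omega
      have h1 := hY _ hmem
      rw [e2] at h1
      rw [e1]
      have hY1 : 0 ≤ Y (N₀ + k) := by
        rw [h1]; exact add_nonneg ih0 (mul_nonneg (by linarith) (hx _))
      refine ⟨hY1, ?_⟩
      have h2 := hx3 _ hmem hY1
      set s' := √dt * s (N₀ + k)
      have hs' : 0 ≤ s' := mul_nonneg (Real.sqrt_nonneg _) (hs _)
      have h3 : Y (N₀ + k) * (1 - B * dt) ≤ Y (N₀ - 1 + k) + B * s' := by linarith
      have h4 : Y (N₀ + k) ≤ (1 + 2 * B * dt) * (Y (N₀ - 1 + k) + B * s') := by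
        -- This is where `B dt ≤ 1/2` resolves the implicit recursion.
        have h5 : 1 ≤ (1 + 2 * B * dt) * (1 - B * dt) := by
          have : 0 ≤ B * dt := by positivity
          nlinarith
        calc Y (N₀ + k) ≤ Y (N₀ + k) * ((1 + 2 * B * dt) * (1 - B * dt)) :=
              le_mul_of_one_le_right hY1 h5
          _ = (1 + 2 * B * dt) * (Y (N₀ + k) * (1 - B * dt)) := by ring
          _ ≤ _ := mul_le_mul_of_nonneg_left h3 (by positivity)
      refine h4.trans ?_
      have e3 : N₀ + (k + 1) = N₀ + k + 1 := by omega
      rw [e3, Finset.sum_Ico_succ_top (by omega), pow_succ', mul_assoc (1 + 2 * B * dt)]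
      refine mul_le_mul_of_nonneg_left ?_ (by positivity)
      have hbase : 1 ≤ 1 + 2 * B * dt := by
        have : 0 ≤ B * dt := by positivity
        linarith
      have h6 : B * s' ≤ (1 + 2 * B * dt) ^ k * (B * s') :=
        le_mul_of_one_le_left (by positivity) (one_le_pow₀ hbase)
      calc _ ≤ (1 + 2 * B * dt) ^ k * (Y (N₀ - 1) + B * ∑ w ∈ Finset.Ico N₀ (N₀ + k), √dt * s w)
            + (1 + 2 * B * dt) ^ k * (B * s') := add_le_add ih1 h6
        _ = _ := by ring
  set Ss := ∑ w ∈ Finset.Icc N₀ N, s w ^ 2 with hSs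
  have hSs0 : 0 ≤ Ss := Finset.sum_nonneg fun w _ => sq_nonneg (s w)
  have hcard : ((Finset.Icc N₀ N).card : ℝ) * dt ≤ T := by
    refine le_trans (mul_le_mul_of_nonneg_right ?_ hdt.le) hNdt
    rw [Nat.card_Icc]
    exact Nat.cast_le.2 (by omega)
  -- Cauchy-Schwarz over the windows: their number times `dt` is at most `T`, so the `√dt`
  -- compensates exactly for the number of terms.
  have hsum : ∑ w ∈ Finset.Icc N₀ N, √dt * s w ≤ √(T * Ss) := by
    refine Real.le_sqrt_of_sq_le ?_
    have h1 := sq_sum_le_card_mul_sum_sq (s := Finset.Icc N₀ N) (f := fun w => √dt * s w)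
    refine h1.trans ?_
    have h2 : ∑ w ∈ Finset.Icc N₀ N, (√dt * s w) ^ 2 = dt * Ss := by
      rw [hSs, Finset.mul_sum]
      exact Finset.sum_congr rfl fun w _ => by rw [mul_pow, Real.sq_sqrt hdt.le]
    rw [h2, ← mul_assoc]
    exact mul_le_mul_of_nonneg_right hcard hSs0
  have k3 : ∀ w ∈ Finset.Icc N₀ N, Y w ^ 2 ≤ 2 * A ^ 2 * (1 + B ^ 2 * T) * (Y (N₀ - 1) ^ 2 + Ss) := by
    intro w hw
    obtain ⟨hw1, hw2⟩ := Finset.mem_Icc.1 hw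
    obtain ⟨k, rfl⟩ : ∃ k, w = N₀ - 1 + k := ⟨w - (N₀ - 1), by omega⟩
    obtain ⟨h0, h1⟩ := k2 k hw2
    have h2 : (1 + 2 * B * dt) ^ k ≤ A := by
      have h3 : 1 + 2 * B * dt ≤ Real.exp (2 * B * dt) := by
        linarith [Real.add_one_le_exp (2 * B * dt)]
      refine (pow_le_pow_left₀ (by positivity) h3 k).trans ?_
      rw [← Real.exp_nat_mul, hA]
      refine Real.exp_le_exp.2 ?_
      have h4 : (k : ℝ) * dt ≤ T := by
        refine le_trans (mul_le_mul_of_nonneg_right (Nat.cast_le.2 ?_) hdt.le) hNdt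
        omega
      calc (k : ℝ) * (2 * B * dt) = 2 * B * (k * dt) := by ring
        _ ≤ 2 * B * T := mul_le_mul_of_nonneg_left h4 (by positivity)
    have h3 : ∑ w ∈ Finset.Ico N₀ (N₀ + k), √dt * s w ≤ √(T * Ss) := by
      refine le_trans (Finset.sum_le_sum_of_subset_of_nonneg ?_ fun w _ _ =>
        mul_nonneg (Real.sqrt_nonneg _) (hs w)) hsum
      intro w hw
      rw [Finset.mem_Ico] at hw
      exact Finset.mem_Icc.2 ⟨hw.1, by omega⟩
    have h4 : Y (N₀ - 1 + k) ≤ A * (Y (N₀ - 1) + B * √(T * Ss)) := by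
      refine h1.trans (mul_le_mul h2 ?_ ?_ (by positivity))
      · exact add_le_add le_rfl (mul_le_mul_of_nonneg_left h3 (by positivity))
      · exact add_nonneg hY0 (mul_nonneg (by positivity) (Finset.sum_nonneg fun w _ =>
          mul_nonneg (Real.sqrt_nonneg _) (hs w)))
    have h5 : (√(T * Ss)) ^ 2 = T * Ss := Real.sq_sqrt (by positivity)
    calc Y (N₀ - 1 + k) ^ 2 ≤ (A * (Y (N₀ - 1) + B * √(T * Ss))) ^ 2 := pow_le_pow_left₀ h0 h4 2
      _ ≤ A ^ 2 * (2 * (Y (N₀ - 1) ^ 2 + B ^ 2 * (√(T * Ss)) ^ 2)) := by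
          rw [mul_pow]
          refine mul_le_mul_of_nonneg_left ?_ (sq_nonneg _)
          nlinarith [sq_nonneg (Y (N₀ - 1) - B * √(T * Ss))]
      _ = 2 * A ^ 2 * (Y (N₀ - 1) ^ 2 + B ^ 2 * T * Ss) := by rw [h5]; ring
      _ ≤ _ := by
          rw [mul_assoc (2 * A ^ 2)]
          refine mul_le_mul_of_nonneg_left ?_ (by positivity)
          have : 0 ≤ B ^ 2 * T * Y (N₀ - 1) ^ 2 := by positivity
          nlinarith
  calc ∑ w ∈ Finset.Icc N₀ N, ε w ^ 2
      ≤ ∑ w ∈ Finset.Icc N₀ N, 4 * c * (dt * (2 * A ^ 2 * (1 + B ^ 2 * T) *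
        (Y (N₀ - 1) ^ 2 + Ss)) + s w ^ 2) := by
        refine Finset.sum_le_sum fun w hw => (k1 w hw).trans ?_
        refine mul_le_mul_of_nonneg_left (add_le_add (mul_le_mul_of_nonneg_left (k3 w hw) hdt.le)
          le_rfl) (by linarith)
    _ = 4 * c * (((Finset.Icc N₀ N).card * dt) * (2 * A ^ 2 * (1 + B ^ 2 * T) *
        (Y (N₀ - 1) ^ 2 + Ss)) + Ss) := by
        rw [← Finset.mul_sum, Finset.sum_add_distrib, Finset.sum_const, nsmul_eq_mul]
        ring
    _ ≤ 4 * c * (T * (2 * A ^ 2 * (1 + B ^ 2 * T) * (Y (N₀ - 1) ^ 2 + Ss)) +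
        (Y (N₀ - 1) ^ 2 + Ss)) := by
        refine mul_le_mul_of_nonneg_left (add_le_add (mul_le_mul_of_nonneg_right hcard
          (by positivity)) ?_) (by linarith)
        linarith [sq_nonneg (Y (N₀ - 1))]
    _ = _ := by ring

/-! ### Square integrable functions on subintervals -/

section

variable {V : Type*} [NormedAddCommGroup V]

lemma memLp_Ioc_mono {f : ℝ → V} {a b a' b' : ℝ} (hf : MemLp f 2 (volume.restrict (Ioc a b)))
    (ha : a ≤ a') (hb : b' ≤ b) : MemLp f 2 (volume.restrict (Ioc a' b')) :=
  hf.mono_measure (Measure.restrict_mono (Ioc_subset_Ioc ha hb) le_rfl)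

lemma memLp_Ioc_congr {f g : ℝ → V} {a b : ℝ} (hf : MemLp f 2 (volume.restrict (Ioc a b)))
    (h : ∀ t ∈ Ioc a b, f t = g t) : MemLp g 2 (volume.restrict (Ioc a b)) :=
  (memLp_congr_ae (by filter_upwards [ae_restrict_mem measurableSet_Ioc] with t ht using h t ht)).1
    hf

lemma intervalIntegrable_of_memLp_Ioc {f : ℝ → V} {a b : ℝ} (hab : a ≤ b)
    (hf : MemLp f 2 (volume.restrict (Ioc a b))) : IntervalIntegrable f volume a b := by
  rw [intervalIntegrable_iff_integrableOn_Ioc_of_le hab]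
  exact hf.integrable one_le_two

lemma intervalIntegrable_sq_of_memLp_Ioc {f : ℝ → V} {a b : ℝ} (hab : a ≤ b)
    (hf : MemLp f 2 (volume.restrict (Ioc a b))) :
    IntervalIntegrable (fun t => ‖f t‖ ^ 2) volume a b := by
  rw [intervalIntegrable_iff_integrableOn_Ioc_of_le hab]
  exact hf.integrable_norm_pow two_ne_zero

lemma intervalIntegrable_inner_of_memLp_Ioc [InnerProductSpace ℝ V] {f g : ℝ → V} {a b : ℝ}
    (hab : a ≤ b) (hf : MemLp f 2 (volume.restrict (Ioc a b)))
    (hg : MemLp g 2 (volume.restrict (Ioc a b))) :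
    IntervalIntegrable (fun t => (inner ℝ (f t) (g t) : ℝ)) volume a b := by
  rw [intervalIntegrable_iff_integrableOn_Ioc_of_le hab]
  refine (L2.integrable_inner (𝕜 := ℝ) (hf.toLp f) (hg.toLp g)).congr ?_
  filter_upwards [hf.coeFn_toLp, hg.coeFn_toLp] with t h1 h2
  rw [h1, h2]

end

/-! ### The errors and their equations -/

section Errors

variable {m : ℕ} {S : Spatial m}

/-- The error of the state, `u_i - u_i^n` on the substep `n`. -/
def stateErr (T : ℝ) (G : Grid) (u : ∀ i, ℝ → S.FE i) (X : Discrete S) (i : Fin 2) (t : ℝ) :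
    S.FE i :=
  u i t - X.u i ⌈t / G.dti T i⌉₊ t

/-- The error of the flux. -/
def fluxErr (T : ℝ) (G : Grid) (F : Fin 2 → ℝ → S.TraceFE) (X : Discrete S) (i : Fin 2) (t : ℝ) :
    S.TraceFE :=
  F i t - X.F i ⌈t / G.dt T⌉₊ t

/-- The side value errors at the end points of the substeps. -/
def nodeErr (T : ℝ) (G : Grid) (u : ∀ i, ℝ → S.FE i) (X : Discrete S) (i : Fin 2) (j : ℕ) :
    S.FE i :=
  u i (G.node T i j) - X.U i j

/-- The representative of `v ↦ L(e, v) + (φ, v)_Γ`, with the errors `e` of the state and `φ` of the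
flux. -/
def residual (A : Coeffs m) (T : ℝ) (G : Grid) (u : ∀ i, ℝ → S.FE i)
    (F : Fin 2 → ℝ → S.TraceFE) (X : Discrete S) (i : Fin 2) (t : ℝ) : S.FE i :=
  A.op S i (stateErr T G u X i t) +
    ContinuousLinearMap.adjoint (S.tr i) (fluxErr T G F X i t)

variable {A : Coeffs m} {d : Loads m} {T : ℝ} {u : ∀ i, ℝ → S.FE i} {F : Fin 2 → ℝ → S.TraceFE}
  {Q : Method} {N₀ : ℕ} {G : Grid} {X : Discrete S}

lemma inner_residual (i : Fin 2) (t : ℝ) (v : S.FE i) :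
    (inner ℝ (residual A T G u F X i t) v : ℝ) =
      inner ℝ (A.op S i (stateErr T G u X i t)) v + inner ℝ (fluxErr T G F X i t) (S.tr i v) := by
  rw [residual, inner_add_left, ContinuousLinearMap.adjoint_inner_left]

lemma exists_norm_residual_le (A : Coeffs m) (S : Spatial m) : ∃ c, 1 ≤ c ∧
    ∀ (T : ℝ) (G : Grid) (u : ∀ i, ℝ → S.FE i) (F : Fin 2 → ℝ → S.TraceFE) (X : Discrete S)
      (i : Fin 2) (t : ℝ), ‖residual A T G u F X i t‖ ≤
        c * (‖stateErr T G u X i t‖ + ‖fluxErr T G F X i t‖) := by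
  refine ⟨1 + ∑ i, (‖A.op S i‖ + ‖ContinuousLinearMap.adjoint (S.tr i)‖),
    le_add_of_nonneg_right (Finset.sum_nonneg fun _ _ => by positivity), ?_⟩
  intro T G u F X i t
  have h1 : ‖A.op S i‖ + ‖ContinuousLinearMap.adjoint (S.tr i)‖ ≤
      1 + ∑ i, (‖A.op S i‖ + ‖ContinuousLinearMap.adjoint (S.tr i)‖) := by
    have := Finset.single_le_sum
      (f := fun i => ‖A.op S i‖ + ‖ContinuousLinearMap.adjoint (S.tr i)‖)
      (fun _ _ => by positivity) (Finset.mem_univ i)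
    linarith
  have h2 := norm_nonneg (A.op S i)
  have h3 := norm_nonneg (ContinuousLinearMap.adjoint (S.tr i))
  rw [residual, mul_add]
  refine (norm_add_le _ _).trans (add_le_add ?_ ?_)
  · exact (ContinuousLinearMap.le_opNorm _ _).trans
      (mul_le_mul_of_nonneg_right (by linarith) (norm_nonneg _))
  · exact (ContinuousLinearMap.le_opNorm _ _).trans
      (mul_le_mul_of_nonneg_right (by linarith) (norm_nonneg _))

lemma stateErr_eq (hT : 0 < T) {i : Fin 2} {j : ℕ} (hj : 1 ≤ j) {t : ℝ}
    (ht : t ∈ Ioc (G.node T i (j - 1)) (G.node T i j)) :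
    stateErr T G u X i t = u i t - X.u i j t := by
  rw [stateErr, G.ceil_eq_of_mem hT i hj ht]

lemma fluxErr_eq (hT : 0 < T) {i : Fin 2} {w : ℕ} (hw : 1 ≤ w) {t : ℝ}
    (ht : t ∈ Ioc (G.sync T (w - 1)) (G.sync T w)) :
    fluxErr T G F X i t = F i t - X.F i w t := by
  rw [fluxErr, G.ceil_sync_eq_of_mem hT hw ht]

lemma IsSemiDiscrete.continuousOn (hT : 0 < T) (hu : IsSemiDiscrete S A d T u F) (i : Fin 2) :
    ContinuousOn (u i) (Icc 0 T) := by
  obtain ⟨⟨u', hu'⟩, -, -⟩ := hu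
  exact (hu' i).1.continuousOn hT.le

lemma IsSobolev.memLp {V : Type*} [NormedAddCommGroup V] [InnerProductSpace ℝ V] {k : ℕ}
    {v : ℝ → V} {D : ℕ → ℝ → V} (h : IsSobolev k T v D) :
    MemLp v 2 (volume.restrict (Ioc 0 T)) :=
  (memLp_congr_ae h.1).2 (h.2.2 0 (Nat.zero_le k))

/-- The discrete state is a finite sum of polynomials times indicators of substeps, including the
substeps on which the data are given. -/
lemma memLp_stateErr (hT : 0 < T) (hu : ∀ i, ContinuousOn (u i) (Icc 0 T))
    (hX : ∀ i, ∀ j ∈ Finset.Icc 1 (G.N * G.M i), IsTimePoly Q.q (X.u i j)) (i : Fin 2) :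
    MemLp (stateErr T G u X i) 2 (volume.restrict (Ioc 0 T)) := by
  refine (hu i).memLp_Ioc.sub ?_
  refine memLp_Ioc_congr (f := fun t => ∑ j ∈ Finset.Icc 1 (G.N * G.M i),
    (Ioc (G.node T i (j - 1)) (G.node T i j)).indicator (X.u i j) t)
    (memLp_finsetSum _ fun j hj => ((hX i j hj).memLp 0 T).indicator measurableSet_Ioc) ?_
  intro t ht
  obtain ⟨h1, h2⟩ := G.mem_Ioc_ceil hT i ht
  rw [Finset.sum_eq_single_of_mem _ h1, indicator_of_mem h2]
  intro j hj hne
  refine indicator_of_notMem (fun htj => hne ?_) _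
  exact (G.ceil_eq_of_mem hT i (Finset.mem_Icc.1 hj).1 htj).symm

/-- Only on windows where the scheme is solved, since nothing is prescribed for the fluxes on
earlier windows. -/
lemma memLp_fluxErr (hT : 0 < T) (hF : ∀ i, MemLp (F i) 2 (volume.restrict (Ioc 0 T)))
    (hX : IsMultirateSolution A d T Q N₀ G X) (hN₀ : 1 ≤ N₀) (i : Fin 2) {w : ℕ}
    (hw : w ∈ Finset.Icc N₀ G.N) :
    MemLp (fluxErr T G F X i) 2 (volume.restrict (Ioc (G.sync T (w - 1)) (G.sync T w))) := by
  have hw' := Finset.mem_Icc.1 hw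
  refine memLp_Ioc_congr (f := fun t => F i t - X.F i w t)
    ((memLp_Ioc_mono (hF i) (G.sync_nonneg hT _) (G.sync_le hT hw'.2)).sub
      ((hX.2 w hw i).2.2.1.memLp _ _)) fun t ht => ?_
  rw [fluxErr_eq hT (hN₀.trans hw'.1) ht]

lemma memLp_residual (hT : 0 < T) (hu : ∀ i, ContinuousOn (u i) (Icc 0 T))
    (hF : ∀ i, MemLp (F i) 2 (volume.restrict (Ioc 0 T)))
    (hX : IsMultirateSolution A d T Q N₀ G X) (hN₀ : 1 ≤ N₀) (i : Fin 2) {w : ℕ}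
    (hw : w ∈ Finset.Icc N₀ G.N) :
    MemLp (residual A T G u F X i) 2
      (volume.restrict (Ioc (G.sync T (w - 1)) (G.sync T w))) := by
  have hw' := Finset.mem_Icc.1 hw
  exact ((A.op S i).comp_memLp' (memLp_Ioc_mono (memLp_stateErr hT hu hX.1 i)
    (G.sync_nonneg hT _) (G.sync_le hT hw'.2))).add
    ((ContinuousLinearMap.adjoint (S.tr i)).comp_memLp' (memLp_fluxErr hT hF hX hN₀ i hw))

lemma Grid.substep_subset_window (G : Grid) (hT : 0 < T) {i : Fin 2} {w n : ℕ} (hw : 1 ≤ w)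
    (hwN : w ≤ G.N) (hn : n ∈ Finset.Icc 1 (G.M i)) :
    G.sync T (w - 1) ≤ G.node T i (G.idx i w n - 1) ∧
      G.node T i (G.idx i w n) ≤ G.sync T w := by
  obtain ⟨-, h2, h3, -⟩ := G.idx_bounds hw hwN hn
  rw [← G.node_mul i, ← G.node_mul i]
  exact ⟨G.node_le_node hT i h3, G.node_le_node hT i h2⟩

/-- The equation for the errors on a substep. -/
lemma substep_error_eq (hT : 0 < T) (hu : IsSemiDiscrete S A d T u F)
    (hF : ∀ i, MemLp (F i) 2 (volume.restrict (Ioc 0 T)))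
    (hX : IsMultirateSolution A d T Q N₀ G X) (hN₀ : 1 ≤ N₀) {i : Fin 2} {w n : ℕ}
    (hw : w ∈ Finset.Icc N₀ G.N) (hn : n ∈ Finset.Icc 1 (G.M i)) {v : ℝ → S.FE i}
    (hv : IsTimePoly (Q.q + 1 - Q.ns) v) :
    (inner ℝ (nodeErr T G u X i (G.idx i w n)) (v (G.node T i (G.idx i w n))) : ℝ) -
        inner ℝ (nodeErr T G u X i (G.idx i w n - 1)) (v (G.node T i (G.idx i w n - 1))) =
      (∫ t in (G.node T i (G.idx i w n - 1))..(G.node T i (G.idx i w n)),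
        inner ℝ (stateErr T G u X i t) (deriv v t)) -
      ∫ t in (G.node T i (G.idx i w n - 1))..(G.node T i (G.idx i w n)),
        inner ℝ (residual A T G u F X i t) (v t) := by
  have hw' := Finset.mem_Icc.1 hw
  have hw1 : 1 ≤ w := hN₀.trans hw'.1
  obtain ⟨hj1, hj2, hj3, hj4⟩ := G.idx_bounds hw1 hw'.2 hn
  obtain ⟨hs1, hs2⟩ := G.substep_subset_window hT hw1 hw'.2 hn
  have hcont := fun i => hu.continuousOn hT i
  have hres := memLp_Ioc_mono (memLp_residual hT hcont hF hX hN₀ i hw) hs1 hs2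
  have hse := memLp_stateErr hT hcont hX.1 i
  have heq := (hX.2 w hw i).1 n hn |>.2 v hv
  set j := G.idx i w n with hj
  set a := G.node T i (j - 1) with ha
  set b := G.node T i j with hb
  have hab : a ≤ b := G.node_le_node hT i (Nat.sub_le _ _)
  have ha0 : 0 ≤ a := G.node_nonneg hT i _
  have hbT : b ≤ T := G.node_le hT i hj4
  obtain ⟨⟨u', hu'⟩, -, -⟩ := hu
  obtain ⟨hud, hueq⟩ := hu' i
  -- Integration by parts brings the exact solution into the same weak form as the scheme.
  have hibp := hud.integral_inner_timePoly ha0 hab hbT hv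
  have hXj : IsTimePoly Q.q (X.u i j) := hX.1 i j (Finset.mem_Icc.2 ⟨hj1, hj4⟩)
  have i1 := hud.intervalIntegrable_inner_timePoly ha0 hab hbT hv
  have i2 : IntervalIntegrable (fun t => (inner ℝ (residual A T G u F X i t) (v t) : ℝ))
      volume a b := intervalIntegrable_inner_of_memLp_Ioc hab hres (hv.memLp a b)
  -- The load `f` is eliminated by means of the semi-discrete equation, which leaves the residual
  -- and the time derivative of the exact solution.
  have e1 : ∫ t in a..b, (A.L i (X.u i j t) (v t) + pairGam (X.F i w t) (trace (v t)) -
      pairOmega i (d.f i t) (v t)) =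
      ∫ t in a..b, (-(inner ℝ (residual A T G u F X i t) (v t) : ℝ) -
        inner ℝ (u' i t) (v t)) := by
    have hueq' : ∀ᵐ t ∂volume, t ∈ Ioc 0 T → ∀ v : S.FE i,
      inner ℝ (u' i t) v =
        -A.L i (u i t) v - pairGam (F i t) (trace v) + pairOmega i (d.f i t) v :=
      (ae_restrict_iff' measurableSet_Ioc).1 hueq
    refine intervalIntegral.integral_congr_ae ?_
    filter_upwards [hueq'] with t ht htI
    rw [uIoc_of_le hab] at htI
    have h1 := ht ⟨ha0.trans_lt htI.1, htI.2.trans hbT⟩ (v t)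
    rw [inner_residual, stateErr_eq hT hj1 htI,
      fluxErr_eq hT hw1 ⟨hs1.trans_lt htI.1, htI.2.trans hs2⟩, map_sub, inner_sub_left,
      inner_sub_left, A.inner_op, A.inner_op, ← pairGam_trace_right, ← pairGam_trace_right]
    linarith
  have e2 : ∫ t in a..b, (-(inner ℝ (residual A T G u F X i t) (v t) : ℝ) -
        inner ℝ (u' i t) (v t)) =
      -(∫ t in a..b, (inner ℝ (residual A T G u F X i t) (v t) : ℝ)) -
        ∫ t in a..b, (inner ℝ (u' i t) (v t) : ℝ) := by
    rw [← intervalIntegral.integral_neg]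
    exact intervalIntegral.integral_sub i2.neg i1
  have e3 : ∫ t in a..b, (inner ℝ (stateErr T G u X i t) (deriv v t) : ℝ) =
      (∫ t in a..b, (inner ℝ (u i t) (deriv v t) : ℝ)) -
        ∫ t in a..b, (inner ℝ (X.u i j t) (deriv v t) : ℝ) := by
    rw [← intervalIntegral.integral_sub]
    · refine intervalIntegral.integral_congr_ae (Filter.Eventually.of_forall fun t ht => ?_)
      rw [uIoc_of_le hab] at ht
      simp only [stateErr_eq hT hj1 ht, inner_sub_left]
    · refine ContinuousOn.intervalIntegrable ?_
      rw [uIcc_of_le hab]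
      exact ((hcont i).mono (Icc_subset_Icc ha0 hbT)).inner (𝕜 := ℝ)
        hv.continuous_deriv.continuousOn
    · exact (hXj.continuous.inner hv.continuous_deriv).intervalIntegrable _ _
  rw [e1, e2] at heq
  rw [e3, nodeErr, nodeErr, inner_sub_left, inner_sub_left]
  linarith

/-- The projected traces on a coupling window. -/
lemma window_trace_eq (hT : 0 < T) (hX : IsMultirateSolution A d T Q N₀ G X) (hN₀ : 1 ≤ N₀)
    (i : Fin 2) {w : ℕ} (hw : w ∈ Finset.Icc N₀ G.N) {l : ℝ → S.TraceFE}
    (hl : IsTimePoly (Q.r i) l) :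
    ∫ t in (G.sync T (w - 1))..(G.sync T w), (inner ℝ (X.uΓ i w t) (l t) : ℝ) =
      ∫ t in (G.sync T (w - 1))..(G.sync T w),
        inner ℝ (S.tr i (X.u i ⌈t / G.dti T i⌉₊ t)) (l t) := by
  have hw' := Finset.mem_Icc.1 hw
  have hw1 : 1 ≤ w := hN₀.trans hw'.1
  have hcongr : ∀ n ∈ Finset.Icc 1 (G.M i),
      ∀ t ∈ Ioc (G.node T i (G.idx i w n - 1)) (G.node T i (G.idx i w n)),
      (inner ℝ (S.tr i (X.u i (G.idx i w n) t)) (l t) : ℝ) =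
        inner ℝ (S.tr i (X.u i ⌈t / G.dti T i⌉₊ t)) (l t) := fun n hn t ht => by
    rw [G.ceil_eq_of_mem hT i (G.idx_bounds hw1 hw'.2 hn).1 ht]
  rw [((hX.2 w hw i).2.2.2 l hl).1, ← G.sum_window i hw1]
  · refine Finset.sum_congr rfl fun n hn => ?_
    refine intervalIntegral.integral_congr_ae (Filter.Eventually.of_forall fun t ht => ?_)
    rw [uIoc_of_le (G.node_le_node hT i (Nat.sub_le _ _))] at ht
    exact hcongr n hn t ht
  · intro n hn
    obtain ⟨hj1, -, -, hj4⟩ := G.idx_bounds hw1 hw'.2 hn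
    have hXj := hX.1 i _ (Finset.mem_Icc.2 ⟨hj1, hj4⟩)
    refine (((S.tr i).continuous.comp hXj.continuous).inner (𝕜 := ℝ)
      hl.continuous).intervalIntegrable (μ := volume) _ _ |>.congr ?_
    rw [uIoc_of_le (G.node_le_node hT i (Nat.sub_le _ _))]
    exact fun t ht => hcongr n hn t ht

/-- The fluxes on a coupling window. -/
lemma window_flux_eq (hT : 0 < T) (hu : IsSemiDiscrete S A d T u F)
    (hX : IsMultirateSolution A d T Q N₀ G X) (i : Fin 2) {w : ℕ}
    (hw : w ∈ Finset.Icc N₀ G.N) {l : ℝ → S.TraceFE} (hl : IsTimePoly (Q.r i) l) :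
    ∫ t in (G.sync T (w - 1))..(G.sync T w), (inner ℝ (X.F i w t) (l t) : ℝ) =
      ∫ t in (G.sync T (w - 1))..(G.sync T w),
        inner ℝ (F i t - ∑ j, A.b i j • (S.tr j (u j t) - X.uΓ j w t)) (l t) := by
  have hw' := Finset.mem_Icc.1 hw
  rw [((hX.2 w hw i).2.2.2 l hl).2]
  refine intervalIntegral.integral_congr_ae ?_
  have hF := (ae_restrict_iff' measurableSet_Ioc).1 (hu.2.2 i)
  filter_upwards [hF] with t ht htI
  rw [uIoc_of_le (G.sync_le_sync hT (Nat.sub_le _ _))] at htI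
  have h1 := ht ⟨(G.sync_nonneg hT _).trans_lt htI.1, htI.2.trans (G.sync_le hT hw'.2)⟩ (l t)
  -- The exact and the discrete flux contain the same load `g`, which cancels.
  have h2 := pairGam_combo_sub S (d.g_memLp i t) (A.b i 0) (A.b i 1) (S.tr 0 (u 0 t))
    (S.tr 1 (u 1 t)) (l t)
  have h3 := pairGam_combo_sub S (d.g_memLp i t) (A.b i 0) (A.b i 1) (X.uΓ 0 w t)
    (X.uΓ 1 w t) (l t)
  rw [Fin.sum_univ_two, inner_sub_left, inner_add_left, real_inner_smul_left,
    real_inner_smul_left, inner_sub_left, inner_sub_left]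
  have h4 : (inner ℝ (F i t) (l t) : ℝ) = A.b i 0 * inner ℝ (S.tr 0 (u 0 t)) (l t) +
      A.b i 1 * inner ℝ (S.tr 1 (u 1 t)) (l t) - pairGam (d.g i t) (l t) := h1.trans h2
  rw [h3, h4]
  ring

end Errors

/-! ### Norms in `L²` of time and polynomial approximation in them. -/

section L2Norm

variable {V : Type*} [NormedAddCommGroup V]

lemma l2n_congr_ae {f g : ℝ → V} {a b : ℝ} (hab : a ≤ b)
    (h : ∀ᵐ t ∂volume.restrict (Ioc a b), f t = g t) : l2n a b f = l2n a b g := by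
  rw [l2n, l2n, intervalIntegral.integral_of_le hab, intervalIntegral.integral_of_le hab]
  congr 1
  refine integral_congr_ae ?_
  filter_upwards [h] with t ht using by rw [ht]

lemma l2n_congr {f g : ℝ → V} {a b : ℝ} (hab : a ≤ b) (h : ∀ t ∈ Ioc a b, f t = g t) :
    l2n a b f = l2n a b g :=
  l2n_congr_ae hab (by filter_upwards [ae_restrict_mem measurableSet_Ioc] with t ht using h t ht)

lemma l2n_le_of_norm_le {V' : Type*} [NormedAddCommGroup V'] {f : ℝ → V} {g : ℝ → V'} {a b c : ℝ}
    (hab : a ≤ b) (hc : 0 ≤ c) (hg : MemLp g 2 (volume.restrict (Ioc a b)))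
    (h : ∀ t ∈ Ioc a b, ‖f t‖ ≤ c * ‖g t‖) : l2n a b f ≤ c * l2n a b g := by
  refine Real.sqrt_le_iff.2 ⟨mul_nonneg hc (l2n_nonneg _ _ _), ?_⟩
  rw [mul_pow, sq_l2n hab, ← intervalIntegral.integral_const_mul,
    intervalIntegral.integral_of_le hab, intervalIntegral.integral_of_le hab]
  refine integral_mono_of_nonneg (Filter.Eventually.of_forall fun _ => sq_nonneg _)
    (hg.integrable_norm_pow two_ne_zero |>.const_mul _) ?_
  filter_upwards [ae_restrict_mem measurableSet_Ioc] with t ht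
  rw [← mul_pow]
  exact pow_le_pow_left₀ (norm_nonneg _) (h t ht) 2

lemma l2n_le_of_norm_le_const {f : ℝ → V} {a b c : ℝ} (hab : a ≤ b) (hc : 0 ≤ c)
    (h : ∀ t ∈ Ioc a b, ‖f t‖ ≤ c) : l2n a b f ≤ √(b - a) * c := by
  refine Real.sqrt_le_iff.2 ⟨mul_nonneg (Real.sqrt_nonneg _) hc, ?_⟩
  rw [mul_pow, Real.sq_sqrt (sub_nonneg.2 hab)]
  have := intervalIntegral.norm_integral_le_of_norm_le_const (a := a) (b := b)
    (f := fun t => ‖f t‖ ^ 2) (C := c ^ 2) (fun t ht => by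
      rw [uIoc_of_le hab] at ht
      rw [Real.norm_of_nonneg (sq_nonneg _)]
      exact pow_le_pow_left₀ (norm_nonneg _) (h t ht) 2)
  rw [abs_of_nonneg (sub_nonneg.2 hab)] at this
  linarith [le_abs_self (∫ t in a..b, ‖f t‖ ^ 2), Real.norm_eq_abs (∫ t in a..b, ‖f t‖ ^ 2)]

lemma integral_norm_le_l2n {f : ℝ → V} {a b : ℝ} (hab : a ≤ b)
    (hf : MemLp f 2 (volume.restrict (Ioc a b))) :
    ∫ t in a..b, ‖f t‖ ≤ √(b - a) * l2n a b f := by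
  refine Real.le_sqrt_of_sq_le ?_ |>.trans (Real.sqrt_mul (sub_nonneg.2 hab) _).le
  exact sq_integral_le hab hf.norm

/-- The pointwise bound has only `k` powers of the length and an `L¹` norm. Passing to `L²` on both
sides gives two more half powers. -/
lemma IsDerivChain.exists_timePoly_l2n_le [InnerProductSpace ℝ V] [FiniteDimensional ℝ V]
    {T : ℝ} {k : ℕ} {D : ℕ → ℝ → V}
    (h : IsDerivChain (k + 1) T D) {a b : ℝ} (ha : 0 ≤ a) (hab : a ≤ b) (hb : b ≤ T)
    (hD : MemLp (D (k + 1)) 2 (volume.restrict (Ioc a b))) :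
    ∃ P : ℝ → V, IsTimePoly k P ∧
      l2n a b (fun t => D 0 t - P t) ≤ (b - a) ^ (k + 1) * l2n a b (D (k + 1)) := by
  obtain ⟨P, hP, hPe⟩ := h.exists_timePoly_approx k ha hab hb
  have hba : 0 ≤ b - a := sub_nonneg.2 hab
  refine ⟨P, hP, (l2n_le_of_norm_le_const hab (mul_nonneg (pow_nonneg hba _)
    (intervalIntegral.integral_nonneg hab fun _ _ => norm_nonneg _))
    fun t ht => hPe t (Ioc_subset_Icc_self ht)).trans ?_⟩
  calc √(b - a) * ((b - a) ^ k * ∫ s in a..b, ‖D (k + 1) s‖)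
      ≤ √(b - a) * ((b - a) ^ k * (√(b - a) * l2n a b (D (k + 1)))) := by
        gcongr
        exact integral_norm_le_l2n hab hD
    _ = (√(b - a) * √(b - a)) * (b - a) ^ k * l2n a b (D (k + 1)) := by ring
    _ = _ := by rw [Real.mul_self_sqrt hba, ← pow_succ']

lemma sum_sq_l2n_windows (G : Grid) {T : ℝ} (hT : 0 < T) {f : ℝ → V}
    (hf : MemLp f 2 (volume.restrict (Ioc 0 T))) {N₀ : ℕ} (hN₀ : 1 ≤ N₀) :
    ∑ w ∈ Finset.Icc N₀ G.N, l2n (G.sync T (w - 1)) (G.sync T w) f ^ 2 ≤ l2n 0 T f ^ 2 := by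
  refine (Finset.sum_le_sum_of_subset_of_nonneg (Finset.Icc_subset_Icc_left hN₀)
    fun _ _ _ => sq_nonneg _).trans_eq ?_
  rw [sq_l2n hT.le]
  have h1 := G.sum_windows_integral (T := T) (f := fun t => ‖f t‖ ^ 2) (Nat.zero_le G.N)
    (fun w hw => intervalIntegrable_sq_of_memLp_Ioc (G.sync_le_sync hT (Nat.sub_le _ _))
      (memLp_Ioc_mono hf (G.sync_nonneg hT _) (G.sync_le hT (Finset.mem_Icc.1 hw).2)))
  rw [G.sync_N] at h1
  have h2 : G.sync T 0 = 0 := by simp [Grid.sync]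
  rw [h2] at h1
  rw [← h1]
  exact Finset.sum_congr rfl fun w _ => sq_l2n (G.sync_le_sync hT (Nat.sub_le _ _)) f

end L2Norm

/-- The regularity assumptions, for given representatives of the derivatives of the states, their
traces and the fluxes. -/
structure IsRegular {m : ℕ} {S : Spatial m} (A : Coeffs m) (d : Loads m) (T : ℝ)
    (u : ∀ i, ℝ → S.FE i) (F : Fin 2 → ℝ → S.TraceFE) (Q : Method) (Du : ∀ i, ℕ → ℝ → S.FE i)
    (Dz DF : Fin 2 → ℕ → ℝ → S.TraceFE) : Prop where
  pos : 0 < T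
  semi : IsSemiDiscrete S A d T u F
  state : ∀ i, IsDerivChain (Q.q + 1) T (Du i)
  state_eq : ∀ i, ∀ t ∈ Icc 0 T, u i t = Du i 0 t
  state_memLp : ∀ i, ∀ a ≤ Q.q + 1, MemLp (Du i a) 2 (volume.restrict (Ioc 0 T))
  trace : ∀ i, IsDerivChain (Q.r i + 1) T (Dz i)
  trace_eq : ∀ i, ∀ t ∈ Icc 0 T, S.tr i (u i t) = Dz i 0 t
  trace_memLp : ∀ i, MemLp (Dz i (Q.r i + 1)) 2 (volume.restrict (Ioc 0 T))
  flux : ∀ i, IsDerivChain (Q.r i + 1) T (DF i)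
  flux_eq : ∀ i, F i =ᵐ[volume.restrict (Ioc 0 T)] DF i 0
  flux_memLp : ∀ i, MemLp (DF i (Q.r i + 1)) 2 (volume.restrict (Ioc 0 T))
  flux_memLp' : ∀ i, MemLp (F i) 2 (volume.restrict (Ioc 0 T))

/-! ### The coupling errors on one window. -/

section Window

variable {m : ℕ} {S : Spatial m} {A : Coeffs m} {d : Loads m} {T : ℝ} {u : ∀ i, ℝ → S.FE i}
  {F : Fin 2 → ℝ → S.TraceFE} {Q : Method} {Du : ∀ i, ℕ → ℝ → S.FE i}
  {Dz DF : Fin 2 → ℕ → ℝ → S.TraceFE} {N₀ : ℕ} {G : Grid} {X : Discrete S}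

/-- `∑ᵢ Δt^{r_i+1}`. -/
def windowRate (Q : Method) (δt : ℝ) : ℝ := ∑ i, δt ^ (Q.r i + 1)

/-- The approximation error of traces and fluxes on a window. -/
def windowDefect (T : ℝ) (G : Grid) (Q : Method) (Dz DF : Fin 2 → ℕ → ℝ → S.TraceFE) (w : ℕ) :
    ℝ :=
  windowRate Q (G.dt T) * ∑ j, (l2n (G.sync T (w - 1)) (G.sync T w) (Dz j (Q.r j + 1)) +
    l2n (G.sync T (w - 1)) (G.sync T w) (DF j (Q.r j + 1)))

/-- The error of the states on a window. -/
def windowErr (T : ℝ) (G : Grid) (u : ∀ i, ℝ → S.FE i) (X : Discrete S) (w : ℕ) : ℝ :=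
  ∑ i, l2n (G.sync T (w - 1)) (G.sync T w) (stateErr T G u X i)

lemma pow_le_windowRate (Q : Method) {δt : ℝ} (h : 0 ≤ δt) (i : Fin 2) :
    δt ^ (Q.r i + 1) ≤ windowRate Q δt :=
  Finset.single_le_sum (f := fun i => δt ^ (Q.r i + 1)) (fun _ _ => pow_nonneg h _)
    (Finset.mem_univ i)

lemma windowRate_nonneg (Q : Method) {δt : ℝ} (h : 0 ≤ δt) : 0 ≤ windowRate Q δt :=
  Finset.sum_nonneg fun _ _ => pow_nonneg h _

lemma windowDefect_nonneg (hT : 0 < T) (w : ℕ) : 0 ≤ windowDefect T G Q Dz DF w :=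
  mul_nonneg (windowRate_nonneg Q (G.dt_pos hT).le)
    (Finset.sum_nonneg fun _ _ => add_nonneg (l2n_nonneg _ _ _) (l2n_nonneg _ _ _))

lemma windowErr_nonneg (w : ℕ) : 0 ≤ windowErr T G u X w :=
  Finset.sum_nonneg fun _ _ => l2n_nonneg _ _ _

lemma IsRegular.continuousOn (h : IsRegular A d T u F Q Du Dz DF) (i : Fin 2) :
    ContinuousOn (u i) (Icc 0 T) := h.semi.continuousOn h.pos i

lemma IsRegular.memLp_stateErr (h : IsRegular A d T u F Q Du Dz DF)
    (hX : IsMultirateSolution A d T Q N₀ G X) (i : Fin 2) {w : ℕ} (hw : w ≤ G.N) :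
    MemLp (stateErr T G u X i) 2 (volume.restrict (Ioc (G.sync T (w - 1)) (G.sync T w))) :=
  memLp_Ioc_mono (Multirate.memLp_stateErr h.pos h.continuousOn hX.1 i)
    (G.sync_nonneg h.pos _) (G.sync_le h.pos hw)

/-- The windows are disjoint, so the local squared norms of the highest derivatives add up to at
most the global ones. The factor `4` comes from squaring a sum of four terms. -/
lemma IsRegular.sum_sq_windowDefect_le (h : IsRegular A d T u F Q Du Dz DF) :
    ∃ C, 0 ≤ C ∧ ∀ (G : Grid) (N₀ : ℕ), 1 ≤ N₀ →
      ∑ w ∈ Finset.Icc N₀ G.N, windowDefect T G Q Dz DF w ^ 2 ≤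
        C * windowRate Q (G.dt T) ^ 2 := by
  refine ⟨4 * ∑ j, (l2n 0 T (Dz j (Q.r j + 1)) ^ 2 + l2n 0 T (DF j (Q.r j + 1)) ^ 2),
    mul_nonneg (by norm_num) (Finset.sum_nonneg fun _ _ => by positivity), fun G N₀ hN₀ => ?_⟩
  have h1 : ∀ w, windowDefect T G Q Dz DF w ^ 2 ≤ windowRate Q (G.dt T) ^ 2 *
      (4 * ∑ j, (l2n (G.sync T (w - 1)) (G.sync T w) (Dz j (Q.r j + 1)) ^ 2 +
        l2n (G.sync T (w - 1)) (G.sync T w) (DF j (Q.r j + 1)) ^ 2)) := by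
    intro w
    rw [windowDefect, mul_pow]
    refine mul_le_mul_of_nonneg_left ?_ (sq_nonneg _)
    simp only [Fin.sum_univ_two]
    generalize l2n (G.sync T (w - 1)) (G.sync T w) (Dz 0 (Q.r 0 + 1)) = a
    generalize l2n (G.sync T (w - 1)) (G.sync T w) (Dz 1 (Q.r 1 + 1)) = b
    generalize l2n (G.sync T (w - 1)) (G.sync T w) (DF 0 (Q.r 0 + 1)) = c
    generalize l2n (G.sync T (w - 1)) (G.sync T w) (DF 1 (Q.r 1 + 1)) = e
    nlinarith [sq_nonneg (a - b), sq_nonneg (a - c), sq_nonneg (a - e), sq_nonneg (b - c),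
      sq_nonneg (b - e), sq_nonneg (c - e)]
  refine (Finset.sum_le_sum fun w _ => h1 w).trans ?_
  rw [← Finset.mul_sum, mul_comm]
  refine mul_le_mul_of_nonneg_right ?_ (sq_nonneg _)
  rw [← Finset.mul_sum, Finset.sum_comm]
  refine mul_le_mul_of_nonneg_left (Finset.sum_le_sum fun j _ => ?_) (by norm_num)
  rw [Finset.sum_add_distrib]
  exact add_le_add (sum_sq_l2n_windows G h.pos (h.trace_memLp j) hN₀)
    (sum_sq_l2n_windows G h.pos (h.flux_memLp j) hN₀)

/-- The flux errors on a window, and the cancellation in the coupling terms when they are tested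
with functions that are well approximated by polynomials on the window. -/
lemma IsRegular.exists_window_coupling (h : IsRegular A d T u F Q Du Dz DF) :
    ∃ C, 0 ≤ C ∧ ∀ (N₀ : ℕ) (G : Grid) (X : Discrete S), 1 ≤ N₀ →
      IsMultirateSolution A d T Q N₀ G X → ∀ w ∈ Finset.Icc N₀ G.N,
      (∀ i, l2n (G.sync T (w - 1)) (G.sync T w) (fluxErr T G F X i) ≤
        C * (windowErr T G u X w + windowDefect T G Q Dz DF w)) ∧
      ∀ (y : Fin 2 → ℝ → S.TraceFE) (x : Fin 2 → Fin 2 → ℝ → S.TraceFE) (ω : ℝ),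
        (∀ i, MemLp (y i) 2 (volume.restrict (Ioc (G.sync T (w - 1)) (G.sync T w)))) →
        (∀ i j, IsTimePoly (Q.r j) (x i j)) →
        (∀ i j, l2n (G.sync T (w - 1)) (G.sync T w) (fun t => y i t - x i j t) ≤ ω) →
        |∑ i, (∑ j, A.b i j * (∫ t in (G.sync T (w - 1))..(G.sync T w),
            inner ℝ (S.tr j (stateErr T G u X j t)) (y i t)) -
          ∫ t in (G.sync T (w - 1))..(G.sync T w), inner ℝ (fluxErr T G F X i t) (y i t))| ≤
        C * (windowErr T G u X w + windowDefect T G Q Dz DF w) * ω := by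
  obtain ⟨Cb, hCb0, hCb⟩ := exists_coupling_bounds A.b
  -- The summand `1` lets the same factor stand in front of the defect, which involves no trace
  -- operator.
  set τ := 1 + ∑ i, ‖S.tr i‖ with hτ
  have hτ1 : 1 ≤ τ := le_add_of_nonneg_right (Finset.sum_nonneg fun i _ => norm_nonneg (S.tr i))
  have hτi : ∀ i, ‖S.tr i‖ ≤ τ := fun i => by
    have := Finset.single_le_sum (f := fun i => ‖S.tr i‖) (fun i _ => norm_nonneg (S.tr i))
      (Finset.mem_univ i)
    linarith
  refine ⟨Cb * τ, by positivity, ?_⟩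
  intro N₀ G X hN₀ hX w hw
  have hT := h.pos
  have hw' := Finset.mem_Icc.1 hw
  have hw1 : 1 ≤ w := hN₀.trans hw'.1
  set α := G.sync T (w - 1) with hα
  set β := G.sync T w with hβ
  have hαβ : α ≤ β := G.sync_le_sync hT (Nat.sub_le _ _)
  have hα0 : 0 ≤ α := G.sync_nonneg hT _
  have hβT : β ≤ T := G.sync_le hT hw'.2
  have hlen : β - α = G.dt T := by rw [hα, hβ, ← G.sync_pred_add hw1]; ring
  have hsub : Ioc α β ⊆ Ioc 0 T := Ioc_subset_Ioc hα0 hβT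
  have hdt := (G.dt_pos hT).le
  -- Polynomial approximations of the exact traces and fluxes on the window; their errors make up
  -- `windowDefect`.
  choose P hP hPe using fun j => (h.trace j).exists_timePoly_l2n_le hα0 hαβ hβT
    (memLp_Ioc_mono (h.trace_memLp j) hα0 hβT)
  choose R hR hRe using fun j => (h.flux j).exists_timePoly_l2n_le hα0 hαβ hβT
    (memLp_Ioc_mono (h.flux_memLp j) hα0 hβT)
  have hse := fun j => h.memLp_stateErr hX j hw'.2
  have hu2 : ∀ j, MemLp (fun t => S.tr j (u j t)) 2 (volume.restrict (Ioc α β)) := fun j =>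
    memLp_Ioc_mono ((S.tr j).comp_memLp' (h.continuousOn j).memLp_Ioc) hα0 hβT
  have htrse : ∀ j, MemLp (fun t => S.tr j (stateErr T G u X j t)) 2
      (volume.restrict (Ioc α β)) := fun j => (S.tr j).comp_memLp' (hse j)
  have hdiff : ∀ j t, S.tr j (u j t) - S.tr j (X.u j ⌈t / G.dti T j⌉₊ t) =
      S.tr j (stateErr T G u X j t) := fun j t => by rw [stateErr, map_sub]
  have huh : ∀ j, MemLp (fun t => S.tr j (X.u j ⌈t / G.dti T j⌉₊ t)) 2
      (volume.restrict (Ioc α β)) := fun j => by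
    refine memLp_Ioc_congr ((hu2 j).sub (htrse j)) fun t _ => ?_
    rw [Pi.sub_apply, ← hdiff, sub_sub_cancel]
  have key := hCb S.TraceFE Q.r α β (fun j t => S.tr j (u j t))
    (fun j t => S.tr j (X.u j ⌈t / G.dti T j⌉₊ t)) (fun j => X.uΓ j w) F (fun j => X.F j w) P R
    hαβ hu2 huh (fun j => memLp_Ioc_mono (h.flux_memLp' j) hα0 hβT)
    (fun j => (hX.2 w hw j).2.1) (fun j => (hX.2 w hw j).2.2.1) hP hR
    (fun j l hl => window_trace_eq hT hX hN₀ j hw hl)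
    (fun i l hl => window_flux_eq hT h.semi hX i hw hl)
  have e1 : ∀ i, l2n α β (fun t => F i t - X.F i w t) = l2n α β (fluxErr T G F X i) := fun i =>
    l2n_congr hαβ fun t ht => (fluxErr_eq hT hw1 ht).symm
  have e2 : ∑ j, l2n α β (fun t => S.tr j (stateErr T G u X j t)) ≤ τ * windowErr T G u X w := by
    rw [windowErr, Finset.mul_sum]
    refine Finset.sum_le_sum fun j _ => l2n_le_of_norm_le hαβ (by positivity) (hse j) fun t _ => ?_
    exact ((S.tr j).le_opNorm _).trans (mul_le_mul_of_nonneg_right (hτi j) (norm_nonneg _))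
  have e3 : ∑ j, l2n α β (fun t => S.tr j (u j t) - P j t) +
      ∑ j, l2n α β (fun t => F j t - R j t) ≤ windowDefect T G Q Dz DF w := by
    rw [windowDefect, ← Finset.sum_add_distrib, Finset.mul_sum]
    refine Finset.sum_le_sum fun j _ => ?_
    rw [mul_add]
    refine add_le_add ?_ ?_
    · rw [l2n_congr (g := fun t => Dz j 0 t - P j t) hαβ fun t ht => by
        rw [h.trace_eq j t (Ioc_subset_Icc_self (hsub ht))]]
      refine (hPe j).trans (mul_le_mul_of_nonneg_right ?_ (l2n_nonneg _ _ _))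
      rw [hlen]; exact pow_le_windowRate Q hdt j
    · rw [l2n_congr_ae (g := fun t => DF j 0 t - R j t) hαβ (by
        filter_upwards [ae_restrict_of_ae_restrict_of_subset hsub (h.flux_eq j)] with t ht
        rw [ht])]
      refine (hRe j).trans (mul_le_mul_of_nonneg_right ?_ (l2n_nonneg _ _ _))
      rw [hlen]; exact pow_le_windowRate Q hdt j
  simp only [hdiff] at key
  have hγ := windowDefect_nonneg (Q := Q) (Dz := Dz) (DF := DF) (G := G) hT w
  have hε := windowErr_nonneg (T := T) (G := G) (u := u) (X := X) w
  have e4 : Cb * (∑ j, l2n α β (fun t => S.tr j (stateErr T G u X j t)) +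
      ∑ j, l2n α β (fun t => S.tr j (u j t) - P j t) + ∑ j, l2n α β (fun t => F j t - R j t)) ≤
      Cb * τ * (windowErr T G u X w + windowDefect T G Q Dz DF w) := by
    rw [mul_assoc]
    refine mul_le_mul_of_nonneg_left ?_ hCb0
    have : windowDefect T G Q Dz DF w ≤ τ * windowDefect T G Q Dz DF w :=
      le_mul_of_one_le_left hγ hτ1
    linarith
  refine ⟨fun i => (e1 i).symm.le.trans ((key.1 i).trans e4), ?_⟩
  intro y x ω hy hx hω
  have hω0 : 0 ≤ ω := (l2n_nonneg _ _ _).trans (hω 0 0)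
  have h5 := key.2 y x ω hy hx hω
  have e5 : ∀ i, ∫ t in α..β, (inner ℝ (F i t - X.F i w t) (y i t) : ℝ) =
      ∫ t in α..β, inner ℝ (fluxErr T G F X i t) (y i t) := fun i =>
    intervalIntegral.integral_congr_ae (Filter.Eventually.of_forall fun t ht => by
      rw [uIoc_of_le hαβ] at ht
      rw [fluxErr_eq hT hw1 ht])
  simp only [e5] at h5
  exact h5.trans (mul_le_mul_of_nonneg_right e4 hω0)

end Window

/-! ### The error of the states -/

section Global

variable {m : ℕ} {S : Spatial m} {A : Coeffs m} {d : Loads m} {T : ℝ} {u : ∀ i, ℝ → S.FE i}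
  {F : Fin 2 → ℝ → S.TraceFE} {Q : Method} {Du : ∀ i, ℕ → ℝ → S.FE i}
  {Dz DF : Fin 2 → ℕ → ℝ → S.TraceFE}

lemma sq_add_four_le (x y z w : ℝ) :
    (x + y + z + w) ^ 2 ≤ 4 * (x ^ 2 + y ^ 2 + z ^ 2 + w ^ 2) := by
  nlinarith [sq_nonneg (x - y), sq_nonneg (x - z), sq_nonneg (x - w), sq_nonneg (y - z),
    sq_nonneg (y - w), sq_nonneg (z - w)]

/-- The squared norms of all derivatives of order at most `q + 1`. -/
def derivSq (Q : Method) (Du : ∀ i, ℕ → ℝ → S.FE i) (i : Fin 2) (t : ℝ) : ℝ :=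
  ∑ a ∈ Finset.range (Q.q + 2), ‖Du i a t‖ ^ 2

lemma derivSq_nonneg (i : Fin 2) (t : ℝ) : 0 ≤ derivSq Q Du i t :=
  Finset.sum_nonneg fun _ _ => sq_nonneg _

lemma IsRegular.intervalIntegrable_derivSq (h : IsRegular A d T u F Q Du Dz DF) (i : Fin 2) :
    IntervalIntegrable (derivSq Q Du i) volume 0 T := by
  rw [intervalIntegrable_iff_integrableOn_Ioc_of_le h.pos.le]
  exact integrable_finsetSum _ fun a ha =>
    (h.state_memLp i a (by rw [Finset.mem_range] at ha; omega)).integrable_norm_pow two_ne_zero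

/-- `Method.exists_substep_bound` with the exact state as `y` and the discrete one as `x`. The three
terms are the side value errors, which also enter through the multistep side conditions, the
approximation and consistency errors, and the residual. The bound is squared and multiplied by
`Δt_i` to match the form of the consistency assumption. -/
lemma IsRegular.exists_state_bound (h : IsRegular A d T u F Q Du Dz DF)
    {ψ : ℕ → Polynomial ℝ} (hψ : IsOrthogonalBasis Q.q ψ) (hD : (Q.Dtilde ψ).det ≠ 0) (K : ℝ) :
    ∃ (c : ℝ) (J : ℕ), 0 ≤ c ∧ ∀ (N₀ : ℕ) (G : Grid) (X : Discrete S), 1 ≤ N₀ →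
      ReachesBack Q N₀ G → SideConsistent T Q N₀ G u Du K →
      IsMultirateSolution A d T Q N₀ G X → ∀ w ∈ Finset.Icc N₀ G.N, ∀ i,
      ∀ n ∈ Finset.Icc 1 (G.M i), ∀ Y : ℝ, 0 ≤ Y →
      (∀ j ≤ G.idx i w n, ‖nodeErr T G u X i j‖ ≤ Y) →
      ∀ t ∈ Ioc (G.node T i (G.idx i w n - 1)) (G.node T i (G.idx i w n)),
        G.dti T i * ‖stateErr T G u X i t‖ ^ 2 ≤ c * (G.dti T i * Y ^ 2 +
          G.dti T i ^ (2 * Q.q + 2) * (∫ s in (G.node T i (G.idx i w n - J))..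
            (G.node T i (G.idx i w n)), derivSq Q Du i s) +
          G.dti T i * (∫ s in (G.node T i (G.idx i w n - 1))..(G.node T i (G.idx i w n)),
            ‖residual A T G u F X i s‖) ^ 2) := by
  obtain ⟨C, hC0, hC⟩ := Q.exists_substep_bound hψ hD
  set Jθ : ℕ := ∑ k, ⌈|Q.θ k|⌉₊ with hJθ
  -- The last `J` substeps contain all side points, all side values that are used and the substep
  -- itself.
  set J : ℕ := Q.ks + 1 + Jθ with hJ
  set DD : ℝ := ∑ k, ∑ l, |Q.D k l| with hDD
  have hDD0 : 0 ≤ DD := Finset.sum_nonneg fun _ _ => Finset.sum_nonneg fun _ _ => abs_nonneg _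
  refine ⟨4 * C ^ 2 * ((1 + DD) ^ 2 + Q.ns * |K| + (J : ℝ) ^ (2 * Q.q + 1) + 1), J,
    by positivity, ?_⟩
  intro N₀ G X hN₀ hRB hSC hX w hw i n hn Y hY0 hY t ht
  have hT := h.pos
  have hw' := Finset.mem_Icc.1 hw
  have hw1 : 1 ≤ w := hN₀.trans hw'.1
  obtain ⟨hj1, hj2, hj3, hj4⟩ := G.idx_bounds hw1 hw'.2 hn
  have hside := (hX.2 w hw i).1 n hn |>.1
  have hsc := hSC w hw i n hn
  have herr := fun v hv => substep_error_eq (F := F) (v := v) hT h.semi h.flux_memLp' hX hN₀ hw hn hv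
  obtain ⟨hs1, hs2⟩ := G.substep_subset_window hT hw1 hw'.2 hn
  have hres := memLp_Ioc_mono (memLp_residual hT h.continuousOn h.flux_memLp' hX hN₀ i hw) hs1 hs2
  set j := G.idx i w n with hj
  set δ := G.dti T i with hδ
  have hδ0 : 0 < δ := G.dti_pos hT i
  have hb : G.node T i (j - 1) + δ = G.node T i j := G.node_pred_add i hj1
  set α := G.node T i (j - J) with hα
  set a := G.node T i (j - 1) with ha
  set b := G.node T i j with hbdef
  have hJ1 : j - J ≤ j - 1 := by omega
  have hαa : α ≤ a := G.node_le_node hT i hJ1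
  have hab : a ≤ b := by linarith
  have hα0 : 0 ≤ α := G.node_nonneg hT i _
  have hbT : b ≤ T := G.node_le hT i hj4
  have hlen : b - α ≤ J * δ := by
    rw [hbdef, hα, Grid.node, Grid.node, ← sub_mul]
    refine mul_le_mul_of_nonneg_right ?_ hδ0.le
    have : (j : ℝ) ≤ ((j - J : ℕ) : ℝ) + J := by exact_mod_cast (by omega : j ≤ j - J + J)
    linarith
  -- For `j ≥ J` the interval is long enough by the choice of `J`. Otherwise it starts at time zero,
  -- and the assumption `ReachesBack` keeps the side points nonnegative.
  have hθmem : ∀ k, a + Q.θ k * δ ∈ Icc α b := fun k => by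
    refine ⟨?_, by nlinarith [Q.θ_le_one k]⟩
    have e1 : a + Q.θ k * δ = ((j - 1 : ℕ) + Q.θ k) * δ := by rw [ha, Grid.node]; ring
    rw [e1, hα, Grid.node]
    refine mul_le_mul_of_nonneg_right ?_ hδ0.le
    have h1 : |Q.θ k| ≤ Jθ := (Nat.le_ceil _).trans (Nat.cast_le.2
      (Finset.single_le_sum (f := fun k => ⌈|Q.θ k|⌉₊) (fun _ _ => Nat.zero_le _)
        (Finset.mem_univ k)))
    have h2 := neg_abs_le (Q.θ k)
    by_cases hjJ : J ≤ j
    · have h3 : ((j - J : ℕ) : ℝ) + 1 + Jθ ≤ ((j - 1 : ℕ) : ℝ) + 1 := by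
        exact_mod_cast (by omega : j - J + 1 + Jθ ≤ j - 1 + 1)
      linarith
    · have h3 : j - J = 0 := by omega
      rw [h3, Nat.cast_zero]
      have h4 := (hRB i).2 k
      have h5 : (((N₀ - 1 : ℕ) : ℝ)) * G.M i ≤ ((j - 1 : ℕ) : ℝ) := by
        exact_mod_cast (Nat.mul_le_mul_right _ (Nat.sub_le_sub_right hw'.1 1)).trans hj3
      linarith
  have hb0 : 0 ≤ b - α := by linarith
  set Φ := ∫ s in α..b, derivSq Q Du i s with hΦ
  have hΦ0 : 0 ≤ Φ := intervalIntegral.integral_nonneg (by linarith) fun _ _ => derivSq_nonneg _ _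
  have hΦi : IntervalIntegrable (derivSq Q Du i) volume α b :=
    (h.intervalIntegrable_derivSq i).mono_set (by
      rw [uIcc_of_le (by linarith), uIcc_of_le hT.le]; exact Icc_subset_Icc hα0 hbT)
  obtain ⟨P, hP, hPe⟩ := (h.state i).exists_timePoly_approx Q.q hα0 (by linarith : α ≤ b) hbT
  have hmem := memLp_Ioc_mono (h.state_memLp i (Q.q + 1) le_rfl) hα0 hbT
  set ρ := (b - α) ^ Q.q * ∫ s in α..b, ‖Du i (Q.q + 1) s‖ with hρ
  have hρ0 : 0 ≤ ρ := mul_nonneg (pow_nonneg hb0 _)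
    (intervalIntegral.integral_nonneg (by linarith) fun _ _ => norm_nonneg _)
  -- Of the `2 q + 2` powers of the step, `2 q` come from the approximation, one from Cauchy-Schwarz
  -- and one from the factor in front.
  have hρ2 : δ * ρ ^ 2 ≤ (J : ℝ) ^ (2 * Q.q + 1) * (δ ^ (2 * Q.q + 2) * Φ) := by
    have h1 := sq_integral_le (by linarith : α ≤ b) hmem.norm
    have h2 : ∫ s in α..b, ‖Du i (Q.q + 1) s‖ ^ 2 ≤ Φ := by
      refine intervalIntegral.integral_mono_on (by linarith)
        (intervalIntegrable_sq_of_memLp_Ioc (by linarith) hmem) hΦi fun s _ => ?_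
      exact Finset.single_le_sum (f := fun a => ‖Du i a s‖ ^ 2) (fun _ _ => sq_nonneg _)
        (Finset.mem_range.2 (by omega))
    have h3 : ρ ^ 2 ≤ (J * δ) ^ (2 * Q.q + 1) * Φ := by
      calc ρ ^ 2 = (b - α) ^ (2 * Q.q) * (∫ s in α..b, ‖Du i (Q.q + 1) s‖) ^ 2 := by
            rw [hρ, mul_pow, ← pow_mul, mul_comm Q.q 2]
        _ ≤ (b - α) ^ (2 * Q.q) * ((b - α) * Φ) :=
            mul_le_mul_of_nonneg_left (h1.trans (mul_le_mul_of_nonneg_left h2 hb0))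
              (pow_nonneg hb0 _)
        _ = (b - α) ^ (2 * Q.q + 1) * Φ := by ring
        _ ≤ _ := mul_le_mul_of_nonneg_right (pow_le_pow_left₀ hb0 hlen _) hΦ0
    calc δ * ρ ^ 2 ≤ δ * ((J * δ) ^ (2 * Q.q + 1) * Φ) := mul_le_mul_of_nonneg_left h3 hδ0.le
      _ = _ := by rw [mul_pow]; ring
  have hsub : Icc α b ⊆ Icc 0 T := Icc_subset_Icc hα0 hbT
  have hPu : ∀ s ∈ Icc α b, ‖u i s - P s‖ ≤ ρ := fun s hs => by
    rw [h.state_eq i s (hsub hs)]; exact hPe s hs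
  set η : Fin Q.ns → S.FE i := fun k => u i (a + Q.θ k * δ) -
    ∑ l : Fin (Q.ks + 1), Q.D k l • u i (G.node T i (j - (l : ℕ))) with hη
  have hη2 : δ * (∑ k, ‖η k‖) ^ 2 ≤ Q.ns * |K| * (δ ^ (2 * Q.q + 2) * Φ) := by
    have h1 : (∑ k, ‖η k‖) ^ 2 ≤ Q.ns * ∑ k, ‖η k‖ ^ 2 := by
      simpa using sq_sum_le_card_mul_sum_sq (s := (Finset.univ : Finset (Fin Q.ns)))
        (f := fun k => ‖η k‖)
    have h2 : ∫ s in (G.node T i (j - Q.ks))..b, derivSq Q Du i s ≤ Φ :=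
      intervalIntegral.integral_mono_interval (G.node_le_node hT i (by omega))
        (G.node_le_node hT i (by omega)) le_rfl
        (Filter.Eventually.of_forall fun s => derivSq_nonneg i s) hΦi
    have h20 : 0 ≤ ∫ s in (G.node T i (j - Q.ks))..b, derivSq Q Du i s :=
      intervalIntegral.integral_nonneg (G.node_le_node hT i (by omega))
        fun _ _ => derivSq_nonneg _ _
    have h3 : δ * ∑ k, ‖η k‖ ^ 2 ≤ |K| * (δ ^ (2 * Q.q + 2) * Φ) := by
      refine hsc.trans ?_
      rw [mul_assoc]
      exact mul_le_mul (le_abs_self K) (mul_le_mul_of_nonneg_left h2 (pow_nonneg hδ0.le _))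
        (mul_nonneg (pow_nonneg hδ0.le _) h20) (abs_nonneg _)
    calc δ * (∑ k, ‖η k‖) ^ 2 ≤ δ * (Q.ns * ∑ k, ‖η k‖ ^ 2) :=
          mul_le_mul_of_nonneg_left h1 hδ0.le
      _ = Q.ns * (δ * ∑ k, ‖η k‖ ^ 2) := by ring
      _ ≤ Q.ns * (|K| * (δ ^ (2 * Q.q + 2) * Φ)) :=
          mul_le_mul_of_nonneg_left h3 (Nat.cast_nonneg _)
      _ = _ := by ring
  -- Subtracting the discrete side condition from the exact values leaves the consistency error `η
  -- k` and the same combination of side value errors.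
  have hux : ∑ k, ‖u i (a + Q.θ k * δ) - X.u i j (a + Q.θ k * δ)‖ ≤ ∑ k, ‖η k‖ + DD * Y := by
    rw [hDD, Finset.sum_mul, ← Finset.sum_add_distrib]
    refine Finset.sum_le_sum fun k _ => ?_
    have e1 : u i (a + Q.θ k * δ) - X.u i j (a + Q.θ k * δ) =
        η k + ∑ l : Fin (Q.ks + 1), Q.D k l • nodeErr T G u X i (j - (l : ℕ)) := by
      simp only [hside k, hη, nodeErr, smul_sub, Finset.sum_sub_distrib]
      abel
    rw [e1, Finset.sum_mul]
    refine (norm_add_le _ _).trans (add_le_add le_rfl ((norm_sum_le _ _).trans ?_))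
    refine Finset.sum_le_sum fun l _ => ?_
    rw [norm_smul, Real.norm_eq_abs]
    exact mul_le_mul_of_nonneg_left (hY _ (Nat.sub_le _ _)) (abs_nonneg _)
  have key := hC (S.FE i) (X.u i j) (u i) P (residual A T G u F X i) (nodeErr T G u X i (j - 1))
    (nodeErr T G u X i j) a δ ρ (hX.1 i j (Finset.mem_Icc.2 ⟨hj1, hj4⟩)) hP hδ0
  rw [hb] at key
  have hkey := key ((h.continuousOn i).mono ((Icc_subset_Icc_left hαa).trans hsub))
    (intervalIntegrable_of_memLp_Ioc hab hres)
    (fun s hs => hPu s (Icc_subset_Icc_left hαa hs)) (fun k => hPu _ (hθmem k))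
    (fun v hv => by
      rw [herr v hv]
      congr 1
      refine intervalIntegral.integral_congr_ae (Filter.Eventually.of_forall fun s hs => ?_)
      rw [uIoc_of_le hab] at hs
      rw [stateErr_eq hT hj1 hs]) t (Ioc_subset_Icc_self ht)
  rw [stateErr_eq hT hj1 ht]
  set Ξ := ∫ s in a..b, ‖residual A T G u F X i s‖ with hΞ
  have hΞ0 : 0 ≤ Ξ := intervalIntegral.integral_nonneg hab fun _ _ => norm_nonneg _
  set Sη := ∑ k, ‖η k‖ with hSη
  have hSη0 : 0 ≤ Sη := Finset.sum_nonneg fun _ _ => norm_nonneg _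
  have hfin : ‖u i t - X.u i j t‖ ≤ C * ((1 + DD) * Y + Sη + ρ + Ξ) := by
    refine hkey.trans (mul_le_mul_of_nonneg_left ?_ hC0)
    have := hY j le_rfl
    linarith
  have hsq : ((1 + DD) * Y + Sη + ρ + Ξ) ^ 2 ≤
      4 * ((1 + DD) ^ 2 * Y ^ 2 + Sη ^ 2 + ρ ^ 2 + Ξ ^ 2) := by
    rw [← mul_pow]
    exact sq_add_four_le _ _ _ _
  set Ψ := δ ^ (2 * Q.q + 2) * Φ with hΨ
  have hΨ0 : 0 ≤ Ψ := mul_nonneg (pow_nonneg hδ0.le _) hΦ0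
  have hp1 : 0 ≤ Q.ns * |K| := by positivity
  have hp2 : (0 : ℝ) ≤ (J : ℝ) ^ (2 * Q.q + 1) := by positivity
  have hp3 : 0 ≤ δ * Y ^ 2 := by positivity
  have hp4 : 0 ≤ δ * Ξ ^ 2 := by positivity
  have hpoly : ∀ x y z p r s : ℝ, 0 ≤ x → 0 ≤ y → 0 ≤ z → 0 ≤ p → 0 ≤ r → 0 ≤ s →
      x * p + y * r + z * r + s ≤ (x + y + z + 1) * (p + r + s) := by
    intro x y z p r s hx hy hz hp hr hs
    have : 0 ≤ x * (r + s) + (y + z) * (p + s) + p + r := by positivity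
    linarith
  calc δ * ‖u i t - X.u i j t‖ ^ 2
      ≤ δ * (C * ((1 + DD) * Y + Sη + ρ + Ξ)) ^ 2 :=
        mul_le_mul_of_nonneg_left (pow_le_pow_left₀ (norm_nonneg _) hfin 2) hδ0.le
    _ ≤ δ * (C ^ 2 * (4 * ((1 + DD) ^ 2 * Y ^ 2 + Sη ^ 2 + ρ ^ 2 + Ξ ^ 2))) := by
        rw [mul_pow]
        exact mul_le_mul_of_nonneg_left (mul_le_mul_of_nonneg_left hsq (sq_nonneg _)) hδ0.le
    _ = 4 * C ^ 2 * ((1 + DD) ^ 2 * (δ * Y ^ 2) + δ * Sη ^ 2 + δ * ρ ^ 2 + δ * Ξ ^ 2) := by ring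
    _ ≤ 4 * C ^ 2 * ((1 + DD) ^ 2 * (δ * Y ^ 2) + Q.ns * |K| * Ψ +
          (J : ℝ) ^ (2 * Q.q + 1) * Ψ + δ * Ξ ^ 2) := by
        refine mul_le_mul_of_nonneg_left ?_ (by positivity)
        linarith
    _ ≤ 4 * C ^ 2 * (((1 + DD) ^ 2 + Q.ns * |K| + (J : ℝ) ^ (2 * Q.q + 1) + 1) *
          (δ * Y ^ 2 + Ψ + δ * Ξ ^ 2)) := by
        refine mul_le_mul_of_nonneg_left ?_ (by positivity)
        exact hpoly _ _ _ _ _ _ (sq_nonneg _) hp1 hp2 hp3 hΨ0 hp4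
    _ = _ := by ring

/-- The bound at each time is integrated over the substeps and summed. The side value term becomes
`Δt Y²` because the `M i` substeps fill the window, and Cauchy-Schwarz on each substep gives the
factor `Δt_i² ≤ Δt²` of the residual. -/
lemma IsRegular.exists_window_state_bound (h : IsRegular A d T u F Q Du Dz DF)
    {ψ : ℕ → Polynomial ℝ} (hψ : IsOrthogonalBasis Q.q ψ) (hD : (Q.Dtilde ψ).det ≠ 0) (K : ℝ) :
    ∃ (c : ℝ) (J : ℕ), 0 ≤ c ∧ ∀ (N₀ : ℕ) (G : Grid) (X : Discrete S), 1 ≤ N₀ →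
      ReachesBack Q N₀ G → SideConsistent T Q N₀ G u Du K →
      IsMultirateSolution A d T Q N₀ G X → ∀ w ∈ Finset.Icc N₀ G.N, ∀ i, ∀ Y : ℝ, 0 ≤ Y →
      (∀ j ≤ w * G.M i, ‖nodeErr T G u X i j‖ ≤ Y) →
        l2n (G.sync T (w - 1)) (G.sync T w) (stateErr T G u X i) ^ 2 ≤ c * (G.dt T * Y ^ 2 +
          (∑ n ∈ Finset.Icc 1 (G.M i), G.dti T i ^ (2 * Q.q + 2) *
            ∫ s in (G.node T i (G.idx i w n - J))..(G.node T i (G.idx i w n)), derivSq Q Du i s) +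
          G.dt T ^ 2 * l2n (G.sync T (w - 1)) (G.sync T w) (residual A T G u F X i) ^ 2) := by
  obtain ⟨c, J, hc0, hc⟩ := h.exists_state_bound hψ hD K
  refine ⟨c, J, hc0, ?_⟩
  intro N₀ G X hN₀ hRB hSC hX w hw i Y hY0 hY
  have hT := h.pos
  have hw' := Finset.mem_Icc.1 hw
  have hw1 : 1 ≤ w := hN₀.trans hw'.1
  have hwle : G.sync T (w - 1) ≤ G.sync T w := G.sync_le_sync hT (Nat.sub_le _ _)
  have hres := memLp_residual hT h.continuousOn h.flux_memLp' hX hN₀ i hw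
  have hse := h.memLp_stateErr hX i hw'.2
  set δ := G.dti T i with hδ
  have hδ0 : 0 < δ := G.dti_pos hT i
  have hsubs := fun n hn => G.substep_subset_window hT (i := i) (n := n) hw1 hw'.2 hn
  have hle : ∀ n, G.node T i (G.idx i w n - 1) ≤ G.node T i (G.idx i w n) := fun n =>
    G.node_le_node hT i (Nat.sub_le _ _)
  rw [sq_l2n hwle, sq_l2n hwle, ← G.sum_window i hw1, ← G.sum_window i hw1]
  rotate_left
  · exact fun n hn => intervalIntegrable_sq_of_memLp_Ioc (hle n)
      (memLp_Ioc_mono hres (hsubs n hn).1 (hsubs n hn).2)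
  · exact fun n hn => intervalIntegrable_sq_of_memLp_Ioc (hle n)
      (memLp_Ioc_mono hse (hsubs n hn).1 (hsubs n hn).2)
  set R : ℕ → ℝ := fun n => ∫ s in (G.node T i (G.idx i w n - 1))..(G.node T i (G.idx i w n)),
    ‖residual A T G u F X i s‖ ^ 2 with hR
  set σ : ℕ → ℝ := fun n => δ ^ (2 * Q.q + 2) *
    ∫ s in (G.node T i (G.idx i w n - J))..(G.node T i (G.idx i w n)), derivSq Q Du i s with hσ
  have hR0 : ∀ n, 0 ≤ R n := fun n =>
    intervalIntegral.integral_nonneg (hle n) fun _ _ => sq_nonneg _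
  have hstep : ∀ n ∈ Finset.Icc 1 (G.M i),
      ∫ s in (G.node T i (G.idx i w n - 1))..(G.node T i (G.idx i w n)),
        ‖stateErr T G u X i s‖ ^ 2 ≤ c * (δ * Y ^ 2 + σ n + δ ^ 2 * R n) := by
    intro n hn
    obtain ⟨hj1, hj2, -, -⟩ := G.idx_bounds hw1 hw'.2 hn
    have h1 := hc N₀ G X hN₀ hRB hSC hX w hw i n hn Y hY0 fun j hj => hY j (hj.trans hj2)
    have hlen : G.node T i (G.idx i w n) - G.node T i (G.idx i w n - 1) = δ := by
      rw [← G.node_pred_add i hj1]; ring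
    have h2 : (∫ s in (G.node T i (G.idx i w n - 1))..(G.node T i (G.idx i w n)),
        ‖residual A T G u F X i s‖) ^ 2 ≤ δ * R n := by
      have := sq_integral_le (hle n) (memLp_Ioc_mono hres (hsubs n hn).1 (hsubs n hn).2).norm
      rwa [hlen] at this
    have h3 : ∀ t ∈ uIoc (G.node T i (G.idx i w n - 1)) (G.node T i (G.idx i w n)),
        ‖‖stateErr T G u X i t‖ ^ 2‖ ≤ c * (δ * Y ^ 2 + σ n + δ ^ 2 * R n) / δ := by
      intro t ht
      rw [uIoc_of_le (hle n)] at ht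
      rw [Real.norm_of_nonneg (sq_nonneg _), le_div_iff₀ hδ0, mul_comm]
      refine (h1 t ht).trans (mul_le_mul_of_nonneg_left (add_le_add le_rfl ?_) hc0)
      calc _ ≤ δ * (δ * R n) := mul_le_mul_of_nonneg_left h2 hδ0.le
        _ = _ := by ring
    have h4 := intervalIntegral.norm_integral_le_of_norm_le_const h3
    rw [hlen, abs_of_pos hδ0, div_mul_cancel₀ _ hδ0.ne'] at h4
    exact (le_abs_self _).trans h4
  refine (Finset.sum_le_sum hstep).trans ?_
  rw [← Finset.mul_sum, Finset.sum_add_distrib, Finset.sum_add_distrib, Finset.sum_const,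
    Nat.card_Icc, Nat.add_sub_cancel, nsmul_eq_mul, ← mul_assoc, G.M_mul_dti,
    ← Finset.mul_sum _ _ (δ ^ 2)]
  refine mul_le_mul_of_nonneg_left (add_le_add le_rfl ?_) hc0
  exact mul_le_mul_of_nonneg_right (pow_le_pow_left₀ hδ0.le (G.dti_le_dt hT i) 2)
    (Finset.sum_nonneg fun n _ => hR0 n)

/-- The residual is a bounded operator applied to the state and flux errors, and the coupling
conditions bound the flux error on the window by the state errors of both subdomains. -/
lemma IsRegular.exists_residual_bound (h : IsRegular A d T u F Q Du Dz DF) :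
    ∃ C, 0 ≤ C ∧ ∀ (N₀ : ℕ) (G : Grid) (X : Discrete S), 1 ≤ N₀ →
      IsMultirateSolution A d T Q N₀ G X → ∀ w ∈ Finset.Icc N₀ G.N, ∀ i,
        l2n (G.sync T (w - 1)) (G.sync T w) (residual A T G u F X i) ^ 2 ≤
          C * (windowErr T G u X w ^ 2 + windowDefect T G Q Dz DF w ^ 2) := by
  obtain ⟨c, hc1, hc⟩ := exists_norm_residual_le A S
  obtain ⟨C, hC0, hC⟩ := h.exists_window_coupling
  refine ⟨2 * c ^ 2 * (1 + 2 * C ^ 2), by positivity, ?_⟩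
  intro N₀ G X hN₀ hX w hw i
  have hT := h.pos
  have hw' := Finset.mem_Icc.1 hw
  have hwle : G.sync T (w - 1) ≤ G.sync T w := G.sync_le_sync hT (Nat.sub_le _ _)
  have hse := h.memLp_stateErr hX i hw'.2
  have hfe := memLp_fluxErr hT h.flux_memLp' hX hN₀ i hw
  have hres := memLp_residual hT h.continuousOn h.flux_memLp' hX hN₀ i hw
  have h1 : l2n (G.sync T (w - 1)) (G.sync T w) (residual A T G u F X i) ^ 2 ≤
      2 * c ^ 2 * (l2n (G.sync T (w - 1)) (G.sync T w) (stateErr T G u X i) ^ 2 +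
        l2n (G.sync T (w - 1)) (G.sync T w) (fluxErr T G F X i) ^ 2) := by
    rw [sq_l2n hwle, sq_l2n hwle, sq_l2n hwle, ← intervalIntegral.integral_add
      (intervalIntegrable_sq_of_memLp_Ioc hwle hse) (intervalIntegrable_sq_of_memLp_Ioc hwle hfe),
      ← intervalIntegral.integral_const_mul]
    refine intervalIntegral.integral_mono_on hwle (intervalIntegrable_sq_of_memLp_Ioc hwle hres)
      (((intervalIntegrable_sq_of_memLp_Ioc hwle hse).add
        (intervalIntegrable_sq_of_memLp_Ioc hwle hfe)).const_mul _) fun t _ => ?_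
    refine (pow_le_pow_left₀ (norm_nonneg _) (hc T G u F X i t) 2).trans ?_
    rw [mul_pow, mul_comm 2, mul_assoc]
    refine mul_le_mul_of_nonneg_left ?_ (sq_nonneg _)
    nlinarith [sq_nonneg (‖stateErr T G u X i t‖ - ‖fluxErr T G F X i t‖)]
  have h2 : l2n (G.sync T (w - 1)) (G.sync T w) (stateErr T G u X i) ≤ windowErr T G u X w :=
    Finset.single_le_sum (f := fun i => l2n (G.sync T (w - 1)) (G.sync T w) (stateErr T G u X i))
      (fun _ _ => l2n_nonneg _ _ _) (Finset.mem_univ i)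
  have h3 := (hC N₀ G X hN₀ hX w hw).1 i
  have h4 := pow_le_pow_left₀ (l2n_nonneg _ _ (stateErr T G u X i)) h2 2
  have h5 := pow_le_pow_left₀ (l2n_nonneg _ _ (fluxErr T G F X i)) h3 2
  refine h1.trans ?_
  rw [mul_assoc (2 * c ^ 2)]
  refine mul_le_mul_of_nonneg_left ?_ (by positivity)
  rw [mul_pow] at h5
  have h6 : C ^ 2 * (windowErr T G u X w + windowDefect T G Q Dz DF w) ^ 2 ≤
      C ^ 2 * (2 * (windowErr T G u X w ^ 2 + windowDefect T G Q Dz DF w ^ 2)) :=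
    mul_le_mul_of_nonneg_left add_sq_le (sq_nonneg _)
  have := sq_nonneg (windowDefect T G Q Dz DF w)
  linarith

/-- The error equation is tested with the increment itself, constant in time; constants are
admissible for every `ns`. -/
lemma IsRegular.norm_nodeErr_sub_le (h : IsRegular A d T u F Q Du Dz DF) {N₀ : ℕ} {G : Grid}
    {X : Discrete S} (hN₀ : 1 ≤ N₀) (hX : IsMultirateSolution A d T Q N₀ G X) {w : ℕ}
    (hw : w ∈ Finset.Icc N₀ G.N) {i : Fin 2} {n : ℕ} (hn : n ∈ Finset.Icc 1 (G.M i)) :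
    ‖nodeErr T G u X i (G.idx i w n) - nodeErr T G u X i (G.idx i w n - 1)‖ ≤
      ∫ s in (G.node T i (G.idx i w n - 1))..(G.node T i (G.idx i w n)),
        ‖residual A T G u F X i s‖ := by
  have hT := h.pos
  have hw' := Finset.mem_Icc.1 hw
  obtain ⟨hs1, hs2⟩ := G.substep_subset_window hT (hN₀.trans hw'.1) hw'.2 hn
  have hle : G.node T i (G.idx i w n - 1) ≤ G.node T i (G.idx i w n) :=
    G.node_le_node hT i (Nat.sub_le _ _)
  have hres := intervalIntegrable_of_memLp_Ioc hle
    (memLp_Ioc_mono (memLp_residual hT h.continuousOn h.flux_memLp' hX hN₀ i hw) hs1 hs2)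
  set φ := nodeErr T G u X i (G.idx i w n) - nodeErr T G u X i (G.idx i w n - 1) with hφ
  have h1 := substep_error_eq hT h.semi h.flux_memLp' hX hN₀ hw hn (isTimePoly_const _ φ)
  simp only [deriv_const, inner_zero_right, intervalIntegral.integral_zero, zero_sub] at h1
  rw [← inner_sub_left, ← hφ, real_inner_self_eq_norm_sq] at h1
  have h2 : ‖φ‖ ^ 2 ≤ (∫ s in (G.node T i (G.idx i w n - 1))..(G.node T i (G.idx i w n)),
      ‖residual A T G u F X i s‖) * ‖φ‖ := by
    rw [h1, ← intervalIntegral.integral_mul_const]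
    refine (neg_le_abs _).trans ((intervalIntegral.abs_integral_le_integral_abs hle).trans ?_)
    refine intervalIntegral.integral_mono_on hle ?_ (hres.norm.mul_const _)
      fun s _ => abs_real_inner_le_norm _ _
    have h3 : IntervalIntegrable (fun s => (inner ℝ (residual A T G u F X i s) φ : ℝ)) volume
        (G.node T i (G.idx i w n - 1)) (G.node T i (G.idx i w n)) :=
      ⟨hres.1.inner_const φ, hres.2.inner_const φ⟩
    exact h3.abs
  rcases (norm_nonneg φ).eq_or_lt with h3 | h3
  · rw [← h3]; exact intervalIntegral.integral_nonneg hle fun _ _ => norm_nonneg _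
  · rw [sq] at h2; exact le_of_mul_le_mul_right h2 h3

/-- The bound covers all nodes up to the end of the window, because the side conditions reach back
to earlier side values. -/
lemma IsRegular.norm_nodeErr_le_of_window (h : IsRegular A d T u F Q Du Dz DF) {N₀ : ℕ} {G : Grid}
    {X : Discrete S} (hN₀ : 1 ≤ N₀) (hX : IsMultirateSolution A d T Q N₀ G X) {w : ℕ}
    (hw : w ∈ Finset.Icc N₀ G.N) {i : Fin 2} {Y : ℝ}
    (hY : ∀ j ≤ (w - 1) * G.M i, ‖nodeErr T G u X i j‖ ≤ Y) {j : ℕ} (hj : j ≤ w * G.M i) :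
    ‖nodeErr T G u X i j‖ ≤ Y + ∫ s in (G.sync T (w - 1))..(G.sync T w),
      ‖residual A T G u F X i s‖ := by
  have hT := h.pos
  have hw' := Finset.mem_Icc.1 hw
  have hw1 := hN₀.trans hw'.1
  have hwle : G.sync T (w - 1) ≤ G.sync T w := G.sync_le_sync hT (Nat.sub_le _ _)
  have hres := intervalIntegrable_of_memLp_Ioc hwle
    (memLp_residual hT h.continuousOn h.flux_memLp' hX hN₀ i hw)
  rcases le_or_gt j ((w - 1) * G.M i) with h1 | h1
  · have := intervalIntegral.integral_nonneg (μ := volume) hwle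
      fun s _ => norm_nonneg (residual A T G u F X i s)
    linarith [hY j h1]
  have hM : w * G.M i = (w - 1) * G.M i + G.M i := by
    obtain ⟨v, rfl⟩ : ∃ v, w = v + 1 := ⟨w - 1, by omega⟩
    rw [Nat.add_sub_cancel]; ring
  have hn : ∀ n, n ≤ G.M i → ‖nodeErr T G u X i ((w - 1) * G.M i + n)‖ ≤
      Y + ∫ s in (G.sync T (w - 1))..(G.node T i ((w - 1) * G.M i + n)),
        ‖residual A T G u F X i s‖ := by
    intro n
    induction n with
    | zero =>
      intro _
      rw [add_zero, G.node_mul, intervalIntegral.integral_same, add_zero]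
      exact hY _ le_rfl
    | succ n ih =>
      intro hn
      have h2 := ih (by omega)
      have hmem : n + 1 ∈ Finset.Icc 1 (G.M i) := Finset.mem_Icc.2 ⟨by omega, hn⟩
      have h3 := h.norm_nodeErr_sub_le hN₀ hX hw hmem
      have e1 : G.idx i w (n + 1) - 1 = (w - 1) * G.M i + n := rfl
      have e2 : G.idx i w (n + 1) = (w - 1) * G.M i + (n + 1) := rfl
      have hn1 : G.sync T (w - 1) ≤ G.node T i ((w - 1) * G.M i + n) := by
        rw [← G.node_mul i]; exact G.node_le_node hT i (by omega)
      have hn2 : G.node T i ((w - 1) * G.M i + n) ≤ G.node T i ((w - 1) * G.M i + (n + 1)) :=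
        G.node_le_node hT i (by omega)
      have hn3 : G.node T i ((w - 1) * G.M i + (n + 1)) ≤ G.sync T w := by
        rw [← G.node_mul i]; exact G.node_le_node hT i (by omega)
      rw [e1, e2] at h3
      rw [← intervalIntegral.integral_add_adjacent_intervals
        (b := G.node T i ((w - 1) * G.M i + n))
        (hres.norm.mono_set (by
          rw [uIcc_of_le hn1, uIcc_of_le hwle]
          exact Icc_subset_Icc le_rfl (hn2.trans hn3)))
        (hres.norm.mono_set (by
          rw [uIcc_of_le hn2, uIcc_of_le hwle]
          exact Icc_subset_Icc hn1 hn3))]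
      have h4 := norm_le_norm_add_norm_sub' (nodeErr T G u X i ((w - 1) * G.M i + (n + 1)))
        (nodeErr T G u X i ((w - 1) * G.M i + n))
      linarith
  obtain ⟨n, rfl⟩ : ∃ n, j = (w - 1) * G.M i + n := ⟨j - (w - 1) * G.M i, by omega⟩
  refine (hn n (by omega)).trans (add_le_add le_rfl ?_)
  refine intervalIntegral.integral_mono_interval le_rfl ?_ ?_
    (Filter.Eventually.of_forall fun _ => norm_nonneg _) hres.norm
  · rw [← G.node_mul i]; exact G.node_le_node hT i (by omega)
  · rw [← G.node_mul i]; exact G.node_le_node hT i hj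

/-- The error of the states in `L²`, in terms of the error of the initial data. -/
lemma IsRegular.exists_global_estimate (h : IsRegular A d T u F Q Du Dz DF)
    {ψ : ℕ → Polynomial ℝ} (hψ : IsOrthogonalBasis Q.q ψ) (hD : (Q.Dtilde ψ).det ≠ 0) (K : ℝ) :
    ∃ δ > 0, ∃ C, 0 ≤ C ∧ ∀ (N₀ : ℕ) (G : Grid) (X : Discrete S) (a₀ : ℝ), 1 ≤ N₀ →
      G.dt T ≤ δ → ReachesBack Q N₀ G → SideConsistent T Q N₀ G u Du K →
      IsMultirateSolution A d T Q N₀ G X → 0 ≤ a₀ →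
      (∀ i, ∀ j ≤ (N₀ - 1) * G.M i, ‖nodeErr T G u X i j‖ ≤ a₀) →
      ∑ w ∈ Finset.Icc N₀ G.N, (windowErr T G u X w ^ 2 + windowDefect T G Q Dz DF w ^ 2) ≤
        C * (a₀ ^ 2 + G.dt T ^ (2 * Q.q + 2) + windowRate Q (G.dt T) ^ 2) := by
  obtain ⟨c₁, J, hc₁, hstate⟩ := h.exists_window_state_bound hψ hD K
  obtain ⟨c₂, hc₂, hres⟩ := h.exists_residual_bound
  obtain ⟨c₃, hc₃, hdef⟩ := h.sum_sq_windowDefect_le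
  have hT := h.pos
  -- One constant for all inequalities of the Gronwall argument: `4 c₁ (1 + c₂)` for the state
  -- errors, `4 c₂` for the integrals of the residual.
  set c : ℝ := 1 + 4 * c₁ * (1 + c₂) + 4 * c₂ with hc
  have hc1 : 1 ≤ c := by
    have : 0 ≤ 4 * c₁ * (1 + c₂) := by positivity
    linarith
  obtain ⟨δ, hδ, C, hC0, hC⟩ := gronwall_windows hc1 hT
  set I : ℝ := ∑ i, ∫ t in (0 : ℝ)..T, derivSq Q Du i t with hI
  have hIi : ∀ i, 0 ≤ ∫ t in (0 : ℝ)..T, derivSq Q Du i t := fun i =>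
    intervalIntegral.integral_nonneg hT.le fun _ _ => derivSq_nonneg _ _
  have hI0 : 0 ≤ I := Finset.sum_nonneg fun i _ => hIi i
  refine ⟨δ, hδ, C * (1 + J * I + c₃) + c₃, by positivity, ?_⟩
  intro N₀ G X a₀ hN₀ hdt hRB hSC hX ha₀ ha
  have hdt0 := G.dt_pos hT
  set ε := windowErr T G u X with hε
  set γ := windowDefect T G Q Dz DF with hγ
  have hε0 : ∀ w, 0 ≤ ε w := fun w => windowErr_nonneg w
  set σ : Fin 2 → ℕ → ℝ := fun i w => ∑ n ∈ Finset.Icc 1 (G.M i), G.dti T i ^ (2 * Q.q + 2) *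
    ∫ s in (G.node T i (G.idx i w n - J))..(G.node T i (G.idx i w n)), derivSq Q Du i s with hσ
  have hσ1 : ∀ i j, 0 ≤ G.dti T i ^ (2 * Q.q + 2) *
      ∫ s in (G.node T i (j - J))..(G.node T i j), derivSq Q Du i s := fun i j =>
    mul_nonneg (pow_nonneg (G.dti_pos hT i).le _) (intervalIntegral.integral_nonneg
      (G.node_le_node hT i (Nat.sub_le _ _)) fun _ _ => derivSq_nonneg _ _)
  have hσ0 : ∀ i w, 0 ≤ σ i w := fun i w => Finset.sum_nonneg fun n _ => hσ1 i _
  -- All data terms of a window in one number: consistency and approximation in time on the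
  -- substeps, and the defect of traces and fluxes.
  set s : ℕ → ℝ := fun w => √(∑ i, σ i w + γ w ^ 2) with hs
  have hs2 : ∀ w, s w ^ 2 = ∑ i, σ i w + γ w ^ 2 := fun w => Real.sq_sqrt
    (add_nonneg (Finset.sum_nonneg fun i _ => hσ0 i w) (sq_nonneg _))
  set ξ : Fin 2 → ℕ → ℝ := fun i w => ∫ t in (G.sync T (w - 1))..(G.sync T w),
    ‖residual A T G u F X i t‖ with hξ
  have hwle : ∀ w, G.sync T (w - 1) ≤ G.sync T w := fun w =>
    G.sync_le_sync hT (Nat.sub_le _ _)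
  have hξ0 : ∀ i w, 0 ≤ ξ i w := fun i w =>
    intervalIntegral.integral_nonneg (hwle w) fun _ _ => norm_nonneg _
  set x : ℕ → ℝ := fun w => ∑ i, ξ i w with hx
  have hx0 : ∀ w, 0 ≤ x w := fun w => Finset.sum_nonneg fun i _ => hξ0 i w
  -- Starts from the bound `a₀` for the given data and collects the residuals of the windows; by
  -- induction it dominates all side value errors up to window `w`.
  set Y : ℕ → ℝ := fun w => a₀ + c * ∑ k ∈ Finset.Ico N₀ (w + 1), x k with hYdef
  have hY00 : Y (N₀ - 1) = a₀ := by
    simp only [hYdef, Nat.sub_add_cancel hN₀, Finset.Ico_self, Finset.sum_empty, mul_zero,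
      add_zero]
  have hYsucc : ∀ w, N₀ ≤ w → Y w = Y (w - 1) + c * x w := by
    intro w hw
    simp only [hYdef]
    rw [Finset.sum_Ico_succ_top hw, Nat.sub_add_cancel (hN₀.trans hw)]
    ring
  have hYpos : ∀ w, 0 ≤ Y w := fun w => add_nonneg ha₀ (mul_nonneg (by linarith)
    (Finset.sum_nonneg fun k _ => hx0 k))
  have hnode : ∀ k, N₀ - 1 + k ≤ G.N → ∀ i, ∀ j ≤ (N₀ - 1 + k) * G.M i,
      ‖nodeErr T G u X i j‖ ≤ Y (N₀ - 1 + k) := by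
    intro k
    induction k with
    | zero => intro _ i j hj; rw [add_zero, hY00]; exact ha i j hj
    | succ k ih =>
      intro hk i j hj
      have hmem : N₀ - 1 + (k + 1) ∈ Finset.Icc N₀ G.N := Finset.mem_Icc.2 ⟨by omega, hk⟩
      have h1 := h.norm_nodeErr_le_of_window hN₀ hX hmem (i := i) (ih (by omega) i) hj
      rw [hYsucc _ (by omega)]
      refine h1.trans (add_le_add le_rfl ?_)
      have h2 : ξ i (N₀ - 1 + (k + 1)) ≤ x (N₀ - 1 + (k + 1)) :=
        Finset.single_le_sum (f := fun i => ξ i (N₀ - 1 + (k + 1))) (fun i _ => hξ0 i _)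
          (Finset.mem_univ i)
      exact h2.trans (le_mul_of_one_le_left (hx0 _) hc1)
  have hγs : ∀ w, γ w ^ 2 ≤ s w ^ 2 := fun w => by
    rw [hs2]; linarith [Finset.sum_nonneg fun i (_ : i ∈ Finset.univ) => hσ0 i w]
  have hr : ∀ w ∈ Finset.Icc N₀ G.N, ∀ i,
      l2n (G.sync T (w - 1)) (G.sync T w) (residual A T G u F X i) ^ 2 ≤
        c₂ * (ε w ^ 2 + s w ^ 2) := fun w hw i =>
    (hres N₀ G X hN₀ hX w hw i).trans (mul_le_mul_of_nonneg_left
      (add_le_add le_rfl (hγs w)) hc₂)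
  have hmain := hC N₀ G.N (G.dt T) ε s x Y hN₀ hdt0 hdt G.N_mul_dt.le hε0
    (fun w => Real.sqrt_nonneg _) hx0 (hYpos _) (fun w hw => hYsucc w (Finset.mem_Icc.1 hw).1)
    (fun w hw => ?_) (fun w hw => ?_)
  rotate_left
  · obtain ⟨hw1, hw2⟩ := Finset.mem_Icc.1 hw
    have h1 : ∀ i, l2n (G.sync T (w - 1)) (G.sync T w) (stateErr T G u X i) ^ 2 ≤
        c₁ * (G.dt T * Y w ^ 2 + σ i w + G.dt T ^ 2 * (c₂ * (ε w ^ 2 + s w ^ 2))) := fun i => by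
      have h2 := hnode (w - (N₀ - 1)) (by omega) i
      rw [show N₀ - 1 + (w - (N₀ - 1)) = w by omega] at h2
      refine (hstate N₀ G X hN₀ hRB hSC hX w hw i (Y w) (hYpos w) h2).trans ?_
      exact mul_le_mul_of_nonneg_left (add_le_add le_rfl (mul_le_mul_of_nonneg_left (hr w hw i)
        (sq_nonneg _))) hc₁
    have h3 : ε w ^ 2 ≤ 2 * ∑ i, l2n (G.sync T (w - 1)) (G.sync T w) (stateErr T G u X i) ^ 2 := by
      rw [hε, windowErr, Fin.sum_univ_two, Fin.sum_univ_two]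
      exact add_sq_le
    have h4 : ∑ i, l2n (G.sync T (w - 1)) (G.sync T w) (stateErr T G u X i) ^ 2 ≤
        c₁ * (2 * (G.dt T * Y w ^ 2) + s w ^ 2 +
          2 * (G.dt T ^ 2 * (c₂ * (ε w ^ 2 + s w ^ 2)))) := by
      refine (Finset.sum_le_sum fun i _ => h1 i).trans ?_
      rw [← Finset.mul_sum]
      refine mul_le_mul_of_nonneg_left ?_ hc₁
      rw [hs2, Fin.sum_univ_two, Fin.sum_univ_two]
      linarith [sq_nonneg (γ w)]
    have p1 : 0 ≤ G.dt T * Y w ^ 2 := by positivity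
    have p2 : 0 ≤ s w ^ 2 := sq_nonneg _
    have p3 : 0 ≤ G.dt T ^ 2 * (ε w ^ 2 + s w ^ 2) := by positivity
    have e1 : G.dt T ^ 2 * (c₂ * (ε w ^ 2 + s w ^ 2)) =
        c₂ * (G.dt T ^ 2 * (ε w ^ 2 + s w ^ 2)) := by ring
    rw [e1] at h4
    generalize G.dt T * Y w ^ 2 = p at *
    generalize G.dt T ^ 2 * (ε w ^ 2 + s w ^ 2) = r at *
    generalize s w ^ 2 = t at *
    have q1 := mul_nonneg hc₁ p1
    have q2 := mul_nonneg hc₁ p2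
    have q3 := mul_nonneg hc₁ p3
    have q4 := mul_nonneg hc₂ p1
    have q5 := mul_nonneg hc₂ p2
    have q6 := mul_nonneg hc₂ p3
    have q7 := mul_nonneg hc₂ q1
    have q8 := mul_nonneg hc₂ q2
    have q9 := mul_nonneg hc₂ q3
    rw [hc]
    calc ε w ^ 2 ≤ 2 * (c₁ * (2 * p + t + 2 * (c₂ * r))) := by linarith
      _ ≤ _ := by ring_nf; ring_nf at q7 q8 q9; linarith
  · have hx2 : x w ^ 2 ≤ 2 * ∑ i, ξ i w ^ 2 := by
      simp only [hx, Fin.sum_univ_two]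
      exact add_sq_le
    have hξ2 : ∀ i, ξ i w ^ 2 ≤ G.dt T * (c₂ * (ε w ^ 2 + s w ^ 2)) := fun i => by
      have h1 := sq_integral_le (hwle w)
        (memLp_residual hT h.continuousOn h.flux_memLp' hX hN₀ i hw).norm
      have h2 : G.sync T w - G.sync T (w - 1) = G.dt T := by
        rw [← G.sync_pred_add (hN₀.trans (Finset.mem_Icc.1 hw).1)]; ring
      rw [h2] at h1
      refine h1.trans (mul_le_mul_of_nonneg_left ?_ hdt0.le)
      rw [← sq_l2n (hwle w)]
      exact hr w hw i
    rw [Fin.sum_univ_two] at hx2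
    have h3 : 4 * c₂ ≤ c := by
      have : 0 ≤ 4 * c₁ * (1 + c₂) := by positivity
      linarith
    calc x w ^ 2 ≤ 4 * c₂ * (G.dt T * (ε w ^ 2 + s w ^ 2)) := by linarith [hξ2 0, hξ2 1]
      _ ≤ c * (G.dt T * (ε w ^ 2 + s w ^ 2)) := mul_le_mul_of_nonneg_right h3 (by positivity)
      _ = _ := by ring
  rw [hY00] at hmain
  -- The intervals of `J` substeps overlap at most `J` times, so the consistency terms sum to
  -- `Δt^{2q+2}` times a norm of the exact solution.
  have hσsum : ∀ i, ∑ w ∈ Finset.Icc N₀ G.N, σ i w ≤ G.dt T ^ (2 * Q.q + 2) *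
      (J * ∫ t in (0 : ℝ)..T, derivSq Q Du i t) := fun i => by
    refine (G.sum_windows_le i (hσ1 i) hN₀).trans ?_
    rw [← Finset.mul_sum]
    refine mul_le_mul (pow_le_pow_left₀ (G.dti_pos hT i).le (G.dti_le_dt hT i) _)
      (G.sum_overlap_le hT i J (derivSq_nonneg i) (h.intervalIntegrable_derivSq i))
      (Finset.sum_nonneg fun j _ => intervalIntegral.integral_nonneg
        (G.node_le_node hT i (Nat.sub_le _ _)) fun _ _ => derivSq_nonneg _ _)
      (pow_nonneg hdt0.le _)
  have hssum : ∑ w ∈ Finset.Icc N₀ G.N, s w ^ 2 ≤ G.dt T ^ (2 * Q.q + 2) * (J * I) +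
      c₃ * windowRate Q (G.dt T) ^ 2 := by
    simp only [hs2]
    rw [Finset.sum_add_distrib, Finset.sum_comm]
    refine add_le_add ((Finset.sum_le_sum fun i _ => hσsum i).trans_eq ?_) (hdef G N₀ hN₀)
    rw [← Finset.mul_sum, ← Finset.mul_sum]
  rw [Finset.sum_add_distrib]
  have p1 : 0 ≤ G.dt T ^ (2 * Q.q + 2) := pow_nonneg hdt0.le _
  have p2 := sq_nonneg (windowRate Q (G.dt T))
  have p3 := sq_nonneg a₀
  have p4 : 0 ≤ (J : ℝ) * I := by positivity
  refine (add_le_add (hmain.trans (mul_le_mul_of_nonneg_left (add_le_add le_rfl hssum) hC0))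
    (hdef G N₀ hN₀)).trans ?_
  generalize (J : ℝ) * I = JI at *
  generalize G.dt T ^ (2 * Q.q + 2) = p at *
  generalize windowRate Q (G.dt T) ^ 2 = r at *
  generalize a₀ ^ 2 = a at *
  have : C * (a + (p * JI + c₃ * r)) + c₃ * r ≤ C * ((1 + JI + c₃) * (a + p + r)) +
      c₃ * (a + p + r) := by
    refine add_le_add (mul_le_mul_of_nonneg_left ?_ hC0)
      (mul_le_mul_of_nonneg_left (by linarith) hc₃)
    have := mul_nonneg p4 p3
    have := mul_nonneg p4 p2
    have := mul_nonneg hc₃ p3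
    have := mul_nonneg hc₃ p1
    linarith
  refine this.trans_eq ?_
  ring

end Global

/-! ### Approximation of smooth functions of time -/

section Smooth

variable {V : Type*} [NormedAddCommGroup V] [InnerProductSpace ℝ V]

/-- `D a` is the `a`-th derivative of the smooth function `D 0`. -/
def IsSmoothChain (D : ℕ → ℝ → V) : Prop := ∀ a t, HasDerivAt (D a) (D (a + 1) t) t

lemma IsSmoothChain.continuous {D : ℕ → ℝ → V} (h : IsSmoothChain D) (a : ℕ) :
    Continuous (D a) :=
  continuous_iff_continuousAt.2 fun t => (h a t).continuousAt

lemma IsSmoothChain.map {W : Type*} [NormedAddCommGroup W] [InnerProductSpace ℝ W]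
    {D : ℕ → ℝ → V} (h : IsSmoothChain D) (f : V →L[ℝ] W) :
    IsSmoothChain (fun a t => f (D a t)) :=
  fun a t => f.hasFDerivAt.comp_hasDerivAt t (h a t)

lemma IsSmoothChain.contDiff {D : ℕ → ℝ → V} (h : IsSmoothChain D) (n a : ℕ) :
    ContDiff ℝ n (D a) := by
  induction n generalizing a with
  | zero => exact contDiff_zero.2 (h.continuous a)
  | succ n ih =>
    push_cast
    refine contDiff_succ_iff_deriv.2 ⟨fun t => (h a t).differentiableAt, fun hn => ?_, ?_⟩
    · exact absurd hn (by simp)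
    · rw [show deriv (D a) = D (a + 1) from funext fun t => (h a t).deriv]
      exact ih (a + 1)

lemma IsSmoothChain.isDerivChain [FiniteDimensional ℝ V] {D : ℕ → ℝ → V} (h : IsSmoothChain D)
    (k : ℕ) (T : ℝ) : IsDerivChain k T D := fun m _ =>
  ⟨(h.continuous _).intervalIntegrable _ _, fun a _ t _ => by
    rw [intervalIntegral.integral_eq_sub_of_hasDerivAt (fun s _ => h m s)
      ((h.continuous _).intervalIntegrable _ _), add_sub_cancel]⟩

lemma IsSmoothChain.eqOn_iteratedDerivWithin {D : ℕ → ℝ → V} (h : IsSmoothChain D) {T : ℝ}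
    (hT : 0 < T) {w : ℝ → V} (hw : EqOn w (D 0) (Icc 0 T)) (a : ℕ) :
    EqOn (iteratedDerivWithin a w (Icc 0 T)) (D a) (Icc 0 T) := by
  induction a with
  | zero => rwa [iteratedDerivWithin_zero]
  | succ a ih =>
    intro t ht
    rw [iteratedDerivWithin_succ, derivWithin_congr ih (ih ht)]
    exact (h a t).hasDerivWithinAt.derivWithin (uniqueDiffOn_Icc hT t ht)

/-- Approximate the derivative by a polynomial of degree `s`, integrate from `a`, and correct by a
linear function to match the value at `b`. The slope of the correction is no larger than the error
of the derivative, so the order is kept for the function and its derivative. -/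
lemma IsSmoothChain.exists_interpolant [FiniteDimensional ℝ V] {D : ℕ → ℝ → V}
    (h : IsSmoothChain D) (s : ℕ) {a b E : ℝ} (ha : 0 ≤ a) (hab : a < b)
    (hE : ∀ t ∈ Icc a b, ‖D (s + 2) t‖ ≤ E) :
    ∃ P : ℝ → V, IsTimePoly (s + 1) P ∧ P a = D 0 a ∧ P b = D 0 b ∧ ∀ t ∈ Icc a b,
      ‖D 0 t - P t‖ ≤ 2 * ((b - a) * ((b - a) ^ (s + 1) * E)) ∧
      ‖D 1 t - deriv P t‖ ≤ 2 * ((b - a) ^ (s + 1) * E) := by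
  have hba : 0 < b - a := sub_pos.2 hab
  obtain ⟨p, hp, hpe⟩ := (h.isDerivChain (s + 2) b).tail.exists_timePoly_approx s ha hab.le le_rfl
  set ε := (b - a) ^ (s + 1) * E with hε
  have h1 : ∀ t ∈ Icc a b, ‖D 1 t - p t‖ ≤ ε := fun t ht => by
    refine (hpe t ht).trans ?_
    rw [hε, pow_succ, mul_assoc]
    refine mul_le_mul_of_nonneg_left ?_ (pow_nonneg hba.le _)
    have h2 := intervalIntegral.norm_integral_le_of_norm_le_const (a := a) (b := b)
      (f := fun t => ‖D (s + 2) t‖) (C := E) (fun t ht => by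
        rw [uIoc_of_le hab.le] at ht
        rw [norm_norm]
        exact hE t (Ioc_subset_Icc_self ht))
    rw [abs_of_pos hba] at h2
    exact (le_abs_self _).trans (h2.trans_eq (mul_comm _ _))
  have hε0 : 0 ≤ ε := (norm_nonneg _).trans (h1 a (left_mem_Icc.2 hab.le))
  obtain ⟨R, hR, hRa, hRd⟩ := hp.exists_antideriv a (D 0 a)
  have h2 : ∀ t ∈ Icc a b, ‖D 0 t - R t‖ ≤ (b - a) * ε := fun t ht =>
    (h.isDerivChain (s + 2) b).norm_sub_le_of_deriv ha hab.le le_rfl hRd hp.continuous hRa h1 ht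
  set κ := (b - a)⁻¹ • (D 0 b - R b) with hκ
  have hκn : ‖κ‖ ≤ ε := by
    rw [hκ, norm_smul, Real.norm_of_nonneg (inv_nonneg.2 hba.le), inv_mul_le_iff₀ hba]
    exact h2 b (right_mem_Icc.2 hab.le)
  have hlin : IsTimePoly (s + 1) (fun t => (-a + 1 * t) ^ 1 • κ) :=
    isTimePoly_affine_pow_smul (by omega) _ _ _
  refine ⟨fun t => R t + (-a + 1 * t) ^ 1 • κ, hR.add hlin, by simp [hRa], ?_, fun t ht => ⟨?_, ?_⟩⟩
  · have : -a + 1 * b = b - a := by ring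
    simp only [this, pow_one, hκ]
    rw [smul_inv_smul₀ hba.ne', add_sub_cancel]
  · rw [← sub_sub]
    refine (norm_sub_le _ _).trans ?_
    have h3 : ‖(-a + 1 * t) ^ 1 • κ‖ ≤ (b - a) * ε := by
      rw [norm_smul, pow_one, Real.norm_of_nonneg (by linarith [ht.1])]
      exact mul_le_mul (by linarith [ht.2]) hκn (norm_nonneg _) hba.le
    linarith [h2 t ht]
  · have h3 : HasDerivAt (fun t : ℝ => R t + (-a + 1 * t) ^ 1 • κ) (p t + κ) t := by
      refine (hRd t).add ?_
      have := (((hasDerivAt_id t).const_mul 1).const_add (-a)).smul_const κ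
      simpa using this
    rw [h3.deriv, ← sub_sub]
    refine (norm_sub_le _ _).trans ?_
    linarith [h1 t ht]

/-- The constant in the bounds for the interpolants. -/
def interpConst (c : ℕ → ℝ) (T : ℝ) (s : ℕ) : ℝ := 2 * (T + 1) * c (s + 1) + 2 * c 0 + c 1

lemma interpConst_nonneg {c : ℕ → ℝ} (hc : ∀ a, 0 ≤ c a) {T : ℝ} (hT : 0 < T) (s : ℕ) :
    0 ≤ interpConst c T s := by
  have := hc 0
  have := hc 1
  have := hc (s + 1)
  unfold interpConst
  positivity

variable (G : Grid) {T : ℝ} (hT : 0 < T) (i : Fin 2)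

-- Neighbouring pieces share the nodal values `y`, which makes the interpolant continuous and lets
-- the error equations telescope. The index `l` marks the node at which the value is exact even for
-- degree zero.
include hT in
lemma IsSmoothChain.exists_interpolants [FiniteDimensional ℝ V] {D : ℕ → ℝ → V}
    (h : IsSmoothChain D) {c : ℕ → ℝ} (hc : ∀ a, 0 ≤ c a) {E : ℝ} (hE : 0 ≤ E)
    (hb : ∀ a, ∀ t ∈ Icc 0 T, ‖D a t‖ ≤ c a * E) (s : ℕ) {l : ℕ} (hl : l ≤ G.N * G.M i) :
    ∃ (P : ℕ → ℝ → V) (y : ℕ → V),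
      (∀ j ∈ Finset.Icc 1 (G.N * G.M i), IsTimePoly s (P j) ∧ P j (G.node T i (j - 1)) = y (j - 1) ∧
        P j (G.node T i j) = y j ∧ ∀ t ∈ Icc (G.node T i (j - 1)) (G.node T i j),
          ‖D 0 t - P j t‖ ≤ interpConst c T s * G.dt T ^ s * E ∧
          ‖D 1 t - deriv (P j) t‖ ≤ interpConst c T s * G.dt T ^ s * E) ∧
      y l = D 0 (G.node T i l) ∧ (1 ≤ s → ∀ j ≤ G.N * G.M i, y j = D 0 (G.node T i j)) ∧
      ∀ j ≤ G.N * G.M i, ‖y j‖ ≤ c 0 * E := by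
  have hmem : ∀ j ≤ G.N * G.M i, G.node T i j ∈ Icc 0 T := fun j hj =>
    ⟨G.node_nonneg hT i j, G.node_le hT i hj⟩
  have hsub : ∀ j ∈ Finset.Icc 1 (G.N * G.M i),
      Icc (G.node T i (j - 1)) (G.node T i j) ⊆ Icc 0 T := fun j hj =>
    Icc_subset_Icc (G.node_nonneg hT i _) (G.node_le hT i (Finset.mem_Icc.1 hj).2)
  have hc0 := hc 0
  have hc1 := hc 1
  have hcs := hc (s + 1)
  rcases s with _ | s
  -- A continuous piecewise constant function is constant, so it can match only one node; no power
  -- of `Δt` is claimed in this case.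
  · refine ⟨fun _ _ => D 0 (G.node T i l), fun _ => D 0 (G.node T i l), fun j hj =>
      ⟨isTimePoly_const _ _, rfl, rfl, fun t ht => ⟨?_, ?_⟩⟩, rfl, by simp,
      fun j _ => hb 0 _ (hmem l hl)⟩
    · refine (norm_sub_le _ _).trans ((add_le_add (hb 0 t (hsub j hj ht))
        (hb 0 _ (hmem l hl))).trans ?_)
      rw [pow_zero, mul_one, ← add_mul]
      refine mul_le_mul_of_nonneg_right ?_ hE
      have : 0 ≤ 2 * (T + 1) * c (0 + 1) := by positivity
      unfold interpConst
      linarith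
    · rw [deriv_const, sub_zero, pow_zero, mul_one]
      refine (hb 1 t (hsub j hj ht)).trans (mul_le_mul_of_nonneg_right ?_ hE)
      have : 0 ≤ 2 * (T + 1) * c (0 + 1) := by positivity
      unfold interpConst
      linarith
  · have hδ := G.dti_pos hT i
    have hlen : ∀ j ∈ Finset.Icc 1 (G.N * G.M i),
        G.node T i j - G.node T i (j - 1) = G.dti T i := fun j hj => by
      rw [← G.node_pred_add i (Finset.mem_Icc.1 hj).1]; ring
    have hex : ∀ j, ∃ P : ℝ → V, j ∈ Finset.Icc 1 (G.N * G.M i) →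
        IsTimePoly (s + 1) P ∧ P (G.node T i (j - 1)) = D 0 (G.node T i (j - 1)) ∧
        P (G.node T i j) = D 0 (G.node T i j) ∧
        ∀ t ∈ Icc (G.node T i (j - 1)) (G.node T i j),
          ‖D 0 t - P t‖ ≤ interpConst c T (s + 1) * G.dt T ^ (s + 1) * E ∧
          ‖D 1 t - deriv P t‖ ≤ interpConst c T (s + 1) * G.dt T ^ (s + 1) * E := by
      intro j
      by_cases hj : j ∈ Finset.Icc 1 (G.N * G.M i)
      swap
      · exact ⟨fun _ => 0, fun h => absurd h hj⟩
      obtain ⟨P, hP, hPa, hPb, hPe⟩ := h.exists_interpolant s (G.node_nonneg hT i (j - 1))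
        (sub_pos.1 ((hlen j hj).symm ▸ hδ)) fun t ht => hb (s + 2) t (hsub j hj ht)
      rw [hlen j hj] at hPe
      have hdT : G.dti T i ≤ T := (G.dti_le_dt hT i).trans (by
        have h1 := G.sync_le hT (w := 1) G.N_pos
        rwa [Grid.sync, Nat.cast_one, one_mul] at h1)
      set e := G.dti T i ^ (s + 1) * (c (s + 2) * E) with he
      have he0 : 0 ≤ e := mul_nonneg (pow_nonneg hδ.le _) (mul_nonneg hcs hE)
      have hfin : 2 * (T + 1) * e ≤ interpConst c T (s + 1) * G.dt T ^ (s + 1) * E := by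
        have h1 : G.dti T i ^ (s + 1) ≤ G.dt T ^ (s + 1) :=
          pow_le_pow_left₀ hδ.le (G.dti_le_dt hT i) _
        have h2 : 2 * (T + 1) * c (s + 2) ≤ interpConst c T (s + 1) := by
          unfold interpConst
          linarith
        calc 2 * (T + 1) * e = (2 * (T + 1) * c (s + 2)) * G.dti T i ^ (s + 1) * E := by
              rw [he]; ring
          _ ≤ _ := mul_le_mul_of_nonneg_right (mul_le_mul h2 h1 (pow_nonneg hδ.le _)
              (interpConst_nonneg hc hT _)) hE
      refine ⟨P, fun _ => ⟨hP, hPa, hPb, fun t ht => ⟨(hPe t ht).1.trans (le_trans ?_ hfin),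
        (hPe t ht).2.trans (le_trans ?_ hfin)⟩⟩⟩
      · have := mul_le_mul_of_nonneg_right hdT he0
        linarith
      · have := mul_nonneg hT.le he0
        linarith
    -- The pieces match the function at all nodes, so its nodal values are taken for `y`.
    choose P hP using hex
    exact ⟨P, fun j => D 0 (G.node T i j), hP, rfl, fun _ _ _ => rfl,
      fun j hj => hb 0 _ (hmem j hj)⟩

include hT in
lemma Grid.exists_continuous_piecewise {Y : Type*} [TopologicalSpace Y] {P : ℕ → ℝ → Y}
    {y : ℕ → Y}
    (hP : ∀ j ∈ Finset.Icc 1 (G.N * G.M i), Continuous (P j) ∧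
      P j (G.node T i (j - 1)) = y (j - 1) ∧ P j (G.node T i j) = y j) :
    ∃ f : ℝ → Y, ContinuousOn f (Icc 0 T) ∧ (∀ j ≤ G.N * G.M i, f (G.node T i j) = y j) ∧
      ∀ j ∈ Finset.Icc 1 (G.N * G.M i),
        EqOn f (P j) (Icc (G.node T i (j - 1)) (G.node T i j)) := by
  have hδ := G.dti_pos hT i
  let f : ℝ → Y := fun t => if t ≤ 0 then y 0 else P ⌈t / G.dti T i⌉₊ t
  have hf1 : ∀ j ∈ Finset.Icc 1 (G.N * G.M i),
      EqOn f (P j) (Ioc (G.node T i (j - 1)) (G.node T i j)) := fun j hj t ht => by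
    have h0 : ¬ t ≤ 0 := not_le.2 ((G.node_nonneg hT i _).trans_lt ht.1)
    simp only [f, if_neg h0, G.ceil_eq_of_mem hT i (Finset.mem_Icc.1 hj).1 ht]
  have hf2 : ∀ j ≤ G.N * G.M i, f (G.node T i j) = y j := by
    intro j hj
    rcases Nat.eq_zero_or_pos j with rfl | hj0
    · simp [f, G.node_zero]
    · have hj' := Finset.mem_Icc.2 ⟨hj0, hj⟩
      rw [hf1 j hj' ⟨?_, le_rfl⟩, (hP j hj').2.2]
      rw [← G.node_pred_add i hj0]
      linarith
  have hf3 : ∀ j ∈ Finset.Icc 1 (G.N * G.M i),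
      EqOn f (P j) (Icc (G.node T i (j - 1)) (G.node T i j)) := fun j hj t ht => by
    rcases ht.1.eq_or_lt with h1 | h1
    · rw [← h1, hf2 _ ((Nat.sub_le _ _).trans (Finset.mem_Icc.1 hj).2), (hP j hj).2.1]
    · exact hf1 j hj ⟨h1, ht.2⟩
  refine ⟨f, ?_, hf2, hf3⟩
  have hcont : ∀ n ≤ G.N * G.M i, ContinuousOn f (Icc 0 (G.node T i n)) := by
    intro n
    induction n with
    | zero => intro _; rw [G.node_zero, Icc_self]; exact continuousOn_singleton _ _
    | succ n ih =>
      intro hn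
      have hmem := Finset.mem_Icc.2 ⟨Nat.succ_pos n, hn⟩
      rw [← Icc_union_Icc_eq_Icc (G.node_nonneg hT i n) (G.node_le_node hT i n.le_succ)]
      exact (ih (by omega)).union_of_isClosed ((hP _ hmem).1.continuousOn.congr (hf3 _ hmem))
        isClosed_Icc isClosed_Icc
  have := hcont _ le_rfl
  rwa [G.node_mul, G.sync_N] at this

-- The glued function has a derivative off the nodes, where it agrees locally with one piece; the
-- nodes are countable and do not affect the integral.
include hT in
lemma Grid.integral_sq_sub_piecewise_le {D₀ D₁ w f : ℝ → V} {P : ℕ → ℝ → V} {ε : ℝ}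
    (hw : EqOn w D₀ (Icc 0 T)) (hD : ∀ t, HasDerivAt D₀ (D₁ t) t)
    (hP : ∀ j ∈ Finset.Icc 1 (G.N * G.M i), Differentiable ℝ (P j) ∧
      EqOn f (P j) (Icc (G.node T i (j - 1)) (G.node T i j)) ∧
      ∀ t ∈ Icc (G.node T i (j - 1)) (G.node T i j),
        ‖D₀ t - P j t‖ ≤ ε ∧ ‖D₁ t - deriv (P j) t‖ ≤ ε) :
    (∫ t in (0 : ℝ)..T, ‖w t - f t‖ ^ 2) + ∫ t in (0 : ℝ)..T, ‖deriv (fun s => w s - f s) t‖ ^ 2 ≤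
      2 * T * ε ^ 2 := by
  have h1 : ∀ t ∈ uIoc 0 T, ‖‖w t - f t‖ ^ 2‖ ≤ ε ^ 2 := fun t ht => by
    rw [uIoc_of_le hT.le] at ht
    obtain ⟨hj, htj⟩ := G.mem_Ioc_ceil hT i ht
    obtain ⟨-, hfP, he⟩ := hP _ hj
    have htj' := Ioc_subset_Icc_self htj
    rw [Real.norm_of_nonneg (sq_nonneg _), hw (Ioc_subset_Icc_self ht), hfP htj']
    exact pow_le_pow_left₀ (norm_nonneg _) (he t htj').1 2
  have h2 : ∀ᵐ t, t ∈ uIoc 0 T → ‖‖deriv (fun s => w s - f s) t‖ ^ 2‖ ≤ ε ^ 2 := by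
    filter_upwards [(countable_range (G.node T i)).ae_notMem volume] with t hnode ht
    rw [uIoc_of_le hT.le] at ht
    obtain ⟨hj, htj⟩ := G.mem_Ioc_ceil hT i ht
    set j := ⌈t / G.dti T i⌉₊
    obtain ⟨hdiff, hfP, he⟩ := hP _ hj
    have hlt : t < G.node T i j := htj.2.lt_of_ne fun h => hnode ⟨j, h.symm⟩
    have hnhds : Icc (G.node T i (j - 1)) (G.node T i j) ∈ nhds t := Icc_mem_nhds htj.1 hlt
    have hsub : Icc (G.node T i (j - 1)) (G.node T i j) ⊆ Icc 0 T :=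
      Icc_subset_Icc (G.node_nonneg hT i _) (G.node_le hT i (Finset.mem_Icc.1 hj).2)
    have hev : (fun s => w s - f s) =ᶠ[nhds t] fun s => D₀ s - P j s := by
      filter_upwards [hnhds] with s hs
      rw [hw (hsub hs), hfP hs]
    have hd : HasDerivAt (fun s => D₀ s - P j s) (D₁ t - deriv (P j) t) t :=
      (hD t).sub (hdiff t).hasDerivAt
    rw [hev.deriv_eq, hd.deriv, Real.norm_of_nonneg (sq_nonneg _)]
    exact pow_le_pow_left₀ (norm_nonneg _) (he t (Ioc_subset_Icc_self htj)).2 2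
  have h3 := intervalIntegral.norm_integral_le_of_norm_le_const h1
  have h4 := intervalIntegral.norm_integral_le_of_norm_le_const_ae h2
  rw [sub_zero, abs_of_pos hT] at h3 h4
  have h5 := (le_abs_self _).trans h3
  have h6 := (le_abs_self _).trans h4
  linarith

end Smooth

/-! ### Projection onto polynomials in time. -/

section Projection

variable {V : Type*} [NormedAddCommGroup V] [InnerProductSpace ℝ V] [FiniteDimensional ℝ V]

/-- Finite dimension is what makes the orthogonal projection onto this subspace of `L²` available.
-/
instance finiteDimensional_polyLp {α β : ℝ} (r : ℕ) :
    FiniteDimensional ℝ (polyLp V (volume.restrict (Ioc α β)) r) := by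
  have hm : ∀ c : Fin (r + 1) → V, MemLp (fun t : ℝ => ∑ j : Fin (r + 1), t ^ (j : ℕ) • c j) 2
      (volume.restrict (Ioc α β)) := fun c => IsTimePoly.memLp ⟨c, fun _ => rfl⟩ α β
  let L : (Fin (r + 1) → V) →ₗ[ℝ] Lp V 2 (volume.restrict (Ioc α β)) :=
    { toFun := fun c => (hm c).toLp _
      map_add' := fun c c' => by
        rw [← MemLp.toLp_add]
        congr 1
        funext t
        simp [smul_add, Finset.sum_add_distrib]
      map_smul' := fun a c => by
        rw [RingHom.id_apply, ← MemLp.toLp_const_smul]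
        congr 1
        funext t
        simp [Finset.smul_sum, smul_comm a] }
  have hle : polyLp V (volume.restrict (Ioc α β)) r ≤ LinearMap.range L := by
    rintro f ⟨P, ⟨c, hc⟩, hf⟩
    refine ⟨c, Lp.ext ?_⟩
    filter_upwards [hf, (hm c).coeFn_toLp] with t h1 h2
    rw [h1, hc]
    exact h2
  exact Submodule.finiteDimensional_of_le hle

/-- The `L²` projection onto the polynomials in time of degree at most `r`. -/
lemma exists_timePoly_projection {α β : ℝ} (hαβ : α ≤ β) (r : ℕ) {z : ℝ → V}
    (hz : MemLp z 2 (volume.restrict (Ioc α β))) :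
    ∃ P : ℝ → V, IsTimePoly r P ∧
      (∀ l : ℝ → V, IsTimePoly r l →
        ∫ t in α..β, (inner ℝ (P t) (l t) : ℝ) = ∫ t in α..β, inner ℝ (z t) (l t)) ∧
      ∀ R : ℝ → V, IsTimePoly r R →
        l2n α β (fun t => z t - P t) ≤ 2 * l2n α β (fun t => z t - R t) := by
  set K := polyLp V (volume.restrict (Ioc α β)) r with hK
  obtain ⟨P, hP, hPe⟩ := K.starProjection_apply_mem (hz.toLp z)
  have hPm : MemLp P 2 (volume.restrict (Ioc α β)) := hP.memLp α β
  have hPeq : hPm.toLp P = K.starProjection (hz.toLp z) :=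
    Lp.ext (hPm.coeFn_toLp.trans hPe.symm)
  have hmem : ∀ l : ℝ → V, IsTimePoly r l → ∀ hl : MemLp l 2 (volume.restrict (Ioc α β)),
      hl.toLp l ∈ K := fun l hl hlm => ⟨l, hl, hlm.coeFn_toLp⟩
  have horth : ∀ l ∈ K, (inner ℝ (hPm.toLp P) l : ℝ) = inner ℝ (hz.toLp z) l := fun l hl => by
    have := K.starProjection_inner_eq_zero (hz.toLp z) l hl
    rw [inner_sub_left, sub_eq_zero] at this
    rw [hPeq, this]
  refine ⟨P, hP, fun l hl => ?_, fun R hR => ?_⟩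
  · have hlm : MemLp l 2 (volume.restrict (Ioc α β)) := hl.memLp α β
    rw [← inner_toLp hαβ hPm hlm, ← inner_toLp hαβ hz hlm]
    exact horth _ (hmem l hl hlm)
  · have hRm : MemLp R 2 (volume.restrict (Ioc α β)) := hR.memLp α β
    have h1 := norm_sub_le_of_inner_eq (hmem P hP hPm) (hmem R hR hRm) horth
    have e1 : l2n α β (fun t => z t - P t) = ‖hz.toLp z - hPm.toLp P‖ := by
      rw [← MemLp.toLp_sub, norm_toLp_eq_l2n hαβ]; rfl
    have e2 : l2n α β (fun t => z t - R t) = ‖hz.toLp z - hRm.toLp R‖ := by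
      rw [← MemLp.toLp_sub, norm_toLp_eq_l2n hαβ]; rfl
    rw [e1, e2]
    -- `P - R` is the projection of `z - R`, so the triangle inequality gives the factor `2`.
    have h2 := norm_sub_le (hz.toLp z - hRm.toLp R) (hPm.toLp P - hRm.toLp R)
    rw [sub_sub_sub_cancel_right] at h2
    linarith

end Projection

/-! ### The dual problem -/

/-- The solution is `exp ((t - τ) B) e`, with derivatives obtained by applying powers of `B`. As `|t
- τ| ≤ T`, a bound of the exponential on `[-T, T]` serves all `τ` at once. -/
lemma exists_linear_flow {W : Type*} [NormedAddCommGroup W] [NormedSpace ℝ W] [CompleteSpace W]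
    (B : W →L[ℝ] W) (T : ℝ) : ∃ c : ℕ → ℝ, (∀ a, 0 ≤ c a) ∧ ∀ τ ∈ Icc 0 T, ∀ e : W,
      ∃ Z : ℕ → ℝ → W, (∀ a t, HasDerivAt (Z a) (Z (a + 1) t) t) ∧ Z 0 τ = e ∧
        (∀ a t, Z (a + 1) t = B (Z a t)) ∧ ∀ a, ∀ t ∈ Icc 0 T, ‖Z a t‖ ≤ c a * ‖e‖ := by
  set Φ : ℝ → (W →L[ℝ] W) := fun t => NormedSpace.exp (t • B) with hΦ
  have hΦd : ∀ t, HasDerivAt Φ (B * Φ t) t := fun t => hasDerivAt_exp_smul_const' (𝕂 := ℝ) B t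
  have hΦc : Continuous Φ := continuous_iff_continuousAt.2 fun t => (hΦd t).continuousAt
  obtain ⟨M, hM⟩ := (isCompact_Icc (a := -T) (b := T)).exists_bound_of_continuousOn
    hΦc.continuousOn
  refine ⟨fun a => ‖B ^ a‖ * |M|, fun a => by positivity, fun τ hτ e =>
    ⟨fun a t => (B ^ a) (Φ (t - τ) e), fun a t => ?_, by simp [hΦ], fun a t => ?_,
      fun a t ht => ?_⟩⟩
  · have h1 : HasDerivAt (fun t => Φ (t - τ)) (B * Φ (t - τ)) t :=
      (hΦd (t - τ)).comp_sub_const t τ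
    have h2 := h1.clm_apply (hasDerivAt_const t e)
    have h3 := (B ^ a).hasFDerivAt.comp_hasDerivAt t h2
    have e1 : (B ^ a) ((B * Φ (t - τ)) e + Φ (t - τ) 0) = (B ^ (a + 1)) (Φ (t - τ) e) := by
      rw [map_zero, add_zero, pow_succ]; rfl
    rw [e1] at h3
    exact h3
  · simp only [pow_succ']; rfl
  · have h2 : ‖Φ (t - τ)‖ ≤ |M| := (hM _ ⟨by linarith [ht.1, hτ.2], by linarith [ht.2, hτ.1]⟩).trans
      (le_abs_self _)
    calc ‖(B ^ a) (Φ (t - τ) e)‖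
      _ ≤ ‖B ^ a‖ * (‖Φ (t - τ)‖ * ‖e‖) := (ContinuousLinearMap.le_opNorm _ _).trans
          (mul_le_mul_of_nonneg_left (ContinuousLinearMap.le_opNorm _ _) (norm_nonneg _))
      _ ≤ ‖B ^ a‖ * (|M| * ‖e‖) := by gcongr
      _ = _ := by ring

section Dual

variable {m : ℕ} {S : Spatial m} {A : Coeffs m} {T τ : ℝ} {e : ∀ i, S.FE i}

/-- The flux of the dual problem. -/
def dualFlux (A : Coeffs m) (i : Fin 2) (w : ∀ i, S.FE i) : S.TraceFE :=
  ∑ j, A.b j i • S.tr j (w j)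

/-- The operator of the dual problem. -/
def dualOp (A : Coeffs m) (S : Spatial m) : (∀ i, S.FE i) →L[ℝ] (∀ i, S.FE i) :=
  ContinuousLinearMap.pi fun i =>
    (ContinuousLinearMap.adjoint (A.op S i)).comp (ContinuousLinearMap.proj i) +
      (ContinuousLinearMap.adjoint (S.tr i)).comp
        (∑ j, A.b j i • (S.tr j).comp (ContinuousLinearMap.proj j))

/-- The dual operator contains the adjoints of the primal ones, which is why the volume terms cancel
in the duality argument. -/
lemma inner_dualOp (A : Coeffs m) (i : Fin 2) (w : ∀ i, S.FE i) (v : S.FE i) :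
    (inner ℝ v (dualOp A S w i) : ℝ) =
      A.L i v (w i) + inner ℝ (S.tr i v) (dualFlux A i w) := by
  have : dualOp A S w i = ContinuousLinearMap.adjoint (A.op S i) (w i) +
      ContinuousLinearMap.adjoint (S.tr i) (dualFlux A i w) := by
    simp [dualOp, dualFlux]
  rw [this, inner_add_right, ContinuousLinearMap.adjoint_inner_right,
    ContinuousLinearMap.adjoint_inner_right, A.inner_op]

/-- The derivatives of a solution of the dual problem, and their bounds. -/
structure IsDualChain (A : Coeffs m) (T τ : ℝ) (e : ∀ i, S.FE i) (c : ℕ → ℝ)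
    (D : ∀ i, ℕ → ℝ → S.FE i) : Prop where
  smooth : ∀ i, IsSmoothChain (D i)
  value : ∀ i, D i 0 τ = e i
  eq : ∀ i t, D i 1 t = dualOp A S (fun j => D j 0 t) i
  bound : ∀ i a, ∀ t ∈ Icc 0 T, ‖D i a t‖ ≤ c a * √(∑ i, ‖e i‖ ^ 2)

/-- The constants `c` are fixed before `τ` and the data `e`. This makes the final constants
independent of the grid, of the synchronization time and of the discrete solution. -/
lemma exists_isDualChain (A : Coeffs m) (S : Spatial m) (T : ℝ) :
    ∃ c : ℕ → ℝ, (∀ a, 0 ≤ c a) ∧ ∀ τ ∈ Icc 0 T, ∀ e : ∀ i, S.FE i,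
      ∃ D : ∀ i, ℕ → ℝ → S.FE i, IsDualChain A T τ e c D := by
  obtain ⟨c, hc, hZ⟩ := exists_linear_flow (dualOp A S) T
  refine ⟨c, hc, fun τ hτ e => ?_⟩
  obtain ⟨Z, hZd, hZv, hZe, hZb⟩ := hZ τ hτ e
  refine ⟨fun i a t => Z a t i, fun i a t => hasDerivAt_pi.1 (hZd a t) i,
    fun i => congrFun hZv i, fun i t => congrFun (hZe 0 t) i, fun i a t ht => ?_⟩
  have h1 : ‖e‖ ≤ √(∑ i, ‖e i‖ ^ 2) := (pi_norm_le_iff_of_nonneg (Real.sqrt_nonneg _)).2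
    fun i => Real.le_sqrt_of_sq_le (Finset.single_le_sum (f := fun i => ‖e i‖ ^ 2)
      (fun _ _ => sq_nonneg _) (Finset.mem_univ i))
  exact (norm_le_pi_norm _ i).trans ((hZb a t ht).trans (mul_le_mul_of_nonneg_left h1 (hc a)))

variable {c : ℕ → ℝ} {D : ∀ i, ℕ → ℝ → S.FE i}

lemma IsDualChain.isDual (h : IsDualChain A T τ e c D) :
    IsDual A T τ e (fun i => D i 0) (fun i t => dualFlux A i fun j => D j 0 t) := by
  refine ⟨fun i => ((h.smooth i).continuous 0).continuousOn,
    fun i t _ => ⟨D i 1 t, (h.smooth i 0 t).hasDerivWithinAt, fun v => ?_⟩,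
    fun i v => by rw [← h.value], fun i t _ μ => ?_⟩
  · rw [h.eq, inner_dualOp]; rfl
  · simp only [dualFlux, Fin.sum_univ_two]; rfl

/-- Uniqueness for a linear ODE on both sides of `τ`; the fluxes are determined by the states.
Forward uniqueness uses the equation at `τ` itself, which is available since `τ > 0`. The time zero
is reached by continuity. -/
lemma IsDual.eqOn {w : ∀ i, ℝ → S.FE i} {Λ : Fin 2 → ℝ → S.TraceFE} (hτ : τ ∈ Ioc 0 T)
    (h : IsDual A T τ e w Λ) (hD : IsDualChain A T τ e c D) (i : Fin 2) :
    EqOn (w i) (D i 0) (Icc 0 T) := by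
  obtain ⟨hc, hd, hv, hΛ⟩ := h
  set f : ℝ → ∀ i, S.FE i := fun t i => w i t with hf
  set g : ℝ → ∀ i, S.FE i := fun t i => D i 0 t with hg
  have hfc : ContinuousOn f (Icc 0 T) := continuousOn_pi.2 hc
  have hgd : ∀ t, HasDerivAt g (dualOp A S (g t)) t := fun t => hasDerivAt_pi.2 fun i => by
    rw [← hD.eq]; exact hD.smooth i 0 t
  have hgc : Continuous g := continuous_iff_continuousAt.2 fun t => (hgd t).continuousAt
  have hfd : ∀ t ∈ Ioc 0 T, HasDerivWithinAt f (dualOp A S (f t)) (Icc 0 T) t := by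
    intro t ht
    refine hasDerivWithinAt_pi.2 fun i => ?_
    obtain ⟨w', hw', hw'v⟩ := hd i t ht
    have hΛeq : Λ i t = dualFlux A i (f t) := ext_inner_right ℝ fun μ => by
      rw [hΛ i t ht, dualFlux, Fin.sum_univ_two]; rfl
    have : w' = dualOp A S (f t) i := ext_inner_left ℝ fun v => by
      rw [hw'v, inner_dualOp, hΛeq]; rfl
    rwa [← this]
  have hfg : f τ = g τ := funext fun i => by
    simp only [hf, hg, hD.value]
    exact ext_inner_right ℝ (hv i)
  have hlip : ∀ s : Set ℝ, ∀ t ∈ s, LipschitzOnWith ‖dualOp A S‖₊ (dualOp A S) univ :=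
    fun _ _ _ => (dualOp A S).lipschitz.lipschitzOnWith
  have hleft : EqOn f g (Icc 0 τ) :=
    ODE_solution_unique_of_mem_Icc_left (v := fun _ => dualOp A S) (s := fun _ => univ) (hlip _)
      (hfc.mono (Icc_subset_Icc_right hτ.2))
      (fun t ht => (hfd t ⟨ht.1, ht.2.trans hτ.2⟩).mono_of_mem_nhdsWithin
        (Filter.mem_of_superset (Icc_mem_nhdsLE ht.1)
          (Icc_subset_Icc_right (ht.2.trans hτ.2)))) (fun _ _ => mem_univ _)
      hgc.continuousOn (fun t _ => (hgd t).hasDerivWithinAt) (fun _ _ => mem_univ _) hfg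
  have hright : EqOn f g (Icc τ T) :=
    ODE_solution_unique_of_mem_Icc_right (v := fun _ => dualOp A S) (s := fun _ => univ) (hlip _)
      (hfc.mono (Icc_subset_Icc_left hτ.1.le))
      (fun t ht => (hfd t ⟨hτ.1.trans_le ht.1, ht.2.le⟩).mono_of_mem_nhdsWithin
        (Filter.mem_of_superset (Icc_mem_nhdsGE ht.2)
          (Icc_subset_Icc_left (hτ.1.le.trans ht.1)))) (fun _ _ => mem_univ _)
      hgc.continuousOn (fun t _ => (hgd t).hasDerivWithinAt) (fun _ _ => mem_univ _) hfg
  intro t ht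
  rcases le_total t τ with h1 | h1
  · exact congrFun (hleft ⟨ht.1, h1⟩) i
  · exact congrFun (hright ⟨h1, ht.2⟩) i

lemma IsDualChain.dualRegularity (hT : 0 < T) (hD : IsDualChain A T τ e c D) (Q : Method)
    {w : ∀ i, ℝ → S.FE i} (hw : ∀ i, EqOn (w i) (D i 0) (Icc 0 T)) {C : ℝ}
    (hC : 2 * c 0 ^ 2 + 2 * ∑ a ∈ Finset.range
      (max (Q.q + 2 - Q.ns) (max (Q.r 0 + 1) (Q.r 1 + 1)) + 1), T * c a ^ 2 ≤ C) :
    DualRegularity T Q e w C := by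
  set E2 := ∑ i, ‖e i‖ ^ 2 with hE2
  have hE20 : 0 ≤ E2 := Finset.sum_nonneg fun _ _ => sq_nonneg _
  have hsq : ∀ i a, ∀ t ∈ Icc 0 T, ‖D i a t‖ ^ 2 ≤ c a ^ 2 * E2 := fun i a t ht => by
    rw [← Real.sq_sqrt hE20, ← mul_pow]
    exact pow_le_pow_left₀ (norm_nonneg _) (hD.bound i a t ht) 2
  set R := Finset.range (max (Q.q + 2 - Q.ns) (max (Q.r 0 + 1) (Q.r 1 + 1)) + 1)
  have hp : 0 ≤ ∑ a ∈ R, T * c a ^ 2 := Finset.sum_nonneg fun a _ => by positivity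
  have hp0 := sq_nonneg (c 0)
  refine ⟨fun i => ((hD.smooth i).contDiff _ 0).contDiffOn.congr (hw i), ?_, fun t ht => ?_⟩
  · have h1 : ∀ i a, ∫ t in (0 : ℝ)..T, ‖iteratedDerivWithin a (w i) (Icc 0 T) t‖ ^ 2 ≤
        T * c a ^ 2 * E2 := fun i a => by
      have h2 := intervalIntegral.norm_integral_le_of_norm_le_const (a := 0) (b := T)
        (f := fun t => ‖iteratedDerivWithin a (w i) (Icc 0 T) t‖ ^ 2) (C := c a ^ 2 * E2)
        fun t ht => by
          rw [uIoc_of_le hT.le] at ht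
          rw [Real.norm_of_nonneg (sq_nonneg _),
            (hD.smooth i).eqOn_iteratedDerivWithin hT (hw i) a (Ioc_subset_Icc_self ht)]
          exact hsq i a t (Ioc_subset_Icc_self ht)
      rw [sub_zero, abs_of_pos hT] at h2
      exact (le_abs_self _).trans (h2.trans_eq (by ring))
    calc _ ≤ ∑ _i : Fin 2, ∑ a ∈ R, T * c a ^ 2 * E2 :=
          Finset.sum_le_sum fun i _ => Finset.sum_le_sum fun a _ => h1 i a
      _ = 2 * (∑ a ∈ R, T * c a ^ 2) * E2 := by
          rw [Fin.sum_univ_two, ← Finset.sum_mul]; ring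
      _ ≤ _ := mul_le_mul_of_nonneg_right (by linarith) hE20
  · calc ∑ i, ‖w i t‖ ^ 2 ≤ ∑ _i : Fin 2, c 0 ^ 2 * E2 :=
          Finset.sum_le_sum fun i _ => by rw [hw i ht]; exact hsq i 0 t ht
      _ = 2 * c 0 ^ 2 * E2 := by rw [Fin.sum_univ_two]; ring
      _ ≤ _ := mul_le_mul_of_nonneg_right (by linarith) hE20

/-- The traces of a dual solution are well approximated by polynomials on the windows. -/
lemma IsDualChain.exists_trace_approx (hT : 0 < T) (hD : IsDualChain A T τ e c D)
    (G : Grid) {k : ℕ} (hk : k ∈ Finset.Icc 1 G.N) (i : Fin 2) (r : ℕ) :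
    ∃ R : ℝ → S.TraceFE, IsTimePoly r R ∧
      l2n (G.sync T (k - 1)) (G.sync T k) (fun t => S.tr i (D i 0 t) - R t) ≤
        √(G.dt T) * (G.dt T ^ (r + 1) * (‖S.tr i‖ * c (r + 1) * √(∑ i, ‖e i‖ ^ 2))) := by
  have hk' := Finset.mem_Icc.1 hk
  have hle : G.sync T (k - 1) ≤ G.sync T k := G.sync_le_sync hT (Nat.sub_le _ _)
  have hlen : G.sync T k - G.sync T (k - 1) = G.dt T := by
    rw [← G.sync_pred_add hk'.1]; ring
  have hz := (hD.smooth i).map (S.tr i)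
  obtain ⟨R, hR, hRe⟩ := (hz.isDerivChain (r + 1) T).exists_timePoly_l2n_le
    (G.sync_nonneg hT (k - 1)) hle (G.sync_le hT hk'.2)
    ((hz.continuous (r + 1)).continuousOn.memLp_Ioc)
  refine ⟨R, hR, hRe.trans ?_⟩
  rw [hlen, mul_left_comm]
  refine mul_le_mul_of_nonneg_left ?_ (pow_nonneg (G.dt_pos hT).le _)
  rw [← hlen]
  have hsub : Ioc (G.sync T (k - 1)) (G.sync T k) ⊆ Icc 0 T := Ioc_subset_Icc_self.trans
    (Icc_subset_Icc (G.sync_nonneg hT _) (G.sync_le hT hk'.2))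
  have hbound : ∀ t ∈ Ioc (G.sync T (k - 1)) (G.sync T k), ‖S.tr i (D i (r + 1) t)‖ ≤
      ‖S.tr i‖ * c (r + 1) * √(∑ i, ‖e i‖ ^ 2) := fun t ht => by
    rw [mul_assoc]
    exact ((S.tr i).le_opNorm _).trans
      (mul_le_mul_of_nonneg_left (hD.bound i _ t (hsub ht)) (norm_nonneg _))
  have hlt : G.sync T (k - 1) < G.sync T k := by linarith [G.dt_pos hT]
  exact l2n_le_of_norm_le_const hle ((norm_nonneg _).trans (hbound _ ⟨hlt, le_rfl⟩)) hbound

/-- The projection is as good as any polynomial up to a factor `2`; each window contributes a factor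
`Δt`, and `N Δt = T`. -/
lemma IsDualChain.dualProjection (hT : 0 < T) (hD : IsDualChain A T τ e c D)
    (Q : Method) (G : Grid) {w : ∀ i, ℝ → S.FE i} (hw : ∀ i, EqOn (w i) (D i 0) (Icc 0 T)) {C : ℝ}
    (hC : 4 * T * ∑ i, (‖S.tr i‖ * c (Q.r i + 1)) ^ 2 ≤ C) :
    DualProjection T Q G e w C := by
  set E2 := ∑ i, ‖e i‖ ^ 2 with hE2
  have hE20 : 0 ≤ E2 := Finset.sum_nonneg fun _ _ => sq_nonneg _
  have hdt := (G.dt_pos hT).le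
  have hle : ∀ k, G.sync T (k - 1) ≤ G.sync T k := fun k => G.sync_le_sync hT (Nat.sub_le _ _)
  have hsub : ∀ k ∈ Finset.Icc 1 G.N, Icc (G.sync T (k - 1)) (G.sync T k) ⊆ Icc 0 T :=
    fun k hk => Icc_subset_Icc (G.sync_nonneg hT _) (G.sync_le hT (Finset.mem_Icc.1 hk).2)
  have hz : ∀ i k, MemLp (fun t => S.tr i (D i 0 t)) 2
      (volume.restrict (Ioc (G.sync T (k - 1)) (G.sync T k))) := fun i k =>
    (((hD.smooth i).map (S.tr i)).continuous 0).continuousOn.memLp_Ioc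
  choose P hP hPl hPe using fun i k => exists_timePoly_projection (hle k) (Q.r i) (hz i k)
  have hcongr : ∀ i, ∀ k ∈ Finset.Icc 1 G.N, ∀ t ∈ uIoc (G.sync T (k - 1)) (G.sync T k),
      w i t = D i 0 t := fun i k hk t ht => by
    rw [uIoc_of_le (hle k)] at ht
    exact hw i (hsub k hk (Ioc_subset_Icc_self ht))
  refine ⟨P, fun i k hk => ⟨hP i k, fun l hl => ?_⟩, ?_⟩
  · rw [hPl i k l hl]
    refine intervalIntegral.integral_congr_ae (Filter.Eventually.of_forall fun t ht => ?_)
    rw [← hcongr i k hk t ht]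
    rfl
  · have h1 : ∀ i, ∀ k ∈ Finset.Icc 1 G.N, ∫ t in (G.sync T (k - 1))..(G.sync T k),
        ∫ y in Gam m, (trace (w i t) y - P i k t y) ^ 2 ≤
        G.dt T * (4 * (G.dt T ^ (2 * Q.r i + 2) * (‖S.tr i‖ * c (Q.r i + 1)) ^ 2 * E2)) := by
      intro i k hk
      have e1 : ∫ t in (G.sync T (k - 1))..(G.sync T k),
          ∫ y in Gam m, (trace (w i t) y - P i k t y) ^ 2 =
          l2n (G.sync T (k - 1)) (G.sync T k) (fun t => S.tr i (D i 0 t) - P i k t) ^ 2 := by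
        rw [sq_l2n (hle k)]
        refine intervalIntegral.integral_congr_ae (Filter.Eventually.of_forall fun t ht => ?_)
        rw [← hcongr i k hk t ht, ← real_inner_self_eq_norm_sq, FESpace.inner_eq]
        simp only [sq]
        rfl
      obtain ⟨R, hR, hRe⟩ := hD.exists_trace_approx hT G hk i (Q.r i)
      have h2 := pow_le_pow_left₀ (l2n_nonneg _ _ _) ((hPe i k R hR).trans
        (mul_le_mul_of_nonneg_left hRe zero_le_two)) 2
      rw [e1]
      refine h2.trans_eq ?_
      rw [mul_pow, mul_pow, mul_pow, mul_pow, Real.sq_sqrt hdt, Real.sq_sqrt hE20]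
      ring
    calc _ ≤ ∑ i, ∑ _k ∈ Finset.Icc 1 G.N, G.dt T *
          (4 * (G.dt T ^ (2 * Q.r i + 2) * (‖S.tr i‖ * c (Q.r i + 1)) ^ 2 * E2)) :=
          Finset.sum_le_sum fun i _ => Finset.sum_le_sum fun k hk => h1 i k hk
      _ = ∑ i, 4 * T * (‖S.tr i‖ * c (Q.r i + 1)) ^ 2 * G.dt T ^ (2 * Q.r i + 2) * E2 := by
          refine Finset.sum_congr rfl fun i _ => ?_
          rw [Finset.sum_const, Nat.card_Icc, Nat.add_sub_cancel, nsmul_eq_mul, ← mul_assoc,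
            G.N_mul_dt]
          ring
      _ ≤ ∑ i, C * G.dt T ^ (2 * Q.r i + 2) * E2 := by
          refine Finset.sum_le_sum fun i _ => ?_
          refine mul_le_mul_of_nonneg_right (mul_le_mul_of_nonneg_right (le_trans ?_ hC)
            (pow_nonneg hdt _)) hE20
          exact mul_le_mul_of_nonneg_left (Finset.single_le_sum
            (f := fun i => (‖S.tr i‖ * c (Q.r i + 1)) ^ 2) (fun _ _ => sq_nonneg _)
            (Finset.mem_univ i)) (by linarith)
      _ = _ := by rw [← Finset.sum_mul, ← Finset.mul_sum]

/-- The synchronization time is the node `n * M i` of both subdomain grids, and this node is chosen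
as the one where the value is always exact. -/
lemma IsDualChain.dualInterpolation (hT : 0 < T) {G : Grid} {n : ℕ} (hn : n ≤ G.N)
    (hD : IsDualChain A T (G.sync T n) e c D) (hc : ∀ a, 0 ≤ c a) (Q : Method)
    {w : ∀ i, ℝ → S.FE i} (hw : ∀ i, EqOn (w i) (D i 0) (Icc 0 T)) {C : ℝ}
    (hC : 4 * T * interpConst c T (Q.q + 1 - Q.ns) ^ 2 ≤ C) :
    DualInterpolation T (G.sync T n) Q G e w C := by
  set E2 := ∑ i, ‖e i‖ ^ 2 with hE2
  have hE20 : 0 ≤ E2 := Finset.sum_nonneg fun _ _ => sq_nonneg _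
  set s := Q.q + 1 - Q.ns with hs
  choose P y hP hyn hys hyb using fun i => (hD.smooth i).exists_interpolants G hT i hc
    (Real.sqrt_nonneg E2) (hD.bound i) s (Nat.mul_le_mul_right (G.M i) hn)
  choose f hfc hfn hfP using fun i => G.exists_continuous_piecewise hT i (P := P i) (y := y i)
    fun j hj => ⟨(hP i j hj).1.continuous, (hP i j hj).2.1, (hP i j hj).2.2.1⟩
  have hmem : ∀ i, ∀ j ≤ G.N * G.M i, G.node T i j ∈ Icc 0 T := fun i j hj =>
    ⟨G.node_nonneg hT i j, G.node_le hT i hj⟩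
  refine ⟨f, fun i => ⟨hfc i, ?_, fun hns j hj => ?_, fun j hj => ⟨P i j, (hP i j hj).1,
    hfP i j hj⟩⟩, ?_⟩
  · have h1 := hfn i _ (Nat.mul_le_mul_right (G.M i) hn)
    rw [hyn i, ← hw i (hmem i _ (Nat.mul_le_mul_right (G.M i) hn)), G.node_mul] at h1
    exact h1
  · rw [hfn i j hj, hys i (by omega) j hj, hw i (hmem i j hj)]
  · have h1 := fun i => G.integral_sq_sub_piecewise_le hT i (w := w i) (f := f i) (P := P i)
      (ε := interpConst c T s * G.dt T ^ s * √E2) (hw i) ((hD.smooth i) 0) fun j hj =>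
      ⟨fun t => ((hP i j hj).1.hasDerivAt t).differentiableAt, hfP i j hj, (hP i j hj).2.2.2⟩
    refine (Finset.sum_le_sum fun i _ => h1 i).trans ?_
    rw [Fin.sum_univ_two]
    have e1 : (interpConst c T s * G.dt T ^ s * √E2) ^ 2 =
        interpConst c T s ^ 2 * (G.dt T ^ (2 * s) * E2) := by
      rw [mul_pow, mul_pow, Real.sq_sqrt hE20]; ring
    rw [e1, mul_assoc C]
    have h2 : 0 ≤ G.dt T ^ (2 * s) * E2 := mul_nonneg (pow_nonneg (G.dt_pos hT).le _) hE20
    have h3 := mul_le_mul_of_nonneg_right hC h2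
    linarith

end Dual

/-! ### The duality argument -/

section Duality

variable {m : ℕ} {S : Spatial m} {A : Coeffs m} {d : Loads m} {T : ℝ} {u : ∀ i, ℝ → S.FE i}
  {F : Fin 2 → ℝ → S.TraceFE} {Q : Method} {Du : ∀ i, ℕ → ℝ → S.FE i}
  {Dz DF : Fin 2 → ℕ → ℝ → S.TraceFE}

/-- The error equation on a window, tested with an approximation of a smooth function. -/
lemma IsRegular.abs_window_identity_le (h : IsRegular A d T u F Q Du Dz DF) {N₀ : ℕ} {G : Grid}
    {X : Discrete S} (hN₀ : 1 ≤ N₀) (hX : IsMultirateSolution A d T Q N₀ G X) {w : ℕ}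
    (hw : w ∈ Finset.Icc N₀ G.N) {i : Fin 2} {D : ℕ → ℝ → S.FE i} (hD : IsSmoothChain D)
    {P : ℕ → ℝ → S.FE i} {y : ℕ → S.FE i} {κ : ℝ}
    (hP : ∀ j ∈ Finset.Icc 1 (G.N * G.M i), IsTimePoly (Q.q + 1 - Q.ns) (P j) ∧
      P j (G.node T i (j - 1)) = y (j - 1) ∧ P j (G.node T i j) = y j ∧
      ∀ t ∈ Icc (G.node T i (j - 1)) (G.node T i j),
        ‖D 0 t - P j t‖ ≤ κ ∧ ‖D 1 t - deriv (P j) t‖ ≤ κ) :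
    |inner ℝ (nodeErr T G u X i (w * G.M i)) (y (w * G.M i)) -
        inner ℝ (nodeErr T G u X i ((w - 1) * G.M i)) (y ((w - 1) * G.M i)) -
        ((∫ t in (G.sync T (w - 1))..(G.sync T w), inner ℝ (stateErr T G u X i t) (D 1 t)) -
          ∫ t in (G.sync T (w - 1))..(G.sync T w), inner ℝ (residual A T G u F X i t) (D 0 t))| ≤
      κ * ∫ t in (G.sync T (w - 1))..(G.sync T w),
        (‖stateErr T G u X i t‖ + ‖residual A T G u F X i t‖) := by
  have hT := h.pos
  have hw' := Finset.mem_Icc.1 hw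
  have hw1 := hN₀.trans hw'.1
  have hle : ∀ n, G.node T i (G.idx i w n - 1) ≤ G.node T i (G.idx i w n) := fun n =>
    G.node_le_node hT i (Nat.sub_le _ _)
  have hsubs := fun n hn => G.substep_subset_window hT (i := i) (n := n) hw1 hw'.2 hn
  have hse := fun n hn => memLp_Ioc_mono (h.memLp_stateErr hX i hw'.2) (hsubs n hn).1 (hsubs n hn).2
  have hre := fun n hn => memLp_Ioc_mono
    (memLp_residual hT h.continuousOn h.flux_memLp' hX hN₀ i hw) (hsubs n hn).1 (hsubs n hn).2
  have hDm : ∀ a n, MemLp (D a) 2 (volume.restrict (Ioc (G.node T i (G.idx i w n - 1))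
      (G.node T i (G.idx i w n)))) := fun a n => (hD.continuous a).continuousOn.memLp_Ioc
  have i1 := fun n hn => intervalIntegrable_inner_of_memLp_Ioc (hle n) (hse n hn) (hDm 1 n)
  have i2 := fun n hn => intervalIntegrable_inner_of_memLp_Ioc (hle n) (hre n hn) (hDm 0 n)
  have i3 := fun n hn => (intervalIntegrable_of_memLp_Ioc (hle n) (hse n hn)).norm.add
    (intervalIntegrable_of_memLp_Ioc (hle n) (hre n hn)).norm
  -- The sum telescopes because the test functions of adjacent substeps share the value `y` at the
  -- common node.
  have htel : (inner ℝ (nodeErr T G u X i (w * G.M i)) (y (w * G.M i)) : ℝ) -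
      inner ℝ (nodeErr T G u X i ((w - 1) * G.M i)) (y ((w - 1) * G.M i)) =
      ∑ n ∈ Finset.Icc 1 (G.M i),
        (inner ℝ (nodeErr T G u X i (G.idx i w n)) (y (G.idx i w n)) -
          inner ℝ (nodeErr T G u X i (G.idx i w n - 1)) (y (G.idx i w n - 1))) := by
    rw [sum_Icc_one]
    have h1 := Finset.sum_range_sub (fun k => (inner ℝ (nodeErr T G u X i ((w - 1) * G.M i + k))
      (y ((w - 1) * G.M i + k)) : ℝ)) (G.M i)
    have h2 : (w - 1) * G.M i + G.M i = w * G.M i := by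
      obtain ⟨v, rfl⟩ : ∃ v, w = v + 1 := ⟨w - 1, by omega⟩
      rw [Nat.add_sub_cancel]; ring
    simp only [h2, add_zero] at h1
    exact h1.symm
  rw [htel, ← G.sum_window i hw1 i1, ← G.sum_window i hw1 i2, ← G.sum_window i hw1 i3,
    ← Finset.sum_sub_distrib, ← Finset.sum_sub_distrib, Finset.mul_sum]
  refine (Finset.abs_sum_le_sum_abs _ _).trans (Finset.sum_le_sum fun n hn => ?_)
  obtain ⟨hj1, -, -, hj4⟩ := G.idx_bounds hw1 hw'.2 hn
  obtain ⟨hPp, hPa, hPb, hPe⟩ := hP _ (Finset.mem_Icc.2 ⟨hj1, hj4⟩)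
  have heq := substep_error_eq hT h.semi h.flux_memLp' hX hN₀ hw hn hPp
  rw [hPa, hPb] at heq
  rw [heq]
  set a := G.node T i (G.idx i w n - 1)
  set b := G.node T i (G.idx i w n)
  have j1 : IntervalIntegrable (fun t => (inner ℝ (stateErr T G u X i t)
      (deriv (P (G.idx i w n)) t) : ℝ)) volume a b :=
    intervalIntegrable_inner_of_memLp_Ioc (hle n) (hse n hn)
      hPp.continuous_deriv.continuousOn.memLp_Ioc
  have j2 : IntervalIntegrable (fun t => (inner ℝ (residual A T G u F X i t)
      (P (G.idx i w n) t) : ℝ)) volume a b :=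
    intervalIntegrable_inner_of_memLp_Ioc (hle n) (hre n hn) (hPp.memLp a b)
  rw [← intervalIntegral.integral_sub j1 j2, ← intervalIntegral.integral_sub (i1 n hn) (i2 n hn),
    ← intervalIntegral.integral_sub (j1.sub j2) ((i1 n hn).sub (i2 n hn)),
    ← intervalIntegral.integral_const_mul]
  refine (intervalIntegral.abs_integral_le_integral_abs (hle n)).trans ?_
  refine intervalIntegral.integral_mono_on (hle n)
    ((j1.sub j2).sub ((i1 n hn).sub (i2 n hn))).abs ((i3 n hn).const_mul κ) fun t ht => ?_
  obtain ⟨h1, h2⟩ := hPe t ht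
  -- Replacing the interpolant by the smooth function leaves the errors paired with the
  -- interpolation errors only.
  have e1 : (inner ℝ (stateErr T G u X i t) (deriv (P (G.idx i w n)) t) : ℝ) -
      inner ℝ (residual A T G u F X i t) (P (G.idx i w n) t) -
      (inner ℝ (stateErr T G u X i t) (D 1 t) - inner ℝ (residual A T G u F X i t) (D 0 t)) =
      inner ℝ (residual A T G u F X i t) (D 0 t - P (G.idx i w n) t) -
        inner ℝ (stateErr T G u X i t) (D 1 t - deriv (P (G.idx i w n)) t) := by
    rw [inner_sub_right, inner_sub_right]; ring
  rw [e1]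
  have h3 := (abs_real_inner_le_norm (residual A T G u F X i t)
    (D 0 t - P (G.idx i w n) t)).trans (mul_le_mul_of_nonneg_left h1 (norm_nonneg _))
  have h4 := (abs_real_inner_le_norm (stateErr T G u X i t)
    (D 1 t - deriv (P (G.idx i w n)) t)).trans (mul_le_mul_of_nonneg_left h2 (norm_nonneg _))
  refine (abs_sub _ _).trans ?_
  linarith

/-- For a solution of the dual problem, only the coupling terms are left. -/
lemma IsRegular.sum_window_eq_coupling (h : IsRegular A d T u F Q Du Dz DF) {N₀ : ℕ} {G : Grid}
    {X : Discrete S} (hN₀ : 1 ≤ N₀) (hX : IsMultirateSolution A d T Q N₀ G X) {w : ℕ}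
    (hw : w ∈ Finset.Icc N₀ G.N) {τ : ℝ} {e : ∀ i, S.FE i} {c : ℕ → ℝ}
    {D : ∀ i, ℕ → ℝ → S.FE i} (hD : IsDualChain A T τ e c D) :
    ∑ i, ((∫ t in (G.sync T (w - 1))..(G.sync T w), inner ℝ (stateErr T G u X i t) (D i 1 t)) -
      ∫ t in (G.sync T (w - 1))..(G.sync T w), inner ℝ (residual A T G u F X i t) (D i 0 t)) =
    ∑ i, (∑ j, A.b i j * (∫ t in (G.sync T (w - 1))..(G.sync T w),
        inner ℝ (S.tr j (stateErr T G u X j t)) (S.tr i (D i 0 t))) -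
      ∫ t in (G.sync T (w - 1))..(G.sync T w),
        inner ℝ (fluxErr T G F X i t) (S.tr i (D i 0 t))) := by
  have hT := h.pos
  have hw' := Finset.mem_Icc.1 hw
  have hle : G.sync T (w - 1) ≤ G.sync T w := G.sync_le_sync hT (Nat.sub_le _ _)
  have hse := fun i => h.memLp_stateErr hX i hw'.2
  have hre := fun i => memLp_residual hT h.continuousOn h.flux_memLp' hX hN₀ i hw
  have hfe := fun i => memLp_fluxErr hT h.flux_memLp' hX hN₀ i hw
  have hDm : ∀ i a, MemLp (D i a) 2 (volume.restrict (Ioc (G.sync T (w - 1)) (G.sync T w))) :=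
    fun i a => ((hD.smooth i).continuous a).continuousOn.memLp_Ioc
  have htr : ∀ j i, IntervalIntegrable (fun t => (inner ℝ (S.tr j (stateErr T G u X j t))
      (S.tr i (D i 0 t)) : ℝ)) volume (G.sync T (w - 1)) (G.sync T w) := fun j i =>
    intervalIntegrable_inner_of_memLp_Ioc hle ((S.tr j).comp_memLp' (hse j))
      ((S.tr i).comp_memLp' (hDm i 0))
  have hfl : ∀ i, IntervalIntegrable (fun t => (inner ℝ (fluxErr T G F X i t)
      (S.tr i (D i 0 t)) : ℝ)) volume (G.sync T (w - 1)) (G.sync T w) := fun i =>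
    intervalIntegrable_inner_of_memLp_Ioc hle (hfe i) ((S.tr i).comp_memLp' (hDm i 0))
  -- The dual equation turns the derivative into `L(e, w)` plus a flux term, and the residual
  -- contains the same `L(e, w)`.
  have key : ∀ i, (∫ t in (G.sync T (w - 1))..(G.sync T w),
      (inner ℝ (stateErr T G u X i t) (D i 1 t) : ℝ)) -
      (∫ t in (G.sync T (w - 1))..(G.sync T w),
        (inner ℝ (residual A T G u F X i t) (D i 0 t) : ℝ)) =
      ∑ j, A.b j i * (∫ t in (G.sync T (w - 1))..(G.sync T w),
        inner ℝ (S.tr i (stateErr T G u X i t)) (S.tr j (D j 0 t))) -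
      ∫ t in (G.sync T (w - 1))..(G.sync T w),
        (inner ℝ (fluxErr T G F X i t) (S.tr i (D i 0 t)) : ℝ) := by
    intro i
    simp only [← intervalIntegral.integral_const_mul]
    rw [← intervalIntegral.integral_finsetSum fun j _ => (htr i j).const_mul _,
      ← intervalIntegral.integral_sub (intervalIntegrable_inner_of_memLp_Ioc hle (hse i) (hDm i 1))
        (intervalIntegrable_inner_of_memLp_Ioc hle (hre i) (hDm i 0)),
      ← intervalIntegral.integral_sub _ (hfl i)]
    · refine intervalIntegral.integral_congr fun t _ => ?_
      rw [hD.eq, inner_dualOp, inner_residual, A.inner_op, dualFlux, inner_sum]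
      simp only [real_inner_smul_right]
      ring
    · simp only [Fin.sum_univ_two]
      exact ((htr i 0).const_mul _).add ((htr i 1).const_mul _)
  simp only [key]
  -- Exchanging the two sums turns the transposed coefficients of the dual problem into those of the
  -- flux conditions; this is why the dual coupling is transposed.
  rw [Finset.sum_sub_distrib, Finset.sum_sub_distrib, Finset.sum_comm]

/-- One window contributes the interpolation error of the dual solution on the substeps and the
coupling terms, in which the traces of the dual solution are compared with polynomials on the
window. The factor `√Δt` comes from Cauchy-Schwarz in time in the interpolation term, and from
integrating pointwise bounds of the dual solution in the coupling term. -/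
lemma IsRegular.exists_window_duality (h : IsRegular A d T u F Q Du Dz DF) {c : ℕ → ℝ}
    (hc : ∀ a, 0 ≤ c a) :
    ∃ C, 0 ≤ C ∧ ∀ (N₀ : ℕ) (G : Grid) (X : Discrete S), 1 ≤ N₀ →
      IsMultirateSolution A d T Q N₀ G X → ∀ w ∈ Finset.Icc N₀ G.N,
      ∀ (τ : ℝ) (e : ∀ i, S.FE i) (D : ∀ i, ℕ → ℝ → S.FE i), IsDualChain A T τ e c D →
      ∀ (P : ∀ i, ℕ → ℝ → S.FE i) (y : ∀ i, ℕ → S.FE i),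
        (∀ i, ∀ j ∈ Finset.Icc 1 (G.N * G.M i), IsTimePoly (Q.q + 1 - Q.ns) (P i j) ∧
          P i j (G.node T i (j - 1)) = y i (j - 1) ∧ P i j (G.node T i j) = y i j ∧
          ∀ t ∈ Icc (G.node T i (j - 1)) (G.node T i j),
            ‖D i 0 t - P i j t‖ ≤ interpConst c T (Q.q + 1 - Q.ns) *
              G.dt T ^ (Q.q + 1 - Q.ns) * √(∑ i, ‖e i‖ ^ 2) ∧
            ‖D i 1 t - deriv (P i j) t‖ ≤ interpConst c T (Q.q + 1 - Q.ns) *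
              G.dt T ^ (Q.q + 1 - Q.ns) * √(∑ i, ‖e i‖ ^ 2)) →
        |∑ i, inner ℝ (nodeErr T G u X i (w * G.M i)) (y i (w * G.M i)) -
          ∑ i, inner ℝ (nodeErr T G u X i ((w - 1) * G.M i)) (y i ((w - 1) * G.M i))| ≤
        C * (G.dt T ^ (Q.q + 1 - Q.ns) + windowRate Q (G.dt T)) * √(∑ i, ‖e i‖ ^ 2) *
          (√(G.dt T) * (windowErr T G u X w + windowDefect T G Q Dz DF w)) := by
  obtain ⟨C₁, hC₁0, hC₁⟩ := h.exists_window_coupling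
  obtain ⟨C₂, hC₂0, hC₂⟩ := h.exists_residual_bound
  have hT := h.pos
  set s := Q.q + 1 - Q.ns with hs
  set κ := interpConst c T s with hκ
  have hκ0 : 0 ≤ κ := interpConst_nonneg hc hT s
  set σ : ℝ := ∑ i, ∑ j, ‖S.tr i‖ * c (Q.r j + 1) with hσ
  have hσi : ∀ i j, 0 ≤ ‖S.tr i‖ * c (Q.r j + 1) := fun i j =>
    mul_nonneg (norm_nonneg (S.tr i)) (hc _)
  have hσ0 : 0 ≤ σ := Finset.sum_nonneg fun i _ => Finset.sum_nonneg fun j _ => hσi i j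
  have hσij : ∀ i j, ‖S.tr i‖ * c (Q.r j + 1) ≤ σ := fun i j =>
    (Finset.single_le_sum (f := fun j => ‖S.tr i‖ * c (Q.r j + 1)) (fun j _ => hσi i j)
      (Finset.mem_univ j)).trans (Finset.single_le_sum
        (f := fun i => ∑ j, ‖S.tr i‖ * c (Q.r j + 1))
        (fun i _ => Finset.sum_nonneg fun j _ => hσi i j) (Finset.mem_univ i))
  refine ⟨2 * κ * (1 + √C₂) + C₁ * σ, by positivity, ?_⟩
  intro N₀ G X hN₀ hX w hw τ e D hD P y hP
  have hw' := Finset.mem_Icc.1 hw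
  have hw1 := hN₀.trans hw'.1
  have hdt := (G.dt_pos hT).le
  have hle : G.sync T (w - 1) ≤ G.sync T w := G.sync_le_sync hT (Nat.sub_le _ _)
  have hlen : G.sync T w - G.sync T (w - 1) = G.dt T := by rw [← G.sync_pred_add hw1]; ring
  set E := √(∑ i, ‖e i‖ ^ 2) with hE
  have hE0 : 0 ≤ E := Real.sqrt_nonneg _
  set ε := windowErr T G u X w with hε
  set γ := windowDefect T G Q Dz DF w with hγ
  have hε0 : 0 ≤ ε := windowErr_nonneg w
  have hγ0 : 0 ≤ γ := windowDefect_nonneg hT w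
  have hw0 := windowRate_nonneg Q hdt
  have hds : 0 ≤ G.dt T ^ s := pow_nonneg hdt _
  have h1 := fun i => h.abs_window_identity_le hN₀ hX hw (hD.smooth i) (hP i)
  have hint : ∀ i, ∫ t in (G.sync T (w - 1))..(G.sync T w),
      (‖stateErr T G u X i t‖ + ‖residual A T G u F X i t‖) ≤
      √(G.dt T) * ((1 + √C₂) * (ε + γ)) := by
    intro i
    have hse := h.memLp_stateErr hX i hw'.2
    have hre := memLp_residual hT h.continuousOn h.flux_memLp' hX hN₀ i hw
    rw [intervalIntegral.integral_add (intervalIntegrable_of_memLp_Ioc hle hse).norm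
      (intervalIntegrable_of_memLp_Ioc hle hre).norm]
    have k1 := integral_norm_le_l2n hle hse
    have k2 := integral_norm_le_l2n hle hre
    rw [hlen] at k1 k2
    have k3 : l2n (G.sync T (w - 1)) (G.sync T w) (stateErr T G u X i) ≤ ε :=
      Finset.single_le_sum
        (f := fun i => l2n (G.sync T (w - 1)) (G.sync T w) (stateErr T G u X i))
        (fun _ _ => l2n_nonneg _ _ _) (Finset.mem_univ i)
    have k4 : l2n (G.sync T (w - 1)) (G.sync T w) (residual A T G u F X i) ≤ √C₂ * (ε + γ) := by
      refine abs_le_of_sq_le_sq' ?_ (by positivity) |>.2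
      rw [mul_pow, Real.sq_sqrt hC₂0]
      refine (hC₂ N₀ G X hN₀ hX w hw i).trans (mul_le_mul_of_nonneg_left ?_ hC₂0)
      have : 0 ≤ ε * γ := mul_nonneg hε0 hγ0
      nlinarith
    calc _ ≤ √(G.dt T) * ε + √(G.dt T) * (√C₂ * (ε + γ)) :=
          add_le_add (k1.trans (mul_le_mul_of_nonneg_left k3 (Real.sqrt_nonneg _)))
            (k2.trans (mul_le_mul_of_nonneg_left k4 (Real.sqrt_nonneg _)))
      _ = √(G.dt T) * (ε + √C₂ * (ε + γ)) := by ring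
      _ ≤ _ := by
          refine mul_le_mul_of_nonneg_left ?_ (Real.sqrt_nonneg _)
          linarith
  -- The trace of each dual component is approximated in both degrees `r j`, as the comparison of
  -- the coupling terms requires.
  choose R hR hRe using fun i j =>
    hD.exists_trace_approx hT G (Finset.mem_Icc.2 ⟨hw1, hw'.2⟩) i (Q.r j)
  have hcoup := (hC₁ N₀ G X hN₀ hX w hw).2 (fun i t => S.tr i (D i 0 t)) R
    (√(G.dt T) * (windowRate Q (G.dt T) * (σ * E)))
    (fun i => (S.tr i).comp_memLp' ((hD.smooth i).continuous 0).continuousOn.memLp_Ioc) hR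
    (fun i j => (hRe i j).trans (by
      refine mul_le_mul_of_nonneg_left ?_ (Real.sqrt_nonneg _)
      exact mul_le_mul (pow_le_windowRate Q hdt j) (mul_le_mul_of_nonneg_right (hσij i j) hE0)
        (mul_nonneg (hσi i j) hE0) hw0))
  rw [← h.sum_window_eq_coupling hN₀ hX hw hD] at hcoup
  have hκE : 0 ≤ κ * G.dt T ^ s * E := by positivity
  have h2 := fun i => (h1 i).trans (mul_le_mul_of_nonneg_left (hint i) hκE)
  have h3 : ∀ a₀ a₁ b₀ b₁ c₀ c₁ x z : ℝ, |a₀ - b₀ - c₀| ≤ x → |a₁ - b₁ - c₁| ≤ x → |c₀ + c₁| ≤ z →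
      |a₀ + a₁ - (b₀ + b₁)| ≤ 2 * x + z := by
    intro a₀ a₁ b₀ b₁ c₀ c₁ x z k1 k2 k3
    rw [abs_le] at *
    constructor <;> linarith [k1.1, k1.2, k2.1, k2.2, k3.1, k3.2]
  simp only [Fin.sum_univ_two] at hcoup ⊢
  refine (h3 _ _ _ _ _ _ _ _ (h2 0) (h2 1) hcoup).trans ?_
  calc 2 * (κ * G.dt T ^ s * E * (√(G.dt T) * ((1 + √C₂) * (ε + γ)))) +
        C₁ * (ε + γ) * (√(G.dt T) * (windowRate Q (G.dt T) * (σ * E)))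
      = (2 * κ * (1 + √C₂) * G.dt T ^ s + C₁ * σ * windowRate Q (G.dt T)) * E *
          (√(G.dt T) * (ε + γ)) := by ring
    _ ≤ _ := by
        refine mul_le_mul_of_nonneg_right (mul_le_mul_of_nonneg_right ?_ hE0)
          (mul_nonneg (Real.sqrt_nonneg _) (add_nonneg hε0 hγ0))
        have k1 : 0 ≤ 2 * κ * (1 + √C₂) * windowRate Q (G.dt T) := by positivity
        have k2 : 0 ≤ C₁ * σ * G.dt T ^ s := by positivity
        linarith

lemma nodeErr_sync {G : Grid} {X : Discrete S} (w : ℕ) (i : Fin 2) :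
    nodeErr T G u X i (w * G.M i) = sideError T G u X w i := by
  rw [nodeErr, sideError, G.node_mul]

/-- Cauchy-Schwarz over the windows; the factors `√δ` compensate for their number. -/
lemma sum_sqrt_mul_le {ι : Type*} (s : Finset ι) {δ T : ℝ} (hδ : 0 ≤ δ) (hT : s.card * δ ≤ T)
    (ε γ : ι → ℝ) :
    ∑ w ∈ s, √δ * (ε w + γ w) ≤ √(2 * T) * √(∑ w ∈ s, (ε w ^ 2 + γ w ^ 2)) := by
  have hT0 : 0 ≤ T := (mul_nonneg (Nat.cast_nonneg _) hδ).trans hT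
  rw [← Real.sqrt_mul (by positivity)]
  refine Real.le_sqrt_of_sq_le ((sq_sum_le_card_mul_sum_sq).trans ?_)
  have h1 : ∑ w ∈ s, (√δ * (ε w + γ w)) ^ 2 ≤ δ * (2 * ∑ w ∈ s, (ε w ^ 2 + γ w ^ 2)) := by
    rw [Finset.mul_sum, Finset.mul_sum]
    refine Finset.sum_le_sum fun w _ => ?_
    rw [mul_pow, Real.sq_sqrt hδ]
    exact mul_le_mul_of_nonneg_left add_sq_le hδ
  have h2 : 0 ≤ 2 * ∑ w ∈ s, (ε w ^ 2 + γ w ^ 2) :=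
    mul_nonneg zero_le_two (Finset.sum_nonneg fun _ _ => by positivity)
  calc (s.card : ℝ) * ∑ w ∈ s, (√δ * (ε w + γ w)) ^ 2
      ≤ s.card * (δ * (2 * ∑ w ∈ s, (ε w ^ 2 + γ w ^ 2))) :=
        mul_le_mul_of_nonneg_left h1 (Nat.cast_nonneg _)
    _ = (s.card * δ) * (2 * ∑ w ∈ s, (ε w ^ 2 + γ w ^ 2)) := by ring
    _ ≤ T * (2 * ∑ w ∈ s, (ε w ^ 2 + γ w ^ 2)) := mul_le_mul_of_nonneg_right hT h2
    _ = _ := by ring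

/-- The nodal errors in terms of the error of the states in `L²`. -/
lemma IsRegular.exists_syncError_le (h : IsRegular A d T u F Q Du Dz DF) {c : ℕ → ℝ}
    (hc : ∀ a, 0 ≤ c a) :
    ∃ C, 0 ≤ C ∧ ∀ (N₀ : ℕ) (G : Grid) (X : Discrete S), 1 ≤ N₀ →
      IsMultirateSolution A d T Q N₀ G X → ∀ w₀ n : ℕ, N₀ ≤ w₀ + 1 → w₀ ≤ n → n ≤ G.N →
      ∀ D : ∀ i, ℕ → ℝ → S.FE i, IsDualChain A T (G.sync T n) (sideError T G u X n) c D →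
        syncError T G u X n ≤ C * (syncError T G u X w₀ +
          (G.dt T ^ (Q.q + 1 - Q.ns) + windowRate Q (G.dt T)) *
            √(∑ w ∈ Finset.Icc N₀ G.N,
              (windowErr T G u X w ^ 2 + windowDefect T G Q Dz DF w ^ 2))) := by
  obtain ⟨C, hC0, hC⟩ := h.exists_window_duality hc
  have hT := h.pos
  have hc0 := hc 0
  refine ⟨2 * c 0 + C * √(2 * T), by positivity, ?_⟩
  intro N₀ G X hN₀ hX w₀ n hw₀ hw₀n hn D hD
  have hdt := (G.dt_pos hT).le
  set e := sideError T G u X n with he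
  have hE : syncError T G u X n = √(∑ i, ‖e i‖ ^ 2) := rfl
  set E := √(∑ i, ‖e i‖ ^ 2) with hEdef
  have hE0 : 0 ≤ E := Real.sqrt_nonneg _
  have hE2 : E ^ 2 = ∑ i, ‖e i‖ ^ 2 := Real.sq_sqrt (Finset.sum_nonneg fun _ _ => sq_nonneg _)
  choose P y hP hyn hys hyb using fun i => (hD.smooth i).exists_interpolants G hT i hc hE0
    (hD.bound i) (Q.q + 1 - Q.ns) (Nat.mul_le_mul_right (G.M i) hn)
  -- `Ψ` pairs the side value errors at a synchronization time with the interpolated dual solution.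
  -- At `n` it is the squared error, since the dual data are the error itself, and it changes little
  -- over each window.
  set Ψ : ℕ → ℝ := fun w => ∑ i, inner ℝ (nodeErr T G u X i (w * G.M i)) (y i (w * G.M i)) with hΨ
  set ρ := G.dt T ^ (Q.q + 1 - Q.ns) + windowRate Q (G.dt T) with hρ
  have hρ0 : 0 ≤ ρ := add_nonneg (pow_nonneg hdt _) (windowRate_nonneg Q hdt)
  set η : ℕ → ℝ := fun w =>
    √(G.dt T) * (windowErr T G u X w + windowDefect T G Q Dz DF w) with hη
  have hη0 : ∀ w, 0 ≤ η w := fun w => mul_nonneg (Real.sqrt_nonneg _)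
    (add_nonneg (windowErr_nonneg w) (windowDefect_nonneg hT w))
  have hstep : ∀ w ∈ Finset.Icc N₀ G.N, |Ψ w - Ψ (w - 1)| ≤ C * ρ * E * η w := fun w hw =>
    hC N₀ G X hN₀ hX w hw _ e D hD P y hP
  have hΨn : Ψ n = E ^ 2 := by
    rw [hE2]
    refine Finset.sum_congr rfl fun i _ => ?_
    rw [nodeErr_sync, hyn i, G.node_mul, hD.value, real_inner_self_eq_norm_sq]
  have hΨ0 : Ψ w₀ ≤ 2 * c 0 * syncError T G u X w₀ * E := by
    have h1 : ∀ i, (inner ℝ (nodeErr T G u X i (w₀ * G.M i)) (y i (w₀ * G.M i)) : ℝ) ≤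
        syncError T G u X w₀ * (c 0 * E) := fun i => by
      refine (real_inner_le_norm _ _).trans (mul_le_mul ?_
        (hyb i _ (Nat.mul_le_mul_right _ (hw₀n.trans hn))) (norm_nonneg _) (Real.sqrt_nonneg _))
      rw [nodeErr_sync]
      exact Real.le_sqrt_of_sq_le (Finset.single_le_sum
        (f := fun i => ‖sideError T G u X w₀ i‖ ^ 2) (fun _ _ => sq_nonneg _)
        (Finset.mem_univ i))
    refine (Finset.sum_le_sum fun i _ => h1 i).trans_eq ?_
    rw [Fin.sum_univ_two]; ring
  -- The windows after `w₀` are all windows on which the scheme is solved, whether the sum starts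
  -- from `N₀` or from `N₀ - 1`.
  have htel : ∀ k, w₀ + k ≤ G.N → Ψ (w₀ + k) ≤ Ψ w₀ +
      C * ρ * E * ∑ w ∈ Finset.Ico (w₀ + 1) (w₀ + k + 1), η w := by
    intro k
    induction k with
    | zero => intro _; simp
    | succ k ih =>
      intro hk
      have h1 := ih (by omega)
      have h2 := (le_abs_self _).trans
        (hstep (w₀ + (k + 1)) (Finset.mem_Icc.2 ⟨by omega, hk⟩))
      rw [show w₀ + (k + 1) - 1 = w₀ + k by omega] at h2
      rw [show w₀ + (k + 1) + 1 = w₀ + k + 1 + 1 by omega, Finset.sum_Ico_succ_top (by omega)]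
      rw [show w₀ + (k + 1) = w₀ + k + 1 by omega] at h2 ⊢
      linarith
  have h1 := htel (n - w₀) (by omega)
  rw [show w₀ + (n - w₀) = n by omega, hΨn] at h1
  have h2 : ∑ w ∈ Finset.Ico (w₀ + 1) (n + 1), η w ≤ √(2 * T) *
      √(∑ w ∈ Finset.Icc N₀ G.N,
        (windowErr T G u X w ^ 2 + windowDefect T G Q Dz DF w ^ 2)) := by
    refine (Finset.sum_le_sum_of_subset_of_nonneg (t := Finset.Icc N₀ G.N) ?_
      fun w _ _ => hη0 w).trans (sum_sqrt_mul_le _ hdt ?_ _ _)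
    · intro w hw
      rw [Finset.mem_Ico] at hw
      exact Finset.mem_Icc.2 ⟨by omega, by omega⟩
    · refine (mul_le_mul_of_nonneg_right (Nat.cast_le.2 ?_) hdt).trans_eq G.N_mul_dt
      rw [Nat.card_Icc]; omega
  set Z := √(∑ w ∈ Finset.Icc N₀ G.N,
        (windowErr T G u X w ^ 2 + windowDefect T G Q Dz DF w ^ 2))
  have hZ0 : 0 ≤ Z := Real.sqrt_nonneg _
  have hy0 : 0 ≤ syncError T G u X w₀ := Real.sqrt_nonneg _
  have h3 : E * E ≤ (2 * c 0 * syncError T G u X w₀ + C * ρ * (√(2 * T) * Z)) * E := by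
    have : C * ρ * E * ∑ w ∈ Finset.Ico (w₀ + 1) (n + 1), η w ≤ C * ρ * E * (√(2 * T) * Z) :=
      mul_le_mul_of_nonneg_left h2 (by positivity)
    nlinarith
  -- Every bound is linear in the size `E` of the dual data, so one factor `E` can be divided out.
  have h4 : E ≤ 2 * c 0 * syncError T G u X w₀ + C * ρ * (√(2 * T) * Z) := by
    rcases hE0.eq_or_lt with h5 | h5
    · rw [← h5]; positivity
    · exact le_of_mul_le_mul_right h3 h5
  rw [hE]
  refine h4.trans ?_
  have k1 : 0 ≤ C * √(2 * T) * syncError T G u X w₀ := by positivity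
  have k2 : 0 ≤ 2 * c 0 * (ρ * Z) := by positivity
  linarith

end Duality

/-! ### Nodal convergence -/

section Nodal

variable {m : ℕ} {S : Spatial m} {A : Coeffs m} {d : Loads m} {T : ℝ} {u : ∀ i, ℝ → S.FE i}
  {F : Fin 2 → ℝ → S.TraceFE} {Q : Method} {Du : ∀ i, ℕ → ℝ → S.FE i}

lemma exists_isRegular (hT : 0 < T) (hu : IsSemiDiscrete S A d T u F)
    (hDu : ∀ i, IsSobolev (Q.q + 1) T (u i) (Du i))
    (hDuΓ : ∀ i, ∃ (z : ℝ → S.TraceFE) (Dz : ℕ → ℝ → S.TraceFE),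
      (∀ t ∈ Set.Icc 0 T, ∀ y, z t y = trace (u i t) y) ∧ IsSobolev (Q.r i + 1) T z Dz)
    (hDF : ∀ i, ∃ DF : ℕ → ℝ → S.TraceFE, IsSobolev (Q.r i + 1) T (F i) DF) :
    ∃ Dz DF, IsRegular A d T u F Q Du Dz DF := by
  choose z Dz hz hDz using hDuΓ
  choose DF hDF using hDF
  have hc := fun i => hu.continuousOn hT i
  have hztr : ∀ i, ∀ t ∈ Icc 0 T, z i t = S.tr i (u i t) := fun i t ht =>
    FESpace.ext fun y => hz i t ht y
  have hzc : ∀ i, ContinuousOn (z i) (Icc 0 T) := fun i =>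
    ((S.tr i).continuous.comp_continuousOn (hc i)).congr (hztr i)
  exact ⟨Dz, DF, hT, hu, fun i => (hDu i).isDerivChain hT.le, fun i => (hDu i).eqOn hT (hc i),
    fun i => (hDu i).2.2, fun i => (hDz i).isDerivChain hT.le,
    fun i t ht => (hztr i t ht).symm.trans ((hDz i).eqOn hT (hzc i) ht),
    fun i => (hDz i).2.2 _ le_rfl, fun i => (hDF i).isDerivChain hT.le, fun i => (hDF i).1,
    fun i => (hDF i).2.2 _ le_rfl, fun i => (hDF i).memLp⟩

lemma norm_nodeErr_le_of_initAccurate {p K : ℝ} {N₀ : ℕ} {G : Grid} {X : Discrete S}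
    (hX : InitAccurate T p N₀ G u X K) (i : Fin 2) {j : ℕ} (hj : j ≤ (N₀ - 1) * G.M i) :
    ‖nodeErr T G u X i j‖ ≤ K * G.dt T ^ p := by
  rcases Nat.eq_zero_or_pos j with rfl | hj0
  · refine le_trans (Real.le_sqrt_of_sq_le ?_) hX.1
    rw [nodeErr, G.node_zero]
    exact Finset.single_le_sum (f := fun i => ‖u i 0 - X.U i 0‖ ^ 2) (fun _ _ => sq_nonneg _)
      (Finset.mem_univ i)
  -- The window and the substep number of a node counted from time zero; the shift by one assigns a
  -- synchronization time to the window that it ends.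
  · set w := (j - 1) / G.M i + 1 with hw
    set n := (j - 1) % G.M i + 1 with hn
    have hM := G.M_pos i
    have hidx : G.idx i w n = j := by
      have := Nat.div_add_mod' (j - 1) (G.M i)
      rw [Grid.idx, hw, hn, Nat.add_sub_cancel]
      omega
    have hwmem : w ∈ Finset.Ico 1 N₀ := by
      have : (j - 1) / G.M i < N₀ - 1 := by
        rw [Nat.div_lt_iff_lt_mul hM]
        omega
      exact Finset.mem_Ico.2 ⟨Nat.le_add_left 1 _, Nat.add_lt_of_lt_sub this⟩
    have hnmem : n ∈ Finset.Icc 1 (G.M i) :=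
      Finset.mem_Icc.2 ⟨by omega, Nat.mod_lt _ hM⟩
    refine le_trans (Real.le_sqrt_of_sq_le ?_) (hX.2 w hwmem).1
    rw [nodeErr, ← hidx]
    refine le_trans ?_ (Finset.single_le_sum (f := fun i => ∑ n ∈ Finset.Icc 1 (G.M i),
      ‖u i (G.node T i (G.idx i w n)) - X.U i (G.idx i w n)‖ ^ 2)
      (fun _ _ => Finset.sum_nonneg fun _ _ => sq_nonneg _) (Finset.mem_univ i))
    exact Finset.single_le_sum (f := fun n =>
      ‖u i (G.node T i (G.idx i w n)) - X.U i (G.idx i w n)‖ ^ 2) (fun _ _ => sq_nonneg _) hnmem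

lemma rate_eq (Q : Method) (p δt : ℝ) : rate Q p δt =
    (δt ^ (Q.q + 1 - Q.ns) + windowRate Q δt) *
      (δt ^ p + δt ^ (Q.q + 1) + windowRate Q δt) := rfl

lemma rate_nonneg (Q : Method) (p : ℝ) {δt : ℝ} (h : 0 ≤ δt) : 0 ≤ rate Q p δt := by
  have := windowRate_nonneg Q h
  rw [rate_eq]
  positivity

/-- The duality estimate supplies the first factor of the rate and the estimate of the states the
second, with the initial error bounded by `|K| Δt^p`. -/
lemma IsRegular.exists_nodal_bound {Dz DF : Fin 2 → ℕ → ℝ → S.TraceFE}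
    (h : IsRegular A d T u F Q Du Dz DF) {ψ : ℕ → Polynomial ℝ} (hψ : IsOrthogonalBasis Q.q ψ)
    (hD : (Q.Dtilde ψ).det ≠ 0) (p K : ℝ) {c : ℕ → ℝ} (hc : ∀ a, 0 ≤ c a) :
    ∃ δ > 0, ∃ C, 0 ≤ C ∧ ∀ (N₀ : ℕ) (G : Grid) (X : Discrete S), 1 ≤ N₀ → G.dt T ≤ δ →
      ReachesBack Q N₀ G → SideConsistent T Q N₀ G u Du K →
      IsMultirateSolution A d T Q N₀ G X → InitAccurate T p N₀ G u X K →
      ∀ w₀ n : ℕ, N₀ ≤ w₀ + 1 → w₀ ≤ n → n ≤ G.N →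
        syncError T G u X w₀ ≤ K * rate Q p (G.dt T) →
        ∀ D : ∀ i, ℕ → ℝ → S.FE i, IsDualChain A T (G.sync T n) (sideError T G u X n) c D →
        syncError T G u X n ≤ C * rate Q p (G.dt T) := by
  obtain ⟨δ, hδ, C₁, hC₁0, hC₁⟩ := h.exists_global_estimate hψ hD K
  obtain ⟨C₂, hC₂0, hC₂⟩ := h.exists_syncError_le hc
  refine ⟨δ, hδ, C₂ * (|K| + √(C₁ * (1 + K ^ 2))), by positivity, ?_⟩
  intro N₀ G X hN₀ hdt hRB hSC hX hIA w₀ n hw₀ hw₀n hn hinit D hDc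
  have hdt0 := (G.dt_pos h.pos).le
  have hp0 : 0 ≤ G.dt T ^ p := Real.rpow_nonneg hdt0 p
  have hq0 : 0 ≤ G.dt T ^ (Q.q + 1) := pow_nonneg hdt0 _
  have hr0 := windowRate_nonneg Q hdt0
  have hs0 : 0 ≤ G.dt T ^ (Q.q + 1 - Q.ns) := pow_nonneg hdt0 _
  have h1 := hC₁ N₀ G X (|K| * G.dt T ^ p) hN₀ hdt hRB hSC hX (by positivity) fun i j hj =>
    (norm_nodeErr_le_of_initAccurate hIA i hj).trans
      (mul_le_mul_of_nonneg_right (le_abs_self K) hp0)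
  have h2 := hC₂ N₀ G X hN₀ hX w₀ n hw₀ hw₀n hn D hDc
  have h3 : √(∑ w ∈ Finset.Icc N₀ G.N,
      (windowErr T G u X w ^ 2 + windowDefect T G Q Dz DF w ^ 2)) ≤
      √(C₁ * (1 + K ^ 2)) * (G.dt T ^ p + G.dt T ^ (Q.q + 1) + windowRate Q (G.dt T)) := by
    refine Real.sqrt_le_iff.2 ⟨by positivity, h1.trans ?_⟩
    rw [mul_pow (√(C₁ * (1 + K ^ 2))), Real.sq_sqrt (by positivity), mul_assoc C₁]
    refine mul_le_mul_of_nonneg_left ?_ hC₁0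
    rw [mul_pow, sq_abs, show 2 * Q.q + 2 = (Q.q + 1) * 2 by ring, pow_mul]
    generalize G.dt T ^ p = a at *
    generalize G.dt T ^ (Q.q + 1) = b at *
    generalize windowRate Q (G.dt T) = r at *
    have k1 : a ^ 2 + b ^ 2 + r ^ 2 ≤ (a + b + r) ^ 2 := by
      have : 0 ≤ a * b + a * r + b * r := by positivity
      linarith [this, add_sq (a + b) r, add_sq a b, mul_nonneg hp0 hr0]
    have k2 : K ^ 2 * a ^ 2 + b ^ 2 + r ^ 2 ≤ (1 + K ^ 2) * (a ^ 2 + b ^ 2 + r ^ 2) := by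
      have : 0 ≤ a ^ 2 + K ^ 2 * (b ^ 2 + r ^ 2) := by positivity
      linarith
    exact k2.trans (mul_le_mul_of_nonneg_left k1 (by positivity))
  have h4 : syncError T G u X w₀ ≤ |K| * rate Q p (G.dt T) :=
    hinit.trans (mul_le_mul_of_nonneg_right (le_abs_self K) (rate_nonneg Q p hdt0))
  calc syncError T G u X n ≤ _ := h2
    _ ≤ C₂ * (|K| * rate Q p (G.dt T) + (G.dt T ^ (Q.q + 1 - Q.ns) + windowRate Q (G.dt T)) *
          (√(C₁ * (1 + K ^ 2)) * (G.dt T ^ p + G.dt T ^ (Q.q + 1) + windowRate Q (G.dt T)))) := by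
        gcongr
    _ = _ := by rw [rate_eq]; ring

end Nodal

end Multirate

end

theorem theorem5p9 {m : ℕ} (hm : m = 1 ∨ m = 2) (S : Spatial m)
    (A : Coeffs m) (hA : Coercive S A) (d : Loads m) (T : ℝ) (hT : 0 < T)
    -- the semi-discrete solution and its regularity
    (u : ∀ i, ℝ → S.FE i) (F : Fin 2 → ℝ → S.TraceFE) (hu : IsSemiDiscrete S A d T u F)
    (Q : Method)
    (Du : ∀ i, ℕ → ℝ → S.FE i) (hDu : ∀ i, IsSobolev (Q.q + 1) T (u i) (Du i))
    (hDuΓ : ∀ i, ∃ (z : ℝ → S.TraceFE) (Dz : ℕ → ℝ → S.TraceFE),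
      (∀ t ∈ Set.Icc 0 T, ∀ y, z t y = trace (u i t) y) ∧ IsSobolev (Q.r i + 1) T z Dz)
    (hDF : ∀ i, ∃ DF : ℕ → ℝ → S.TraceFE, IsSobolev (Q.r i + 1) T (F i) DF)
    -- the side conditions are unisolvent
    (ψ : ℕ → Polynomial ℝ) (hψ : IsOrthogonalBasis Q.q ψ) (hD : (Q.Dtilde ψ).det ≠ 0)
    (N₀ : ℕ) (hN₀ : 1 ≤ N₀) (p : ℝ) (hp : 0 < p) (K : ℝ) :
    ∃ δ > 0, ∃ C > 0, ∀ G : Grid, G.dt T ≤ δ → ReachesBack Q N₀ G →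
      SideConsistent T Q N₀ G u Du K →
      ∀ X : Discrete S, IsMultirateSolution A d T Q N₀ G X →
        InitAccurate T p N₀ G u X K →
        -- the initialization assumption
        (∃ w₀, (w₀ = N₀ ∨ w₀ + 1 = N₀) ∧ syncError T G u X w₀ ≤ K * rate Q p (G.dt T)) →
        ∀ n, N₀ ≤ n → n ≤ G.N →
          -- the dual problem for the synchronization time `n`
          (∃ w Λ, IsDual A T (G.sync T n) (sideError T G u X n) w Λ) ∧
          (∀ w Λ, IsDual A T (G.sync T n) (sideError T G u X n) w Λ →
            DualRegularity T Q (sideError T G u X n) w C ∧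
            DualProjection T Q G (sideError T G u X n) w C ∧
            DualInterpolation T (G.sync T n) Q G (sideError T G u X n) w C) ∧
          -- the nodal error bound
          syncError T G u X n ≤ C * rate Q p (G.dt T) := by
  obtain ⟨Dz, DF, hreg⟩ := exists_isRegular hT hu hDu hDuΓ hDF
  obtain ⟨c, hc, hdual⟩ := exists_isDualChain A S T
  obtain ⟨δ, hδ, C₀, hC₀, hnodal⟩ := hreg.exists_nodal_bound hψ hD p K hc
  set J := max (Q.q + 2 - Q.ns) (max (Q.r 0 + 1) (Q.r 1 + 1))
  set C₁ : ℝ := 2 * c 0 ^ 2 + 2 * ∑ a ∈ Finset.range (J + 1), T * c a ^ 2 with hC₁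
  set C₂ : ℝ := 4 * T * ∑ i, (‖S.tr i‖ * c (Q.r i + 1)) ^ 2 with hC₂
  set C₃ : ℝ := 4 * T * interpConst c T (Q.q + 1 - Q.ns) ^ 2 with hC₃
  have p₁ : 0 ≤ C₁ := by
    have := Finset.sum_nonneg fun a (_ : a ∈ Finset.range (J + 1)) =>
      mul_nonneg hT.le (sq_nonneg (c a))
    positivity
  have p₂ : 0 ≤ C₂ := mul_nonneg (by positivity) (Finset.sum_nonneg fun _ _ => sq_nonneg _)
  have p₃ : 0 ≤ C₃ := by positivity
  -- The sum serves all four bounds at once; the summand `1` makes it positive.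
  refine ⟨δ, hδ, 1 + C₀ + C₁ + C₂ + C₃, by positivity, ?_⟩
  intro G hdt hRB hSC X hX hIA hinit n hN₀n hn
  have hτ : G.sync T n ∈ Ioc 0 T :=
    ⟨mul_pos (Nat.cast_pos.2 (hN₀.trans hN₀n)) (G.dt_pos hT), G.sync_le hT hn⟩
  obtain ⟨D, hDc⟩ := hdual _ (Ioc_subset_Icc_self hτ) (sideError T G u X n)
  -- The explicit chain gives existence and, by uniqueness, agrees with every dual solution on `[0,
  -- T]`, so its bounds carry over.
  refine ⟨⟨_, _, hDc.isDual⟩, fun w Λ hw => ?_, ?_⟩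
  · have heq := hw.eqOn hτ hDc
    exact ⟨hDc.dualRegularity hT Q heq (by linarith), hDc.dualProjection hT Q G heq (by linarith),
      hDc.dualInterpolation hT hn hc Q heq (by linarith)⟩
  · obtain ⟨w₀, hw₀, hinit⟩ := hinit
    refine (hnodal N₀ G X hN₀ hdt hRB hSC hX hIA w₀ n (by omega) (by omega) hn hinit D hDc).trans ?_
    exact mul_le_mul_of_nonneg_right (by linarith) (rate_nonneg Q p (G.dt_pos hT).le)
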